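/- Let $n\ge 2$. For patterns $\xi^1,\dots,\xi^p\in\{-1,+1\}^N$ and a state $x\in\{-1,+1\}^N$ put $m^\mu(x)=\frac1N\sum_i\xi^\mu_i x_i$ and $F(x)=N^{-(n-1)}\sum_{\mu}\bigl(\sum_i \xi_i^\mu x_i\bigr)^n$. The discrete local field is $\tilde h_i(x)=F(+1,x_{-i})-F(-1,x_{-i})$ and the formal local field is $h_i(x)=n\sum_\mu \xi_i^\mu (m^\mu(x))^{n-1}$. An asynchronous update of neuron $i$ replaces $x_i$ by the sign of the field at $i$ (no change if the field is $0$); the best-response dynamics uses $\tilde h$. A stored pattern is stable if no best-response update changes it. For a target $\nu$ and constants $\gamma>0$, $\beta<\gamma$, $0\le\Lambda<\gamma^{n-1}$ consider the assumptions - (separation) $|m^\mu(x)|\le\beta$ for all $\mu\ne\nu$ and all states $x$ with $m^\nu(x)\ge\gamma$; - (interference) $\bigl|\sum_{\mu\neq\nu}\xi_i^\mu (m^\mu(x))^{n-1}\bigr|\le\Lambda$ for all $i$ and all states $x$ with $m^\nu(x)\ge\gamma$. We say that $\xi^\nu$ is retrieved from its $\gamma$-basin if, from every state $x$ with $m^\nu(x)\ge\gamma$,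 (i) every sequence of updates in which each neuron occurs at least once ends exactly at $\xi^\nu$, and (ii) for every $\delta>0$, if the updated neurons are chosen independently and uniformly at random, then after $T\ge\log(N/\delta)$ sweeps of $N$ updates each the state is $\xi^\nu$ with probability at least $1-\delta$. 1. (Retrieval guarantee.) If separation and interference hold for the target $\nu$, then $\xi^\nu$ is retrieved from its $\gamma$-basin at every load $p$, in particular for all $p$ up to (and beyond) $N^{n-1}/(4n^2(n-1)^2)$: for the updates by the sign of the formal field this holds for every $N$; for the best-response dynamics it holds whenever $\gamma<1$ and $N\ge N_0(n,\gamma,\Lambda)$. 2. (Failure for random patterns.) Let the $p$ patterns be independent and uniform on $\{-1,+1\}^N$. Uniformly over all $p>2N^{n-1}/n$, the probability that a given stored pattern is stable tends to $0$ as $N\to\infty$. For every fixed $K$, uniformly over all $p$ with $2N^{n-1}/n<p\le N^K$, the expected number of stable stored patterns tends to $0$. 3. (Scaling.) There is a constant $c=c(n)>0$ such that, uniformly over all $p\le cN^{n-1}/(\log N)^n$, the probability that all $p$ independent uniform patterns are stable tends to $1$ as $N\to\infty$. Together with 2, the storage capacity of random patterns is $\Theta(N^{n-1})$ up to a polylogarithmic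 factor. -/

import Mathlib

open scoped BigOperators

noncomputable section

namespace DAM

/-- States (and stored patterns) of a network of `N` neurons: vectors in `{-1, +1}^N`. -/
abbrev State (N : ℕ) : Type := Fin N → ℤˣ

/-- The spin of a neuron as a real number `±1`. -/
def spin (s : ℤˣ) : ℝ := ((s : ℤ) : ℝ)

/-- The normalized overlap `m(ζ, x) = (1/N) ∑ i, ζ i * x i`. -/
def overlap {N : ℕ} (ζ x : State N) : ℝ :=
  (∑ i, spin (ζ i) * spin (x i)) / (N : ℝ)

/-- The potential `F(x) = -E(x) = N^{-(n-1)} ∑ μ, (∑ i, ξ^μ_i x_i)^n`. -/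
def potential (n : ℕ) {N p : ℕ} (ξ : Fin p → State N) (x : State N) : ℝ :=
  (∑ μ, (∑ i, spin (ξ μ i) * spin (x i)) ^ n) / (N : ℝ) ^ (n - 1)

/-- The discrete local field `F(+1, x_{-i}) - F(-1, x_{-i})`. -/
def discreteField (n : ℕ) {N p : ℕ} (ξ : Fin p → State N) (x : State N) (i : Fin N) : ℝ :=
  potential n ξ (Function.update x i 1) - potential n ξ (Function.update x i (-1))

/-- The formal local field `∂F/∂x_i = n ∑ μ, ξ^μ_i (m^μ(x))^{n-1}`. -/
def formalField (n : ℕ) {N p : ℕ} (ξ : Fin p → State N) (x : State N) (i : Fin N) : ℝ :=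
  (n : ℝ) * ∑ μ, spin (ξ μ i) * overlap (ξ μ) x ^ (n - 1)

/-- One asynchronous update `x_i ← sign (h_i(x))` of neuron `i`; a tie `h_i(x) = 0` leaves `x_i`
unchanged. -/
def step {N : ℕ} (h : State N → Fin N → ℝ) (x : State N) (i : Fin N) : State N :=
  Function.update x i (if 0 < h x i then 1 else if h x i < 0 then -1 else x i)

/-- The state reached from `x` by updating the neurons of the list `l` one after the other. -/
def run {N : ℕ} (h : State N → Fin N → ℝ) (x : State N) (l : List (Fin N)) : State N :=
  l.foldl (step h) x

/-- Pattern separation for the target `ν`: at every state whose overlap with the target is at least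
`γ`, all other overlaps are at most `β` in absolute value. -/
def PatternSeparation {N p : ℕ} (ξ : Fin p → State N) (ν : Fin p) (γ β : ℝ) : Prop :=
  ∀ x : State N, γ ≤ overlap (ξ ν) x → ∀ μ : Fin p, μ ≠ ν → |overlap (ξ μ) x| ≤ β

/-- The componentwise interference bound for the target `ν`. -/
def InterferenceBound (n : ℕ) {N p : ℕ} (ξ : Fin p → State N) (ν : Fin p) (γ Λ : ℝ) : Prop :=
  ∀ x : State N, γ ≤ overlap (ξ ν) x → ∀ i : Fin N,
    |∑ μ ∈ Finset.univ.erase ν, spin (ξ μ i) * overlap (ξ μ) x ^ (n - 1)| ≤ Λ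

open Classical in
/-- The probability of an event under the uniform distribution on a finite type. -/
def uniformProb {Ω : Type*} [Fintype Ω] (A : Ω → Prop) : ℝ :=
  ((Finset.univ.filter A).card : ℝ) / (Fintype.card Ω : ℝ)

/-- The retrieval guarantee of the asynchronous dynamics with local field `h` on the basin
`{x | m(ζ, x) ≥ γ}` of the target `ζ`. From every initial state of the basin
* every update sequence in which each neuron occurs (for instance a sweep in any order) ends
  exactly at the target, and
* if every update picks a neuron uniformly at random and independently, then after
  `T ≥ log (N / δ)` sweeps of `N` updates each the state is the target with probability at least
  `1 - δ`. -/
def RetrievalGuarantee {N : ℕ} (h : State N → Fin N → ℝ) (ζ : State N) (γ : ℝ) : Prop :=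
  ∀ x : State N, γ ≤ overlap ζ x →
    (∀ l : List (Fin N), (∀ i, i ∈ l) → run h x l = ζ) ∧
    (∀ δ : ℝ, 0 < δ → ∀ T : ℕ, Real.log ((N : ℝ) / δ) ≤ (T : ℝ) →
      1 - δ ≤ uniformProb (fun s : Fin (T * N) → Fin N => run h x (List.ofFn s) = ζ))

/-- The stored pattern `ν` is a fixed point of the asynchronous best-response dynamics. -/
def IsStable (n : ℕ) {N p : ℕ} (ξ : Fin p → State N) (ν : Fin p) : Prop :=
  ∀ i : Fin N, step (discreteField n ξ) (ξ ν) i = ξ ν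

open Classical in
/-- The expected number of stable stored patterns among `p` independent uniformly random patterns
in `{-1, +1}^N`. -/
def expectedStable (n N p : ℕ) : ℝ :=
  (∑ ξ : Fin p → State N, ((Finset.univ.filter (fun ν => IsStable n ξ ν)).card : ℝ)) /
    (Fintype.card (Fin p → State N) : ℝ)

end DAM

end

open scoped BigOperators

namespace DAM

/-! Retrieval. If the field points to the target throughout the basin, no update lowers the overlap,
so the trajectory stays in the basin and an updated neuron is right for good; random updates then
only have to collect all coupons. For the formal field the sign follows from `Λ < γ ^ (n - 1)`. For
best response, let `S μ` be the overlap sum of pattern `μ` without neuron `i`. The field is a signed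
sum of `(S μ + 1) ^ n - (S μ - 1) ^ n`, that is, of `2 n (S μ) ^ (n - 1)` plus multiples of `(S μ) ^
(n - 3)`, and so on. As the load is arbitrary, the lower terms cannot be bounded pattern by pattern.
They are controlled by the interference bound itself, read as a bound on a polynomial of degree `n -
1` near one vertex of the cube: it extends to the whole cube at the cost of a constant
(`exists_extrapolation`), and then the moment sums of degree `n - 3`, `n - 5`, … gain a factor of
order `1 / N` (`exists_lower_moment_bound`). Since `Λ` may be close to `γ ^ (n - 1)`, the leading
term has to keep its constant up to `1 + O(1 / N)`, even if a flip of `i` leaves the basin; this is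
`exists_average_bound`.

Failure. After a gauge transformation the given pattern is all ones, its signal is at most `2 n N ^
(n - 1)`, and the crosstalk at a neuron is a Rademacher sum of variance at least about `4 n² (2n -
3)!! p N ^ (n - 1)`. As `(2n - 3)!! ≥ n / 2`, with equality for `n = 2`, the standard deviation
reaches the signal at `p = 2 N ^ (n - 1) / n`, with no room to spare; `anticoncentration` therefore
works slightly beyond one standard deviation, with a constant probability. To beat every power of
`N`, about `N ^ (1/4)` neurons are tested together: once their entries are dropped from the overlap
sums, their crosstalks are conditionally independent (`leading_crosstalk_bound`), and the dropped
part is negligible.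

Scaling. Truncating the overlap sums at order `√(N log N)`, applying Hoeffding to the signs at one
neuron and taking a union bound gives `exists_all_stable`. -/

@[simp] lemma spin_one : spin 1 = 1 := by simp [spin]
@[simp] lemma spin_neg_one : spin (-1) = -1 := by simp [spin]
lemma spin_mul (a b : ℤˣ) : spin (a * b) = spin a * spin b := by simp [spin]
lemma spin_neg (a : ℤˣ) : spin (-a) = -spin a := by simp [spin]
@[simp] lemma spin_mul_self (a : ℤˣ) : spin a * spin a = 1 := by
  rcases Int.units_eq_one_or a with rfl | rfl <;> simp
@[simp] lemma spin_sq (a : ℤˣ) : spin a ^ 2 = 1 := by rw [sq, spin_mul_self]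
@[simp] lemma abs_spin (a : ℤˣ) : |spin a| = 1 := by
  rcases Int.units_eq_one_or a with rfl | rfl <;> simp
lemma spin_le_one (a : ℤˣ) : spin a ≤ 1 := (le_abs_self _).trans (abs_spin a).le
lemma neg_one_le_spin (a : ℤˣ) : -1 ≤ spin a := by
  have := neg_abs_le (spin a); rwa [abs_spin] at this

/-- The average of a function on a finite type. -/
noncomputable def mean {Ω : Type*} [Fintype Ω] (f : Ω → ℝ) : ℝ :=
  (∑ ω, f ω) / (Fintype.card Ω : ℝ)

/-! ### Uniform averages and probabilities on finite types. -/

section Mean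

variable {Ω Ω' : Type*} [Fintype Ω] [Fintype Ω']

open Classical in
lemma uniformProb_eq_mean (A : Ω → Prop) :
    uniformProb A = mean (fun ω => if A ω then (1 : ℝ) else 0) := by
  simp [uniformProb, mean]

lemma mean_mono {f g : Ω → ℝ} (h : ∀ ω, f ω ≤ g ω) : mean f ≤ mean g := by
  unfold mean
  gcongr with ω
  exact h ω

lemma mean_nonneg {f : Ω → ℝ} (h : ∀ ω, 0 ≤ f ω) : 0 ≤ mean f :=
  div_nonneg (Finset.sum_nonneg fun ω _ => h ω) (Nat.cast_nonneg _)

lemma mean_add (f g : Ω → ℝ) : mean (fun ω => f ω + g ω) = mean f + mean g := by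
  simp [mean, Finset.sum_add_distrib, add_div]

lemma mean_const_mul (c : ℝ) (f : Ω → ℝ) : mean (fun ω => c * f ω) = c * mean f := by
  simp [mean, ← Finset.mul_sum, mul_div_assoc]

lemma mean_mul_const (f : Ω → ℝ) (c : ℝ) : mean (fun ω => f ω * c) = mean f * c := by
  simp_rw [mul_comm _ c]; exact mean_const_mul c f

lemma mean_const [Nonempty Ω] (c : ℝ) : mean (fun _ : Ω => c) = c := by
  have : (Fintype.card Ω : ℝ) ≠ 0 := by exact_mod_cast Fintype.card_ne_zero
  simp [mean]

lemma mean_sum {ι : Type*} (s : Finset ι) (f : ι → Ω → ℝ) :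
    mean (fun ω => ∑ i ∈ s, f i ω) = ∑ i ∈ s, mean (f i) := by
  simp only [mean]
  rw [Finset.sum_comm, Finset.sum_div]

lemma mean_equiv (e : Ω ≃ Ω') (f : Ω' → ℝ) : mean (fun ω => f (e ω)) = mean f := by
  simp only [mean]
  rw [Fintype.card_congr e, e.sum_comp]

lemma mean_prod (f : Ω × Ω' → ℝ) :
    mean f = mean (fun ω => mean (fun ω' => f (ω, ω'))) := by
  simp only [mean]
  rw [Fintype.sum_prod_type, Fintype.card_prod, ← Finset.sum_div, Nat.cast_mul, div_div, mul_comm]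

lemma mean_comm (f : Ω → Ω' → ℝ) :
    mean (fun ω => mean (fun ω' => f ω ω')) = mean (fun ω' => mean (fun ω => f ω ω')) := by
  simp only [mean]
  rw [← Finset.sum_div, ← Finset.sum_div, Finset.sum_comm, div_right_comm]

/-- Independence: the average of a product over a product space. -/
lemma mean_pi_prod {ι : Type*} [Fintype ι] [DecidableEq ι] (f : ι → Ω → ℝ) :
    mean (fun ω : ι → Ω => ∏ i, f i (ω i)) = ∏ i, mean (f i) := by
  simp only [mean]
  rw [Finset.prod_div_distrib, Finset.prod_univ_sum, Fintype.piFinset_univ]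
  simp

lemma mean_pi_apply {ι : Type*} [Fintype ι] [DecidableEq ι] [Nonempty Ω] (i : ι) (f : Ω → ℝ) :
    mean (fun ω : ι → Ω => f (ω i)) = mean f := by
  have := mean_pi_prod (Ω := Ω) (fun j => if j = i then f else fun _ => 1)
  have h1 : ∀ ω : ι → Ω, ∏ j, (if j = i then f else fun _ => 1) (ω j) = f (ω i) := fun ω => by
    rw [Finset.prod_eq_single i] <;> simp +contextual
  simp only [h1] at this
  rw [this, Finset.prod_eq_single i]
  · simp
  · intro j _ hj; simp [hj, mean_const]
  · simp

lemma uniformProb_nonneg (A : Ω → Prop) : 0 ≤ uniformProb A := by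
  unfold uniformProb; positivity

lemma uniformProb_mono {A B : Ω → Prop} (h : ∀ ω, A ω → B ω) :
    uniformProb A ≤ uniformProb B := by
  unfold uniformProb
  gcongr with ω
  exact h _

lemma uniformProb_le_one (A : Ω → Prop) : uniformProb A ≤ 1 := by
  classical
  unfold uniformProb
  apply div_le_one_of_le₀ _ (Nat.cast_nonneg _)
  exact_mod_cast Finset.card_le_univ _

lemma uniformProb_or_le (A B : Ω → Prop) :
    uniformProb (fun ω => A ω ∨ B ω) ≤ uniformProb A + uniformProb B := by
  classical
  simp only [uniformProb_eq_mean, ← mean_add]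
  apply mean_mono
  intro ω
  by_cases hA : A ω <;> by_cases hB : B ω <;> simp [hA, hB]

lemma uniformProb_exists_le {ι : Type*} [Fintype ι] (A : ι → Ω → Prop) :
    uniformProb (fun ω => ∃ i, A i ω) ≤ ∑ i, uniformProb (A i) := by
  classical
  simp only [uniformProb_eq_mean, ← mean_sum]
  apply mean_mono
  intro ω
  split_ifs with h
  · obtain ⟨i, hi⟩ := h
    have := Finset.single_le_sum (f := fun i => if A i ω then (1 : ℝ) else 0)
      (fun j _ => by split_ifs <;> simp) (Finset.mem_univ i)
    simpa [hi] using this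
  · exact Finset.sum_nonneg fun j _ => by split_ifs <;> simp

lemma uniformProb_not [Nonempty Ω] (A : Ω → Prop) :
    uniformProb (fun ω => ¬ A ω) = 1 - uniformProb A := by
  classical
  rw [eq_sub_iff_add_eq]
  simp only [uniformProb_eq_mean, ← mean_add]
  refine Eq.trans ?_ (mean_const (Ω := Ω) 1)
  congr 1; ext ω
  by_cases h : A ω <;> simp [h]

/-- Markov's inequality. -/
lemma uniformProb_le_div_of_le (f : Ω → ℝ) (hf : ∀ ω, 0 ≤ f ω) {t : ℝ} (ht : 0 < t)
    {A : Ω → Prop} (hA : ∀ ω, A ω → t ≤ f ω) : uniformProb A ≤ mean f / t := by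
  classical
  rw [uniformProb_eq_mean, le_div_iff₀ ht, ← mean_mul_const]
  apply mean_mono
  intro ω
  split_ifs with h
  · simpa using hA ω h
  · simpa using hf ω

lemma uniformProb_pi_forall {ι : Type*} [Fintype ι] [DecidableEq ι] (A : ι → Ω → Prop) :
    uniformProb (fun ω : ι → Ω => ∀ i, A i (ω i)) = ∏ i, uniformProb (A i) := by
  classical
  simp only [uniformProb_eq_mean]
  rw [← mean_pi_prod]
  congr 1; ext ω
  rw [Finset.prod_ite_zero]
  simp

end Mean

/-! ### From the sign of the field to retrieval. -/

section Retrieval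

variable {N : ℕ} {h : State N → Fin N → ℝ} {ζ : State N} {γ : ℝ}

lemma overlap_update_target (x : State N) (i : Fin N) :
    overlap ζ x ≤ overlap ζ (Function.update x i (ζ i)) := by
  unfold overlap
  refine div_le_div_of_nonneg_right (Finset.sum_le_sum fun j _ => ?_) (Nat.cast_nonneg _)
  by_cases hj : j = i
  · subst hj
    rw [Function.update_self, spin_mul_self, ← spin_mul]
    exact spin_le_one _
  · rw [Function.update_of_ne hj]

lemma step_eq_of_pos {x : State N} {i : Fin N} (H : 0 < spin (ζ i) * h x i) :
    step h x i = Function.update x i (ζ i) := by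
  unfold step
  rcases Int.units_eq_one_or (ζ i) with h1 | h1
  · rw [h1] at H ⊢
    simp only [spin_one, one_mul] at H
    simp [H]
  · rw [h1] at H ⊢
    simp only [spin_neg_one, neg_mul, one_mul, Left.neg_pos_iff] at H
    simp [H, H.le.not_gt]

/-- By `overlap_update_target` the trajectory never leaves the basin, so every update writes the
target's sign and no later update undoes it. -/
lemma run_eq_of_pos (H : ∀ x, γ ≤ overlap ζ x → ∀ i, 0 < spin (ζ i) * h x i)
    (l : List (Fin N)) : ∀ x, γ ≤ overlap ζ x →
      run h x l = fun i => if i ∈ l then ζ i else x i := by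
  induction l with
  | nil => intro x _; simp [run]
  | cons a l ih =>
    intro x hx
    have h1 : run h x (a :: l) = run h (step h x a) l := rfl
    rw [h1, step_eq_of_pos (H x hx a), ih _ (hx.trans (overlap_update_target x a))]
    funext i
    by_cases hil : i ∈ l
    · simp [hil]
    · by_cases hia : i = a
      · subst hia; simp
      · simp [hil, hia]

lemma uniformProb_not_mem_range {N M : ℕ} (i : Fin N) :
    uniformProb (fun s : Fin M → Fin N => ∀ t, s t ≠ i) = (1 - 1 / (N : ℝ)) ^ M := by
  classical
  have hN : 0 < N := i.pos
  have : Nonempty (Fin N) := ⟨i⟩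
  rw [uniformProb_pi_forall (Ω := Fin N) (fun (_ : Fin M) ω => ω ≠ i)]
  rw [Finset.prod_const, Finset.card_univ, Fintype.card_fin, uniformProb_not]
  have : (Finset.univ.filter fun ω : Fin N => ω = i).card = 1 := by
    rw [Finset.filter_eq']; simp
  simp only [uniformProb, Fintype.card_fin]
  congr 3
  convert congrArg (Nat.cast (R := ℝ)) this
  simp

/-- If the field points to the target at every state of the basin, the target is retrieved. -/
lemma retrievalGuarantee_of_pos (hγ : 0 < γ)
    (H : ∀ x, γ ≤ overlap ζ x → ∀ i, 0 < spin (ζ i) * h x i) : RetrievalGuarantee h ζ γ := by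
  intro x hx
  have key : ∀ l : List (Fin N), (∀ i, i ∈ l) → run h x l = ζ := by
    intro l hl
    rw [run_eq_of_pos H l x hx]
    funext i
    simp [hl i]
  refine ⟨key, fun δ hδ T hT => ?_⟩
  -- Without neurons the overlap is `0 / 0 = 0 < γ`, so the basin is empty.
  rcases Nat.eq_zero_or_pos N with hN | hN
  · subst hN
    simp [overlap] at hx
    linarith
  have : Nonempty (Fin N) := ⟨⟨0, hN⟩⟩
  have hNR : (0 : ℝ) < N := by exact_mod_cast hN
  have hN1 : (1 : ℝ) ≤ N := by exact_mod_cast hN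
  -- Coupon collecting: a failed run has missed some neuron, and `N * (1 - 1 / N) ^ (T * N) ≤ N *
  -- exp (-T) ≤ δ`.
  have h1 : uniformProb (fun s : Fin (T * N) → Fin N => ¬ (run h x (List.ofFn s) = ζ)) ≤
      ∑ i : Fin N, uniformProb (fun s : Fin (T * N) → Fin N => ∀ t, s t ≠ i) := by
    refine (uniformProb_mono fun s hs => ?_).trans (uniformProb_exists_le _)
    by_contra! hcon
    refine hs (key _ fun i => ?_)
    obtain ⟨t, ht⟩ := hcon i
    exact (List.mem_ofFn' _ _).2 ⟨t, ht⟩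
  rw [uniformProb_not] at h1
  simp only [uniformProb_not_mem_range, Finset.sum_const, Finset.card_univ, Fintype.card_fin,
    nsmul_eq_mul] at h1
  have h2 : (1 - 1 / (N : ℝ)) ^ (T * N) ≤ Real.exp (-T) := by
    have h3 : 1 - 1 / (N : ℝ) ≤ Real.exp (-(1 / N)) := by
      have := Real.add_one_le_exp (-(1 / (N : ℝ))); linarith
    have h4 : 0 ≤ 1 - 1 / (N : ℝ) := by
      rw [sub_nonneg, div_le_one hNR]; exact hN1
    refine (pow_le_pow_left₀ h4 h3 _).trans_eq ?_
    rw [← Real.exp_nat_mul]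
    congr 1
    push_cast
    field_simp
  have h5 : Real.exp (-T) ≤ δ / N := by
    rw [Real.exp_neg, ← inv_div]
    apply inv_anti₀ (by positivity)
    rwa [← Real.log_le_iff_le_exp (by positivity)]
  have h6 : (N : ℝ) * (1 - 1 / (N : ℝ)) ^ (T * N) ≤ δ := by
    calc (N : ℝ) * (1 - 1 / (N : ℝ)) ^ (T * N) ≤ N * (δ / N) := by gcongr; exact h2.trans h5
      _ = δ := by field_simp
  linarith

/-- Multiplied by the target's sign and divided by `n`, the field has a target term of at least `γ ^
(n - 1)` and an interference of at least `-Λ`. -/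
lemma formalField_pos {n p : ℕ} (hn : 2 ≤ n) {ξ : Fin p → State N} {ν : Fin p} {Λ : ℝ}
    (hγ : 0 < γ) (hΛ : Λ < γ ^ (n - 1)) (hI : InterferenceBound n ξ ν γ Λ) (x : State N)
    (hx : γ ≤ overlap (ξ ν) x) (i : Fin N) : 0 < spin (ξ ν i) * formalField n ξ x i := by
  unfold formalField
  rw [← Finset.add_sum_erase _ _ (Finset.mem_univ ν)]
  have h1 := hI x hx i
  set Y := ∑ μ ∈ Finset.univ.erase ν, spin (ξ μ i) * overlap (ξ μ) x ^ (n - 1)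
  have h2 : γ ^ (n - 1) ≤ overlap (ξ ν) x ^ (n - 1) := pow_le_pow_left₀ hγ.le hx _
  have h3 : |spin (ξ ν i) * Y| ≤ Λ := by rwa [abs_mul, abs_spin, one_mul]
  have h4 := (abs_le.1 h3).1
  have hn0 : (0 : ℝ) < n := by positivity
  have : spin (ξ ν i) * ((n : ℝ) * (spin (ξ ν i) * overlap (ξ ν) x ^ (n - 1) + Y)) =
      n * (overlap (ξ ν) x ^ (n - 1) + spin (ξ ν i) * Y) := by
    linear_combination (n : ℝ) * overlap (ξ ν) x ^ (n - 1) * spin_mul_self (ξ ν i)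
  rw [this]
  apply mul_pos hn0
  linarith

end Retrieval

/-! ### Set functions of bounded degree. -/

section SetDegree

variable {ι : Type*}

/-- The set function `h` is a multilinear polynomial of degree at most `d` in the indicators. -/
def SetDegreeLE (d : ℕ) (h : Finset ι → ℝ) : Prop :=
  ∃ Δ : Finset ι → ℝ, (∀ K, d < K.card → Δ K = 0) ∧ ∀ R, h R = ∑ K ∈ R.powerset, Δ K

lemma SetDegreeLE.const (c : ℝ) : SetDegreeLE 0 (fun _ : Finset ι => c) := by
  classical
  refine ⟨fun K => if K = ∅ then c else 0, fun K hK => ?_, fun R => ?_⟩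
  · have : K ≠ ∅ := by rintro rfl; simp at hK
    simp [this]
  · simp

lemma SetDegreeLE.sum {d : ℕ} {κ : Type*} (s : Finset κ) (a : κ → ℝ) {h : κ → Finset ι → ℝ}
    (H : ∀ μ, SetDegreeLE d (h μ)) : SetDegreeLE d (fun R => ∑ μ ∈ s, a μ * h μ R) := by
  choose Δ h1 h2 using H
  refine ⟨fun K => ∑ μ ∈ s, a μ * Δ μ K, fun K hK => ?_, fun R => ?_⟩
  · exact Finset.sum_eq_zero fun μ _ => by rw [h1 μ K hK, mul_zero]
  · rw [Finset.sum_comm]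
    exact Finset.sum_congr rfl fun μ _ => by rw [h2, Finset.mul_sum]

variable [DecidableEq ι]

/-- Indicators are idempotent: the monomial of `K` times that of `j` is the monomial of `insert j
K`. For `j ∈ K`, the monomials sent to that of `K` are those of `K` and `K.erase j`. -/
lemma SetDegreeLE.mul_affine {d : ℕ} {h : Finset ι → ℝ} (H : SetDegreeLE d h) (s : ℝ)
    (b : ι → ℝ) : SetDegreeLE (d + 1) (fun R => h R * (s + ∑ j ∈ R, b j)) := by
  obtain ⟨Δ, h1, h2⟩ := H
  refine ⟨fun K => s * Δ K + ∑ j ∈ K, b j * (Δ K + Δ (K.erase j)), fun K hK => ?_, fun R => ?_⟩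
  · beta_reduce
    rw [h1 K (by omega), mul_zero, zero_add]
    refine Finset.sum_eq_zero fun j hj => ?_
    rw [h1 _ (by rw [Finset.card_erase_of_mem hj]; omega)]
    simp
  · have key : ∀ j ∈ R, ∑ K ∈ R.powerset, Δ K =
        ∑ K ∈ R.powerset.filter (fun K => j ∈ K), (Δ K + Δ (K.erase j)) := by
      intro j hj
      rw [Finset.sum_add_distrib,
        ← Finset.sum_filter_add_sum_filter_not R.powerset (fun K => j ∈ K)]
      congr 1
      refine Finset.sum_nbij' (fun K => insert j K) (fun K => K.erase j) ?_ ?_ ?_ ?_ ?_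
      · intro K hK
        simp only [Finset.mem_filter, Finset.mem_powerset] at hK ⊢
        exact ⟨Finset.insert_subset hj hK.1, Finset.mem_insert_self _ _⟩
      · intro K hK
        simp only [Finset.mem_filter, Finset.mem_powerset] at hK ⊢
        exact ⟨(Finset.erase_subset _ _).trans hK.1, Finset.notMem_erase _ _⟩
      · intro K hK
        simp only [Finset.mem_filter] at hK
        exact Finset.erase_insert hK.2
      · intro K hK
        simp only [Finset.mem_filter] at hK
        exact Finset.insert_erase hK.2
      · intro K hK
        simp only [Finset.mem_filter] at hK
        rw [Finset.erase_insert hK.2]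
    beta_reduce
    rw [h2 R, mul_add, Finset.sum_add_distrib, ← Finset.mul_sum, mul_comm _ s]
    congr 1
    rw [Finset.mul_sum]
    rw [Finset.sum_congr rfl fun j hj => by rw [key j hj, Finset.sum_filter, Finset.sum_mul],
      Finset.sum_comm]
    refine Finset.sum_congr rfl fun K hK => ?_
    rw [Finset.mem_powerset] at hK
    rw [← Finset.sum_subset hK]
    · exact Finset.sum_congr rfl fun j hj => by rw [if_pos hj, mul_comm]
    · intro j _ hj; rw [if_neg hj, zero_mul]

lemma SetDegreeLE.affine_pow (d : ℕ) (s : ℝ) (b : ι → ℝ) :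
    SetDegreeLE d (fun R => (s + ∑ j ∈ R, b j) ^ d) := by
  induction d with
  | zero => simpa using SetDegreeLE.const (ι := ι) 1
  | succ d ih => simpa only [pow_succ] using ih.mul_affine s b

/-- A set function of degree at most `d` is controlled by its values on small sets. -/
lemma SetDegreeLE.abs_le [Fintype ι] {d : ℕ} {h : Finset ι → ℝ} (H : SetDegreeLE d h) {B : ℝ}
    (hB : ∀ R, R.card ≤ d → |h R| ≤ B) (R : Finset ι) :
    |h R| ≤ 2 ^ Fintype.card ι * (2 ^ Fintype.card ι) ^ Fintype.card ι * B := by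
  obtain ⟨Δ, h1, h2⟩ := H
  set D := Fintype.card ι
  have hB0 : 0 ≤ B := (abs_nonneg _).trans (hB ∅ (by simp))
  set A : ℝ := 2 ^ D with hA
  have hA1 : 1 ≤ A := one_le_pow₀ (by norm_num)
  have hpc : ∀ K : Finset ι, ((K.powerset.card : ℕ) : ℝ) ≤ A := by
    intro K
    rw [Finset.card_powerset, hA]
    push_cast
    exact pow_le_pow_right₀ (by norm_num) (Finset.card_le_univ K)
  -- Möbius inversion: `Δ K` is `h K` minus at most `A - 1` coefficients of proper subsets, so each
  -- further element of `K` costs one factor `A`.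
  have key : ∀ K : Finset ι, |Δ K| ≤ A ^ K.card * B := by
    intro K
    induction K using Finset.strongInduction with
    | H K ih =>
      rcases le_or_gt K.card d with hK | hK
      · rcases Finset.eq_empty_or_nonempty K with rfl | hne
        · have := hB ∅ (by simp)
          rw [h2 ∅] at this
          simpa using this
        · have hcard : 1 ≤ K.card := hne.card_pos
          have hself : K ∈ K.powerset := Finset.mem_powerset_self K
          have e1 : Δ K = h K - ∑ K' ∈ K.powerset.erase K, Δ K' := by
            rw [h2 K, ← Finset.add_sum_erase _ _ hself]; ring
          have e2 : |∑ K' ∈ K.powerset.erase K, Δ K'| ≤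
              (K.powerset.erase K).card • (A ^ (K.card - 1) * B) := by
            refine (Finset.abs_sum_le_sum_abs _ _).trans (Finset.sum_le_card_nsmul _ _ _ ?_)
            intro K' hK'
            rw [Finset.mem_erase, Finset.mem_powerset] at hK'
            have hss : K' ⊂ K := hK'.2.ssubset_of_ne hK'.1
            refine (ih K' hss).trans ?_
            have := Finset.card_lt_card hss
            gcongr
            omega
          have e3 : ((K.powerset.erase K).card : ℝ) + 1 ≤ A := by
            have := hpc K
            rw [Finset.card_erase_of_mem hself]
            have h0 : 1 ≤ K.powerset.card := Finset.card_pos.2 ⟨K, hself⟩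
            push_cast [h0]
            linarith
          have e4 : B ≤ A ^ (K.card - 1) * B := le_mul_of_one_le_left hB0 (one_le_pow₀ hA1)
          rw [nsmul_eq_mul] at e2
          rw [e1]
          refine (abs_sub _ _).trans ?_
          have e5 : A ^ K.card = A * A ^ (K.card - 1) := by
            rw [← pow_succ']; congr 1; omega
          rw [e5, mul_assoc]
          have e6 : 0 ≤ A ^ (K.card - 1) * B := by positivity
          have := hB K hK
          nlinarith
      · rw [h1 K hK, abs_zero]
        positivity
  rw [h2 R, mul_assoc]
  refine (Finset.abs_sum_le_sum_abs _ _).trans ?_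
  refine (Finset.sum_le_card_nsmul _ _ (A ^ D * B) fun K _ => (key K).trans ?_).trans ?_
  · gcongr
    exact Finset.card_le_univ K
  · rw [nsmul_eq_mul]
    gcongr
    exact hpc R

/-- Averaging over random subsets of `Q` in which every element is kept with weight `s`. -/
lemma sum_weights_moebius (Q : Finset ι) (s : ℝ) (Δ : Finset ι → ℝ) :
    ∑ R ∈ Q.powerset, s ^ R.card * (1 - s) ^ (Q \ R).card * ∑ K ∈ R.powerset, Δ K =
      ∑ K ∈ Q.powerset, s ^ K.card * Δ K := by
  -- For `0 ≤ s ≤ 1` this is the probability that the random subset contains `K`. Expanding a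
  -- product over `Q` with the factor `s` on `K` and `s + (1 - s)` elsewhere proves it for every
  -- `s`.
  have key : ∀ K ∈ Q.powerset, s ^ K.card = ∑ R ∈ Q.powerset,
      if K ⊆ R then s ^ R.card * (1 - s) ^ (Q \ R).card else 0 := by
    intro K hK
    rw [Finset.mem_powerset] at hK
    have h1 := Finset.prod_add (fun _ => s) (fun j => if j ∈ K then 0 else 1 - s) Q
    have h2 : ∏ j ∈ Q, (s + if j ∈ K then 0 else 1 - s) = s ^ K.card := by
      rw [← Finset.prod_subset hK]
      · rw [Finset.prod_congr rfl fun j hj => by rw [if_pos hj, add_zero], Finset.prod_const]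
      · intro j _ hj; rw [if_neg hj]; ring
    rw [← h2, h1]
    refine Finset.sum_congr rfl fun R hR => ?_
    rw [Finset.prod_const]
    split_ifs with hKR
    · rw [Finset.prod_congr rfl fun j hj => if_neg fun hjK => (Finset.mem_sdiff.1 hj).2 (hKR hjK),
        Finset.prod_const]
    · obtain ⟨j, hjK, hjR⟩ := Finset.not_subset.1 hKR
      rw [Finset.prod_eq_zero (Finset.mem_sdiff.2 ⟨hK hjK, hjR⟩)
        (show (if j ∈ K then (0 : ℝ) else 1 - s) = 0 from if_pos hjK), mul_zero]
  have key' : ∀ K ∈ Q.powerset, s ^ K.card * Δ K = ∑ R ∈ Q.powerset,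
      (if K ⊆ R then s ^ R.card * (1 - s) ^ (Q \ R).card else 0) * Δ K := fun K hK => by
    rw [key K hK, Finset.sum_mul]
  rw [Finset.sum_congr rfl key', Finset.sum_comm]
  refine Finset.sum_congr rfl fun R hR => ?_
  rw [Finset.mem_powerset] at hR
  rw [Finset.mul_sum, ← Finset.sum_subset (Finset.powerset_mono.2 hR)]
  · exact Finset.sum_congr rfl fun K hK => by rw [if_pos (Finset.mem_powerset.1 hK)]
  · intro K _ hK
    rw [if_neg fun h => hK (Finset.mem_powerset.2 h), zero_mul]

lemma sum_weights (Q : Finset ι) (s : ℝ) :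
    ∑ R ∈ Q.powerset, s ^ R.card * (1 - s) ^ (Q \ R).card = 1 := by
  have := Finset.prod_add (fun _ : ι => s) (fun _ => 1 - s) Q
  simpa using this.symm

lemma abs_sum_weights_le (Q : Finset ι) {s : ℝ} (h0 : 0 ≤ s) (h1 : s ≤ 1) {h : Finset ι → ℝ}
    {B : ℝ} (hB : ∀ R, R ⊆ Q → |h R| ≤ B) :
    |∑ R ∈ Q.powerset, s ^ R.card * (1 - s) ^ (Q \ R).card * h R| ≤ B := by
  have h1' : 0 ≤ 1 - s := by linarith
  refine (Finset.abs_sum_le_sum_abs _ _).trans ?_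
  calc _ ≤ ∑ R ∈ Q.powerset, s ^ R.card * (1 - s) ^ (Q \ R).card * B := by
        refine Finset.sum_le_sum fun R hR => ?_
        rw [abs_mul, abs_of_nonneg (by positivity)]
        gcongr
        exact hB R (Finset.mem_powerset.1 hR)
    _ = B := by rw [← Finset.sum_mul, sum_weights, one_mul]

/-- The coefficients of a polynomial are controlled by its values on `[0, 1]`. -/
lemma exists_coeff_bound (d : ℕ) : ∃ C : ℝ, 0 ≤ C ∧ ∀ (c : ℕ → ℝ) (B : ℝ),
    (∀ s : ℝ, 0 ≤ s → s ≤ 1 → |∑ k ∈ Finset.range (d + 1), c k * s ^ k| ≤ B) →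
      ∀ k, k ≤ d → |c k| ≤ C * B := by
  classical
  -- Lagrange interpolation at `d + 1` nodes of `[0, 1]` expresses the coefficients through the
  -- values, with weights depending on `d` alone.
  let v : Fin (d + 1) → ℝ := fun i => (i : ℝ) / (d + 1)
  have hv : Function.Injective v := by
    intro i j hij
    have : ((d : ℝ) + 1) ≠ 0 := by positivity
    simp only [v] at hij
    rw [div_left_inj' this] at hij
    exact Fin.ext (by exact_mod_cast hij)
  let L : Fin (d + 1) → Polynomial ℝ := fun i => Lagrange.basis Finset.univ v i
  refine ⟨∑ k ∈ Finset.range (d + 1), ∑ i, |(L i).coeff k|, by positivity, fun c B hB k hk => ?_⟩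
  let P : Polynomial ℝ := ∑ k ∈ Finset.range (d + 1), Polynomial.C (c k) * Polynomial.X ^ k
  have hdeg : P.degree < (Finset.univ : Finset (Fin (d + 1))).card := by
    rw [Finset.card_univ, Fintype.card_fin]
    refine (Polynomial.degree_sum_le _ _).trans_lt ?_
    rw [Finset.sup_lt_iff (WithBot.bot_lt_coe _)]
    intro j hj
    refine (Polynomial.degree_C_mul_X_pow_le _ _).trans_lt ?_
    exact_mod_cast Finset.mem_range.1 hj
  have hP := Lagrange.eq_interpolate (s := Finset.univ) (v := v) hv.injOn hdeg
  have hck : c k = P.coeff k := by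
    simp only [P, Polynomial.finsetSum_coeff, Polynomial.coeff_C_mul, Polynomial.coeff_X_pow]
    rw [Finset.sum_eq_single k]
    · simp
    · intro j _ hj; simp [hj.symm]
    · intro h; exact absurd (Finset.mem_range.2 (by omega)) h
  have heval : ∀ i, |P.eval (v i)| ≤ B := by
    intro i
    have h0 : 0 ≤ v i := by positivity
    have h1 : v i ≤ 1 := by
      have : ((i : ℕ) : ℝ) ≤ d + 1 := by exact_mod_cast i.2.le
      exact div_le_one_of_le₀ this (by positivity)
    have := hB (v i) h0 h1
    simpa [P, Polynomial.eval_finsetSum] using this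
  have hB0 : 0 ≤ B := (abs_nonneg _).trans (heval 0)
  rw [hck, hP, Lagrange.interpolate_apply, Polynomial.finsetSum_coeff]
  calc |∑ i, (Polynomial.C (P.eval (v i)) * L i).coeff k|
      ≤ ∑ i, |(L i).coeff k| * B := by
        refine (Finset.abs_sum_le_sum_abs _ _).trans (Finset.sum_le_sum fun i _ => ?_)
        rw [Polynomial.coeff_C_mul, abs_mul, mul_comm]
        gcongr
        exact heval i
    _ = (∑ i, |(L i).coeff k|) * B := by rw [Finset.sum_mul]
    _ ≤ _ := by
        gcongr
        exact Finset.single_le_sum (f := fun k => ∑ i, |(L i).coeff k|)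
          (fun _ _ => by positivity) (Finset.mem_range.2 (by omega))

/-- Markov-type inequality: the sum of all first differences of a bounded set function of bounded
degree is bounded. -/
lemma exists_first_difference_bound (d : ℕ) : ∃ C : ℝ, 0 ≤ C ∧
    ∀ {ι : Type} [DecidableEq ι] (h : Finset ι → ℝ), SetDegreeLE d h → ∀ (Q : Finset ι) (B : ℝ),
      (∀ R, R ⊆ Q → |h R| ≤ B) → |∑ j ∈ Q, (h {j} - h ∅)| ≤ C * B := by
  obtain ⟨C, hC0, hC⟩ := exists_coeff_bound d
  refine ⟨C, hC0, fun {ι} _ h H Q B hB => ?_⟩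
  obtain ⟨Δ, h1, h2⟩ := H
  have hB0 : 0 ≤ B := (abs_nonneg _).trans (hB ∅ (by simp))
  have hd : ∀ j ∈ Q, h {j} - h ∅ = Δ {j} := by
    intro j _
    have e : ({j} : Finset ι).powerset = {∅, {j}} := by
      ext K; simp [Finset.subset_singleton_iff]
    rw [h2 {j}, h2 ∅, e, Finset.sum_pair (Finset.singleton_ne_empty j).symm]
    simp
  rw [Finset.sum_congr rfl hd]
  rcases Nat.eq_zero_or_pos d with hd0 | hd0
  · rw [Finset.sum_eq_zero fun j _ => h1 _ (by simp [hd0]), abs_zero]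
    positivity
  -- The mean of `h` over random subsets of `Q` of density `s` is a polynomial in `s` of degree at
  -- most `d`. It is bounded by `B` on `[0, 1]`, and its linear coefficient is the sum of the first
  -- differences.
  have := hC (fun k => ∑ K ∈ Q.powersetCard k, Δ K) B (fun s hs0 hs1 => ?_) 1 hd0
  · simpa [Finset.powersetCard_one] using this
  · have e : ∑ k ∈ Finset.range (d + 1), (∑ K ∈ Q.powersetCard k, Δ K) * s ^ k =
        ∑ K ∈ Q.powerset, s ^ K.card * Δ K := by
      rw [← Finset.sum_filter_add_sum_filter_not Q.powerset (fun K => K.card < d + 1)]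
      rw [Finset.sum_eq_zero (s := Q.powerset.filter fun K => ¬ K.card < d + 1), add_zero]
      · rw [← Finset.sum_fiberwise_of_maps_to (g := Finset.card) (t := Finset.range (d + 1))]
        · refine Finset.sum_congr rfl fun k hk => ?_
          rw [Finset.sum_mul]
          refine Finset.sum_congr ?_ fun K hK => ?_
          · ext K
            simp only [Finset.mem_powersetCard, Finset.mem_filter, Finset.mem_powerset]
            rw [Finset.mem_range] at hk
            constructor
            · rintro ⟨a, b⟩; exact ⟨⟨a, by omega⟩, b⟩
            · rintro ⟨⟨a, -⟩, b⟩; exact ⟨a, b⟩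
          · rw [(Finset.mem_filter.1 hK).2, mul_comm]
        · intro K hK
          exact Finset.mem_range.2 (Finset.mem_filter.1 hK).2
      · intro K hK
        rw [h1 K (by have := (Finset.mem_filter.1 hK).2; omega), mul_zero]
    rw [e, ← sum_weights_moebius]
    simp_rw [← h2]
    exact abs_sum_weights_le Q hs0 hs1 hB

end SetDegree

/-! ### Powers of a sum of signs in elementary symmetric functions. -/

section Components

open Polynomial

/-- The generating polynomial of the elementary symmetric functions of `z`. -/
noncomputable def signPoly {N : ℕ} (z : Fin N → ℝ) : ℝ[X] := ∏ j, (1 + C (z j) * X)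

/-- As `z ^ 2 = 1`, one has `1 - X ^ 2 = (1 - z X) (1 + z X)`, so each logarithmic derivative `z /
(1 + z X)` becomes `z - X` after multiplication by `1 - X ^ 2`. Comparing coefficients yields a
three-term recursion for multiplication by `∑ j, z j`. -/
lemma signPoly_derivative {N : ℕ} {z : Fin N → ℝ} (hz : ∀ j, z j ^ 2 = 1) :
    (1 - X ^ 2) * derivative (signPoly z) = (C (∑ j, z j) - C (N : ℝ) * X) * signPoly z := by
  have key : ∀ s : Finset (Fin N), (1 - X ^ 2) * derivative (∏ j ∈ s, (1 + C (z j) * X)) =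
      (C (∑ j ∈ s, z j) - C (s.card : ℝ) * X) * ∏ j ∈ s, (1 + C (z j) * X) := by
    intro s
    induction s using Finset.induction_on with
    | empty => simp
    | insert a s ha ih =>
      rw [Finset.prod_insert ha, Finset.sum_insert ha, Finset.card_insert_of_notMem ha]
      have h1 : (C (z a) : ℝ[X]) ^ 2 = 1 := by rw [← C_pow, hz a, C_1]
      simp only [derivative_mul, derivative_add, derivative_one, derivative_C, derivative_X,
        C_add, Nat.cast_add, Nat.cast_one, C_1] at ih ⊢
      linear_combination (1 + C (z a) * X) * ih -
        (∏ j ∈ s, (1 + C (z j) * X)) * X * h1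
  simpa [signPoly] using key Finset.univ

lemma sum_mul_signPoly_coeff {N : ℕ} {z : Fin N → ℝ} (hz : ∀ j, z j ^ 2 = 1) (k : ℕ) :
    (∑ j, z j) * (signPoly z).coeff (k + 1) =
      (k + 2) * (signPoly z).coeff (k + 2) + (N - k) * (signPoly z).coeff k := by
  have h := congrArg (fun P => P.coeff (k + 1)) (signPoly_derivative hz)
  simp only [sub_mul, one_mul, coeff_sub, mul_assoc, coeff_C_mul, coeff_X_mul, coeff_derivative]
    at h
  rcases k with _ | k
  · simp only [zero_add, coeff_X_pow_mul'] at h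
    norm_num at h ⊢
    linarith
  · have e : k + 1 + 1 = k + 2 := rfl
    rw [e, coeff_X_pow_mul, coeff_derivative] at h
    push_cast at h ⊢
    linarith

lemma sum_mul_signPoly_coeff_zero {N : ℕ} {z : Fin N → ℝ} (hz : ∀ j, z j ^ 2 = 1) :
    (∑ j, z j) * (signPoly z).coeff 0 = (signPoly z).coeff 1 := by
  have h := congrArg (fun P => P.coeff 0) (signPoly_derivative hz)
  simp only [sub_mul, one_mul, coeff_sub, mul_assoc, coeff_derivative, mul_coeff_zero,
    coeff_X_zero] at h
  norm_num at h
  exact h.symm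

/-- The coefficients of `(∑ j, z j) ^ d` in terms of elementary symmetric functions, for signs
`z 0, …, z (N - 1)`. -/
noncomputable def powCoeff (N : ℕ) : ℕ → ℕ → ℝ
  | 0, k => if k = 0 then 1 else 0
  | d + 1, 0 => N * powCoeff N d 1
  | d + 1, k + 1 => (k + 1) * powCoeff N d k + (N - (k + 1)) * powCoeff N d (k + 2)

lemma powCoeff_eq_zero (N : ℕ) {d k : ℕ} (h : d < k) : powCoeff N d k = 0 := by
  induction d generalizing k with
  | zero => simp [powCoeff, h.ne']
  | succ d ih =>
    obtain ⟨k, rfl⟩ : ∃ j, k = j + 1 := ⟨k - 1, by omega⟩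
    rw [powCoeff, ih (by omega), ih (by omega)]
    simp

lemma powCoeff_nonneg {N d : ℕ} (h : d ≤ N) (k : ℕ) : 0 ≤ powCoeff N d k := by
  induction d generalizing k with
  | zero => rw [powCoeff]; split_ifs <;> simp
  | succ d ih =>
    have ih' := ih (by omega)
    rcases k with _ | k
    · rw [powCoeff]
      have := ih' 1
      positivity
    · rw [powCoeff]
      rcases le_or_gt k d with hk | hk
      · have h1 := ih' k
        have h2 := ih' (k + 2)
        have h3 : (0 : ℝ) ≤ N - (k + 1) := by
          rw [sub_nonneg]; exact_mod_cast (by omega : k + 1 ≤ N)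
        positivity
      · rw [powCoeff_eq_zero N hk, powCoeff_eq_zero N (by omega)]
        simp

lemma le_powCoeff_succ {N d : ℕ} (h : d + 1 ≤ N) (k : ℕ) :
    (N - k) * powCoeff N d (k + 1) ≤ powCoeff N (d + 1) k := by
  rcases k with _ | k
  · simp [powCoeff]
  · rw [powCoeff]
    have := powCoeff_nonneg (N := N) (d := d) (by omega) k
    push_cast
    have : 0 ≤ ((k : ℝ) + 1) * powCoeff N d k := by positivity
    linarith

/-- Two multiplications by the sum can lead from `k` up to `k + 1`, with weight `k + 1 ≥ 1`, and
back down, with weight `N - k`; all other contributions are nonnegative. This is the source of the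
gain in `exists_lower_moment_bound`. -/
lemma powCoeff_le_add_two {N d : ℕ} (h : d + 2 ≤ N) (k : ℕ) :
    ((N : ℝ) - d) * powCoeff N d k ≤ powCoeff N (d + 2) k := by
  have h0 := powCoeff_nonneg (N := N) (d := d) (by omega)
  rcases le_or_gt k d with hk | hk
  · have hk' : (k : ℝ) ≤ d := by exact_mod_cast hk
    have hN : (d : ℝ) + 2 ≤ N := by exact_mod_cast h
    have h1 := le_powCoeff_succ (N := N) (d := d + 1) (by omega) k
    have h2 : powCoeff N d k ≤ powCoeff N (d + 1) (k + 1) := by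
      rw [powCoeff]
      have h3 : 0 ≤ ((N : ℝ) - (k + 1)) * powCoeff N d (k + 2) :=
        mul_nonneg (by linarith) (h0 _)
      have h4 : 0 ≤ (k : ℝ) * powCoeff N d k := mul_nonneg (by positivity) (h0 _)
      linarith
    calc ((N : ℝ) - d) * powCoeff N d k ≤ (N - k) * powCoeff N (d + 1) (k + 1) := by
          apply mul_le_mul _ h2 (h0 _) <;> linarith
      _ ≤ _ := h1
  · rw [powCoeff_eq_zero N hk, mul_zero]
    exact powCoeff_nonneg h k

lemma powCoeff_sub_two_mul_le {N d l : ℕ} (h : d < N) (hl : 1 ≤ l) (hld : 2 * l ≤ d) (k : ℕ) :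
    ((N : ℝ) - d) * powCoeff N (d - 2 * l) k ≤ powCoeff N d k := by
  have hN : (d : ℝ) + 1 ≤ N := by exact_mod_cast h
  induction l, hl using Nat.le_induction with
  | base =>
    have := powCoeff_le_add_two (N := N) (d := d - 2) (by omega) k
    rw [show d - 2 + 2 = d by omega] at this
    refine le_trans ?_ this
    have h0 := powCoeff_nonneg (N := N) (d := d - 2) (by omega) k
    have : ((d - 2 : ℕ) : ℝ) ≤ d := by exact_mod_cast (by omega : d - 2 ≤ d)
    gcongr
  | succ l hl ih =>
    refine le_trans ?_ (ih (by omega))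
    have := powCoeff_le_add_two (N := N) (d := d - 2 * (l + 1)) (by omega) k
    rw [show d - 2 * (l + 1) + 2 = d - 2 * l by omega] at this
    have h0 := powCoeff_nonneg (N := N) (d := d - 2 * (l + 1)) (by omega) k
    have h1 : ((d - 2 * (l + 1) : ℕ) : ℝ) ≤ d := by
      exact_mod_cast (by omega : d - 2 * (l + 1) ≤ d)
    have h2 : powCoeff N (d - 2 * (l + 1)) k ≤ powCoeff N (d - 2 * l) k := by
      refine le_trans ?_ this
      apply le_mul_of_one_le_left h0
      linarith
    have h3 : (0 : ℝ) ≤ N - d := by linarith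
    gcongr

lemma sum_pow_eq {N : ℕ} {z : Fin N → ℝ} (hz : ∀ j, z j ^ 2 = 1) (d : ℕ) :
    (∑ j, z j) ^ d = ∑ k ∈ Finset.range (d + 1), powCoeff N d k * (signPoly z).coeff k := by
  induction d with
  | zero =>
    have : (signPoly z).coeff 0 = 1 := by simp [signPoly, coeff_zero_prod]
    simp [powCoeff, this]
  | succ d ih =>
    rw [pow_succ', ih, Finset.mul_sum, Finset.sum_range_succ' _ d]
    have e : ∀ k, (∑ j, z j) * (powCoeff N d (k + 1) * (signPoly z).coeff (k + 1)) =
        powCoeff N d (k + 1) * (k + 2) * (signPoly z).coeff (k + 2) +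
          powCoeff N d (k + 1) * (N - k) * (signPoly z).coeff k := by
      intro k
      linear_combination powCoeff N d (k + 1) * sum_mul_signPoly_coeff hz k
    have e0 : (∑ j, z j) * (powCoeff N d 0 * (signPoly z).coeff 0) =
        powCoeff N d 0 * (signPoly z).coeff 1 := by
      linear_combination powCoeff N d 0 * sum_mul_signPoly_coeff_zero hz
    rw [e0, Finset.sum_congr rfl fun k _ => e k, Finset.sum_add_distrib]
    have r1 : ∑ k ∈ Finset.range d, powCoeff N d (k + 1) * (N - k) * (signPoly z).coeff k =
        ∑ k ∈ Finset.range (d + 2), powCoeff N d (k + 1) * (N - k) * (signPoly z).coeff k := by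
      rw [Finset.sum_range_succ _ (d + 1), Finset.sum_range_succ _ d,
        powCoeff_eq_zero N (by omega : d < d + 1), powCoeff_eq_zero N (by omega : d < d + 1 + 1)]
      simp
    rw [r1, Finset.sum_range_succ' _ (d + 1), Finset.sum_range_succ' _ (d + 1),
      Finset.sum_range_succ' (fun k => powCoeff N (d + 1) (k + 1) * (signPoly z).coeff (k + 1)) d,
      Finset.sum_range_succ' (fun k => powCoeff N d (k + 1 + 1) * (N - ((k + 1 : ℕ) : ℝ)) *
        (signPoly z).coeff (k + 1)) d]
    simp only [powCoeff]
    have s1 : ∑ k ∈ Finset.range d, (((k + 1 : ℕ) + 1 : ℝ) * powCoeff N d (k + 1) +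
        (N - ((k + 1 : ℕ) + 1)) * powCoeff N d (k + 1 + 2)) * (signPoly z).coeff (k + 1 + 1) =
        ∑ k ∈ Finset.range d, powCoeff N d (k + 1) * (k + 2) * (signPoly z).coeff (k + 2) +
        ∑ k ∈ Finset.range d, powCoeff N d (k + 1 + 1 + 1) * (N - ((k + 1 + 1 : ℕ) : ℝ)) *
          (signPoly z).coeff (k + 1 + 1) := by
      rw [← Finset.sum_add_distrib]
      refine Finset.sum_congr rfl fun k _ => ?_
      push_cast
      ring
    rw [s1]
    push_cast
    ring

/-- The noise operator multiplies the component of degree `k` by `(1 - 2s) ^ k`. -/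
lemma sum_weights_signPoly {N : ℕ} (z : Fin N → ℝ) (s : ℝ) (k : ℕ) :
    ∑ R ∈ (Finset.univ : Finset (Fin N)).powerset, s ^ R.card * (1 - s) ^ (Finset.univ \ R).card *
        (signPoly (fun j => if j ∈ R then -z j else z j)).coeff k =
      (1 - 2 * s) ^ k * (signPoly z).coeff k := by
  have h1 := Finset.prod_add (fun j => C s * (1 + C (-z j) * X))
    (fun j => C (1 - s) * (1 + C (z j) * X)) (Finset.univ : Finset (Fin N))
  have h2 : ∏ j, (C s * (1 + C (-z j) * X) + C (1 - s) * (1 + C (z j) * X)) =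
      (signPoly z).comp (C (1 - 2 * s) * X) := by
    rw [signPoly, prod_comp]
    refine Finset.prod_congr rfl fun j _ => ?_
    simp only [add_comp, one_comp, mul_comp, C_comp, X_comp, C_neg, C_sub, C_mul, C_1]
    have : (C (2 : ℝ) : ℝ[X]) = 2 := rfl
    rw [this]
    ring
  have h3 := congrArg (fun P => P.coeff k) (h2.symm.trans h1)
  simp only [comp_C_mul_X_coeff, finsetSum_coeff] at h3
  rw [mul_comm, h3]
  refine Finset.sum_congr rfl fun R hR => ?_
  rw [Finset.prod_mul_distrib, Finset.prod_mul_distrib, Finset.prod_const, Finset.prod_const,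
    mul_mul_mul_comm, ← C_pow, ← C_pow, ← C_mul, coeff_C_mul]
  congr 2
  rw [signPoly, ← Finset.prod_sdiff (Finset.subset_univ R), mul_comm]
  congr 1
  · exact Finset.prod_congr rfl fun j hj => by rw [if_pos hj]
  · exact Finset.prod_congr rfl fun j hj => by rw [if_neg (Finset.mem_sdiff.1 hj).2]

end Components

/-- The unnormalized overlap. -/
noncomputable def pairing {N : ℕ} (ζ x : State N) : ℝ := ∑ i, spin (ζ i) * spin (x i)

/-- The weighted moment sum `∑ μ, a μ (∑ i, η μ i x i) ^ r`. -/
noncomputable def moment {N : ℕ} {κ : Type*} [Fintype κ] (a : κ → ℝ) (η : κ → State N) (r : ℕ)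
    (x : State N) : ℝ := ∑ μ, a μ * pairing (η μ) x ^ r

/-- If the moment sum of degree `d` is bounded on the whole cube, those of degree `d - 2`,
`d - 4`, … are smaller by a factor of order `N`. -/
lemma exists_lower_moment_bound (d : ℕ) : ∃ C : ℝ, 0 ≤ C ∧ ∀ (N : ℕ), d < N →
    ∀ {κ : Type} [Fintype κ] (a : κ → ℝ) (η : κ → State N) (B : ℝ),
      (∀ x, |moment a η d x| ≤ B) →
        ∀ l, 1 ≤ l → 2 * l ≤ d → ∀ x, |moment a η (d - 2 * l) x| ≤ C * B / (N - d) := by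
  obtain ⟨C, hC0, hC⟩ := exists_coeff_bound d
  refine ⟨(d + 1) * C, by positivity, fun N hN κ _ a η B hB l hl hld x => ?_⟩
  have hNd : (0 : ℝ) < N - d := by rw [sub_pos]; exact_mod_cast hN
  have hB0 : 0 ≤ B := (abs_nonneg _).trans (hB x)
  let z : Finset (Fin N) → κ → Fin N → ℝ := fun R μ j =>
    if j ∈ R then -(spin (η μ j) * spin (x j)) else spin (η μ j) * spin (x j)
  have hz : ∀ R μ j, z R μ j ^ 2 = 1 := by
    intro R μ j
    simp only [z]
    split_ifs <;> simp [mul_pow]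
  let y : Finset (Fin N) → State N := fun R j => if j ∈ R then -x j else x j
  have hy : ∀ R μ, pairing (η μ) (y R) = ∑ j, z R μ j := by
    intro R μ
    refine Finset.sum_congr rfl fun j _ => ?_
    simp only [y, z]
    split_ifs <;> simp [spin_neg]
  -- `E k` does not depend on the exponent of the moment, so moments of different degree at `x` are
  -- compared through `powCoeff` alone.
  let E : ℕ → ℝ := fun k => ∑ μ, a μ * (signPoly (z ∅ μ)).coeff k
  have hz0 : ∀ μ j, z ∅ μ j = spin (η μ j) * spin (x j) := fun μ j => by simp [z]
  have hy0 : y ∅ = x := by funext j; simp [y]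
  have hE : ∀ r, moment a η r x = ∑ k ∈ Finset.range (r + 1), powCoeff N r k * E k := by
    intro r
    have : moment a η r x = ∑ μ, a μ * (∑ j, z ∅ μ j) ^ r := by
      simp only [← hy, hy0, moment]
    rw [this]
    simp only [sum_pow_eq (hz ∅ _), E, Finset.mul_sum]
    rw [Finset.sum_comm]
    refine Finset.sum_congr rfl fun k _ => Finset.sum_congr rfl fun μ _ => by ring
  have hpoly : ∀ s : ℝ, ∑ R ∈ (Finset.univ : Finset (Fin N)).powerset,
      s ^ R.card * (1 - s) ^ (Finset.univ \ R).card * moment a η d (y R) =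
      ∑ k ∈ Finset.range (d + 1), (powCoeff N d k * E k) * (1 - 2 * s) ^ k := by
    intro s
    have h1 : ∀ R, moment a η d (y R) = ∑ k ∈ Finset.range (d + 1), ∑ μ,
        a μ * (powCoeff N d k * (signPoly (z R μ)).coeff k) := by
      intro R
      simp only [moment, hy, sum_pow_eq (hz R _), Finset.mul_sum]
      rw [Finset.sum_comm]
    simp only [h1, Finset.mul_sum]
    rw [Finset.sum_comm]
    refine Finset.sum_congr rfl fun k _ => ?_
    rw [Finset.sum_comm]
    simp only [E, Finset.mul_sum, Finset.sum_mul]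
    refine Finset.sum_congr rfl fun μ _ => ?_
    have h2 := sum_weights_signPoly (z ∅ μ) s k
    have h3 : ∀ R, (fun j => if j ∈ R then -z ∅ μ j else z ∅ μ j) = z R μ := by
      intro R; funext j; simp [z]
    simp only [h3] at h2
    have h4 : powCoeff N d k * (a μ * (signPoly (z ∅ μ)).coeff k) * (1 - 2 * s) ^ k =
      powCoeff N d k * a μ * ((1 - 2 * s) ^ k * (signPoly (z ∅ μ)).coeff k) := by ring
    rw [h4, ← h2, Finset.mul_sum]
    refine Finset.sum_congr rfl fun R _ => by ring
  -- The mean of the moment over copies of `x` with correlation `ρ = 1 - 2 s` is a polynomial in `ρ`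
  -- whose coefficients are the components; a bound on `[0, 1]` bounds each of them.
  have hcomp : ∀ k, k ≤ d → |powCoeff N d k * E k| ≤ C * B := by
    apply hC
    intro ρ h0 h1
    have := hpoly ((1 - ρ) / 2)
    rw [show 1 - 2 * ((1 - ρ) / 2) = ρ by ring] at this
    rw [← this]
    exact abs_sum_weights_le _ (by linarith) (by linarith) fun R _ => hB (y R)
  rw [hE]
  have hterm : ∀ k ∈ Finset.range (d - 2 * l + 1),
      |powCoeff N (d - 2 * l) k * E k| ≤ C * B / (N - d) := by
    intro k hk
    rw [Finset.mem_range] at hk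
    have h1 := hcomp k (by omega)
    have h2 := powCoeff_sub_two_mul_le hN hl hld k
    have h3 := powCoeff_nonneg (N := N) (d := d - 2 * l) (by omega) k
    have h4 := powCoeff_nonneg (N := N) (d := d) (by omega) k
    rw [abs_mul, abs_of_nonneg h3]
    rw [abs_mul, abs_of_nonneg h4] at h1
    rw [le_div_iff₀ hNd]
    calc _ = ((N : ℝ) - d) * powCoeff N (d - 2 * l) k * |E k| := by ring
      _ ≤ powCoeff N d k * |E k| := by gcongr
      _ ≤ _ := h1
  refine (Finset.abs_sum_le_sum_abs _ _).trans ((Finset.sum_le_card_nsmul _ _ _ hterm).trans ?_)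
  rw [Finset.card_range, nsmul_eq_mul, mul_div_assoc', mul_assoc]
  have : ((d - 2 * l + 1 : ℕ) : ℝ) ≤ d + 1 := by exact_mod_cast (by omega : d - 2 * l + 1 ≤ d + 1)
  gcongr

/-! ### Interference on the basin, on the cube and at the boundary of the basin. -/

section BestResponse

variable {N : ℕ} {κ : Type} [Fintype κ]

lemma pairing_eq_of_differ {ζ x : State N} (Q : Finset (Fin N)) (h : ∀ j, j ∉ Q → x j = ζ j) :
    (N : ℝ) - 2 * Q.card ≤ pairing ζ x := by
  have : (N : ℝ) - 2 * Q.card = ∑ j, (1 - if j ∈ Q then (2 : ℝ) else 0) := by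
    rw [Finset.sum_sub_distrib, Finset.sum_ite_mem]
    simp [mul_comm]
  rw [this]
  refine Finset.sum_le_sum fun j _ => ?_
  split_ifs with hj
  · rw [← spin_mul]; have := neg_one_le_spin (ζ j * x j); linarith
  · rw [h j hj]; simp

lemma pairing_eq (ζ x : State N) :
    pairing ζ x = N - 2 * (Finset.univ.filter fun j => x j ≠ ζ j).card := by
  have : (N : ℝ) - 2 * (Finset.univ.filter fun j => x j ≠ ζ j).card =
      ∑ j, (1 - if x j ≠ ζ j then (2 : ℝ) else 0) := by
    rw [Finset.sum_sub_distrib, ← Finset.sum_filter]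
    simp [mul_comm]
  rw [this]
  refine Finset.sum_congr rfl fun j _ => ?_
  split_ifs with hj
  · have h : x j = - ζ j := by
      rcases Int.units_eq_one_or (x j) with h1 | h1 <;>
      rcases Int.units_eq_one_or (ζ j) with h2 | h2 <;> simp_all
    rw [h, spin_neg, mul_neg, spin_mul_self]; norm_num
  · rw [not_not] at hj; rw [hj]; simp

lemma pairing_update (ζ x : State N) (i : Fin N) (t : ℤˣ) :
    pairing ζ (Function.update x i t) =
      pairing ζ x - spin (ζ i) * spin (x i) + spin (ζ i) * spin t := by
  unfold pairing
  rw [← Finset.add_sum_erase _ _ (Finset.mem_univ i),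
    ← Finset.add_sum_erase _ (fun j => spin (ζ j) * spin (x j)) (Finset.mem_univ i)]
  rw [Finset.sum_congr rfl fun j hj => by rw [Function.update_of_ne (Finset.ne_of_mem_erase hj)],
    Function.update_self]
  ring

lemma overlap_eq (ζ x : State N) : overlap ζ x = pairing ζ x / N := rfl

/-- A bound for the moment sum near the target extends to the whole cube, at the price of a
constant. -/
lemma exists_extrapolation (d : ℕ) {γ : ℝ} (hγ : γ < 1) : ∃ C : ℝ, 0 ≤ C ∧ ∃ N₀ : ℕ, ∀ N : ℕ,
    N₀ ≤ N → ∀ {κ : Type} [Fintype κ] (a : κ → ℝ) (η : κ → State N) (ζ : State N) (B : ℝ),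
      (∀ x, γ * N ≤ pairing ζ x → |moment a η d x| ≤ B) → ∀ x, |moment a η d x| ≤ C * B := by
  have h1γ : 0 < 1 - γ := by linarith
  obtain ⟨D, hD⟩ := exists_nat_ge (4 * d / (1 - γ) + 1)
  have hD1 : (1 : ℝ) ≤ D := le_trans (by have : 0 ≤ 4 * d / (1 - γ) := by positivity
                                         linarith) hD
  have hD0 : 0 < D := by exact_mod_cast (lt_of_lt_of_le one_pos hD1)
  obtain ⟨N₀, hN₀⟩ := exists_nat_ge (4 * d / (1 - γ))
  refine ⟨2 ^ D * (2 ^ D) ^ D, by positivity, N₀, fun N hN κ _ a η ζ B hB x => ?_⟩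
  let b : Fin N → Fin D := fun j => ⟨j % D, Nat.mod_lt _ hD0⟩
  let y : Finset (Fin D) → State N := fun w j => if b j ∈ w then x j else ζ j
  have hfib : ∀ l : Fin D, (Finset.univ.filter fun j => b j = l).card ≤ N / D + 1 := by
    intro l
    rw [← Finset.card_range (N / D + 1)]
    refine Finset.card_le_card_of_injOn (fun j : Fin N => (j : ℕ) / D) ?_ ?_
    · intro j _
      simp only [Finset.coe_range, Set.mem_Iio]
      have := Nat.div_le_div_right (c := D) j.2.le
      omega
    · intro j hj j' hj' hjj
      simp only [Finset.coe_filter, Finset.mem_univ, true_and, Set.mem_ofPred_eq] at hj hj'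
      have e : (j : ℕ) % D = (j' : ℕ) % D := by
        have := congrArg Fin.val (hj.trans hj'.symm)
        simpa [b] using this
      simp only at hjj
      apply Fin.ext
      rw [← Nat.div_add_mod j D, ← Nat.div_add_mod j' D, hjj, e]
  have hdeg : SetDegreeLE d (fun w => moment a η d (y w)) := by
    have e : (fun w => moment a η d (y w)) = fun w => ∑ μ, a μ * (pairing (η μ) ζ +
        ∑ l ∈ w, ∑ j ∈ Finset.univ.filter (fun j => b j = l),
          spin (η μ j) * (spin (x j) - spin (ζ j))) ^ d := by
      funext w
      refine Finset.sum_congr rfl fun μ _ => ?_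
      congr 2
      rw [Finset.sum_fiberwise_eq_sum_filter, Finset.sum_filter]
      unfold pairing
      rw [← Finset.sum_add_distrib]
      refine Finset.sum_congr rfl fun j _ => ?_
      simp only [y]
      split_ifs
      · ring
      · ring
    rw [e]
    exact SetDegreeLE.sum _ _ fun μ => SetDegreeLE.affine_pow d _ _
  have key := hdeg.abs_le (B := B) ?_ Finset.univ
  · have hy : y Finset.univ = x := by funext j; simp [y]
    rwa [hy, Fintype.card_fin] at key
  · intro w hw
    apply hB
    have h1 := pairing_eq_of_differ (ζ := ζ) (x := y w) (Finset.univ.filter fun j => b j ∈ w)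
      (fun j hj => by
        simp only [Finset.mem_filter, Finset.mem_univ, true_and] at hj
        simp [y, hj])
    refine le_trans ?_ h1
    have h2 : (Finset.univ.filter fun j => b j ∈ w).card ≤ (N / D + 1) * w.card := by
      refine Finset.card_le_mul_card_image_of_maps_to (f := b) (fun j hj => ?_) _ fun l _ => ?_
      · exact (Finset.mem_filter.1 hj).2
      · refine le_trans (Finset.card_le_card ?_) (hfib l)
        intro j hj
        simp only [Finset.mem_filter, Finset.mem_univ, true_and] at hj ⊢
        exact hj.2
    have h3 : ((Finset.univ.filter fun j => b j ∈ w).card : ℝ) ≤ (N / D + 1) * d := by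
      have h4 : ((N / D : ℕ) : ℝ) ≤ N / D := Nat.cast_div_le
      have h5 : (w.card : ℝ) ≤ d := by exact_mod_cast hw
      calc ((Finset.univ.filter fun j => b j ∈ w).card : ℝ)
          ≤ (((N / D : ℕ) : ℝ) + 1) * w.card := by exact_mod_cast h2
        _ ≤ _ := by gcongr
    have hNR : 4 * d / (1 - γ) ≤ (N : ℝ) := hN₀.trans (by exact_mod_cast hN)
    rw [div_le_iff₀ h1γ] at hNR
    have hDR : 4 * d ≤ D * (1 - γ) := by
      rw [← div_le_iff₀ h1γ]; linarith
    have h6 : (N : ℝ) / D * d ≤ N * (1 - γ) / 4 := by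
      rw [div_mul_eq_mul_div, div_le_iff₀ (by linarith)]
      have : (0 : ℝ) ≤ N := Nat.cast_nonneg _
      nlinarith
    nlinarith

/-- Near the target the average over `x i = ±1` of the moment sum obeys almost the same bound as
the moment sum. -/
lemma exists_average_bound (d : ℕ) {γ : ℝ} (hγ : γ < 1) : ∃ C : ℝ, 0 ≤ C ∧ ∃ N₀ : ℕ, ∀ N : ℕ,
    N₀ ≤ N → ∀ {κ : Type} [Fintype κ] (a : κ → ℝ) (η : κ → State N) (ζ : State N) (B : ℝ),
      (∀ x, γ * N ≤ pairing ζ x → |moment a η d x| ≤ B) →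
      ∀ x, γ * N ≤ pairing ζ x → ∀ i,
        |(moment a η d (Function.update x i 1) + moment a η d (Function.update x i (-1))) / 2| ≤
          B + C * B / N := by
  have h1γ : 0 < 1 - γ := by linarith
  obtain ⟨C₁, hC₁, N₁, hext⟩ := exists_extrapolation d hγ
  obtain ⟨C₂, hC₂, hdiff⟩ := exists_first_difference_bound d
  obtain ⟨N₂, hN₂⟩ := exists_nat_ge (16 / (1 - γ))
  refine ⟨C₂ * C₁ * (4 / (1 - γ)), by positivity, max N₁ N₂,
    fun N hN κ _ a η ζ B hB x hx i => ?_⟩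
  have hcube := hext N (le_trans (le_max_left _ _) hN) a η ζ B hB
  have hNR : 16 / (1 - γ) ≤ (N : ℝ) := hN₂.trans (by exact_mod_cast (le_max_right N₁ N₂).trans hN)
  have hN0 : (0 : ℝ) < N := lt_of_lt_of_le (by positivity) hNR
  rw [div_le_iff₀ h1γ] at hNR
  have hB0 : 0 ≤ B := (abs_nonneg _).trans (hB x hx)
  let A : State N → ℝ := fun x =>
    (moment a η d (Function.update x i 1) + moment a η d (Function.update x i (-1))) / 2
  have hAle : ∀ {b : ℝ} (x : State N), (∀ t, |moment a η d (Function.update x i t)| ≤ b) →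
      |A x| ≤ b := by
    intro b x h
    have h1 := abs_le.1 (h 1)
    have h2 := abs_le.1 (h (-1))
    exact abs_le.2 ⟨by simp only [A]; linarith, by simp only [A]; linarith⟩
  -- If the state with the wrong sign at `i` is in the basin, so is the other one, and the average
  -- loses nothing.
  have hbasin : ∀ x : State N, γ * N ≤ pairing ζ (Function.update x i (-ζ i)) → |A x| ≤ B := by
    intro x hx
    refine hAle x fun t => hB _ ?_
    rw [pairing_update] at hx ⊢
    have h1 : spin (ζ i) * spin (-ζ i) = -1 := by rw [spin_neg, mul_neg, spin_mul_self]
    have h2 := neg_one_le_spin (ζ i * t)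
    rw [spin_mul] at h2
    linarith
  change |A x| ≤ _
  have hend : 0 ≤ C₂ * C₁ * (4 / (1 - γ)) * B / N := by positivity
  by_cases hflip : γ * N ≤ pairing ζ (Function.update x i (-ζ i))
  · linarith [hbasin x hflip]
  push Not at hflip
  -- The wrong neurons other than `i`. Correcting one of them gains `2`, which pays for a wrong sign
  -- at `i`, so after a correction the average is at most `B`. The first-difference bound over `Q`
  -- compares these averages with the one at `x`; at the boundary `Q` has order `N` elements, which
  -- makes the error `O(B / N)`.
  let Q : Finset (Fin N) := (Finset.univ.filter fun j => x j ≠ ζ j).erase i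
  have hsmall : pairing ζ x ≤ γ * N + 2 := by
    rw [pairing_update] at hflip
    have h1 : spin (ζ i) * spin (-ζ i) = -1 := by rw [spin_neg, mul_neg, spin_mul_self]
    have h2 := spin_le_one (ζ i * x i)
    rw [spin_mul] at h2
    linarith
  have hQcard : (1 - γ) / 4 * N ≤ Q.card := by
    rw [pairing_eq] at hsmall
    have h1 : (Finset.univ.filter fun j => x j ≠ ζ j).card ≤ Q.card + 1 :=
      Nat.sub_le_iff_le_add.1 Finset.pred_card_le_card_erase
    have h2 : ((Finset.univ.filter fun j => x j ≠ ζ j).card : ℝ) ≤ Q.card + 1 := by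
      exact_mod_cast h1
    linarith
  have hQ0 : (0 : ℝ) < Q.card := lt_of_lt_of_le (by positivity) hQcard
  let y : Finset (Fin N) → State N := fun R j => if j ∈ R then -x j else x j
  have hdeg : SetDegreeLE d (fun R => A (y R)) := by
    have e : (fun R => A (y R)) = fun R => ∑ t : Bool, (1 / 2 : ℝ) * ∑ μ, a μ *
        (pairing (η μ) (Function.update x i (if t then 1 else -1)) +
          ∑ j ∈ R, if j = i then 0 else -2 * (spin (η μ j) * spin (x j))) ^ d := by
      funext R
      have hp : ∀ t μ, pairing (η μ) (Function.update (y R) i t) =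
          pairing (η μ) (Function.update x i t) +
            ∑ j ∈ R, if j = i then 0 else -2 * (spin (η μ j) * spin (x j)) := by
        intro t μ
        rw [← Finset.sum_ite_mem_eq]
        unfold pairing
        rw [← Finset.sum_add_distrib]
        refine Finset.sum_congr rfl fun j _ => ?_
        by_cases hj : j = i
        · subst hj; simp
        · rw [Function.update_of_ne hj, Function.update_of_ne hj]
          simp only [y, if_neg hj]
          split_ifs
          · rw [spin_neg]; ring
          · ring
      simp only [A, moment, hp]
      rw [Fintype.sum_bool]
      simp only [if_true, Bool.false_eq_true, if_false]
      ring
    rw [e]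
    exact SetDegreeLE.sum _ _ fun t => SetDegreeLE.sum _ _ fun μ => SetDegreeLE.affine_pow d _ _
  have hd := hdiff (fun R => A (y R)) hdeg Q (C₁ * B) fun R _ => hAle _ fun t => hcube _
  have hy0 : y ∅ = x := by funext j; simp [y]
  have hyj : ∀ j ∈ Q, |A (y {j})| ≤ B := by
    intro j hj
    simp only [Q, Finset.mem_erase, Finset.mem_filter, Finset.mem_univ, true_and] at hj
    apply hbasin
    have e1 : y {j} = Function.update x j (ζ j) := by
      funext j'
      by_cases h : j' = j
      · subst h
        simp only [y, Finset.mem_singleton, if_true, Function.update_self]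
        rcases Int.units_eq_one_or (x j') with h1 | h1 <;>
        rcases Int.units_eq_one_or (ζ j') with h2 | h2 <;> simp_all
      · simp [y, h]
    have e2 : spin (ζ j) * spin (x j) = -1 := by
      rcases Int.units_eq_one_or (x j) with h1 | h1 <;>
      rcases Int.units_eq_one_or (ζ j) with h2 | h2 <;> simp_all
    rw [pairing_update, e1, pairing_update, Function.update_of_ne hj.1.symm, e2, spin_mul_self,
      spin_neg, mul_neg, spin_mul_self]
    have h2 := spin_le_one (ζ i * x i)
    rw [spin_mul] at h2
    linarith
  rw [Finset.sum_sub_distrib, Finset.sum_const, nsmul_eq_mul, hy0] at hd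
  have hs : |∑ j ∈ Q, A (y {j})| ≤ Q.card * B := by
    refine (Finset.abs_sum_le_sum_abs _ _).trans ((Finset.sum_le_card_nsmul _ _ _ hyj).trans ?_)
    rw [nsmul_eq_mul]
  have h3 : (Q.card : ℝ) * |A x| ≤ Q.card * B + C₂ * (C₁ * B) := by
    rw [← abs_of_pos hQ0, ← abs_mul, abs_of_pos hQ0]
    calc |(Q.card : ℝ) * A x|
        = |∑ j ∈ Q, A (y {j}) - (∑ j ∈ Q, A (y {j}) - Q.card * A x)| := by ring_nf
      _ ≤ _ := (abs_sub _ _).trans (add_le_add hs hd)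
  have h4 : |A x| ≤ B + C₂ * (C₁ * B) / Q.card := by
    rw [← mul_le_mul_iff_right₀ hQ0, mul_add, mul_div_cancel₀ _ hQ0.ne']
    exact h3
  refine h4.trans ?_
  have h5 : C₂ * (C₁ * B) / Q.card ≤ C₂ * (C₁ * B) / ((1 - γ) / 4 * N) := by gcongr
  refine (add_le_add_right h5 B).trans_eq ?_
  field_simp

lemma add_pow_add_sub_pow (S : ℝ) (r : ℕ) :
    ((S + 1) ^ r + (S - 1) ^ r) / 2 =
      ∑ m ∈ Finset.range (r + 1), (r.choose m * ((1 + (-1) ^ (r - m)) / 2)) * S ^ m := by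
  rw [sub_eq_add_neg, add_pow, add_pow, ← Finset.sum_add_distrib, Finset.sum_div]
  refine Finset.sum_congr rfl fun m _ => ?_
  rw [one_pow]; ring

lemma add_pow_sub_sub_pow (S : ℝ) (r : ℕ) :
    (S + 1) ^ r - (S - 1) ^ r =
      ∑ m ∈ Finset.range (r + 1), (r.choose m * (1 - (-1) ^ (r - m))) * S ^ m := by
  rw [sub_eq_add_neg S, add_pow, add_pow, ← Finset.sum_sub_distrib]
  refine Finset.sum_congr rfl fun m _ => ?_
  rw [one_pow]; ring

lemma neg_one_pow_abs_le (k : ℕ) : |(1 - (-1 : ℝ) ^ k)| ≤ 2 ∧ |(1 + (-1 : ℝ) ^ k) / 2| ≤ 1 := by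
  rcases neg_one_pow_eq_or ℝ k with h | h <;> rw [h] <;> norm_num

lemma sum_choose_abs_le (r k : ℕ) (hk : k ≤ r + 1) (e : ℕ → ℝ) (c : ℝ) (hc : 0 ≤ c)
    (D : ℕ → ℝ) (h : ∀ m, m < k → |e m * D m| ≤ c) :
    |∑ m ∈ Finset.range k, (r.choose m * e m) * D m| ≤ 2 ^ r * c := by
  calc |∑ m ∈ Finset.range k, (r.choose m * e m) * D m|
      ≤ ∑ m ∈ Finset.range k, (r.choose m : ℝ) * c := by
        refine (Finset.abs_sum_le_sum_abs _ _).trans (Finset.sum_le_sum fun m hm => ?_)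
        rw [mul_assoc, abs_mul, Nat.abs_cast]
        have := h m (Finset.mem_range.1 hm)
        gcongr
    _ ≤ ∑ m ∈ Finset.range (r + 1), (r.choose m : ℝ) * c := by
        apply Finset.sum_le_sum_of_subset_of_nonneg
        · exact Finset.range_mono hk
        · intros; positivity
    _ = 2 ^ r * c := by
        rw [← Finset.sum_mul]
        congr 1
        exact_mod_cast Nat.sum_range_choose r

lemma sum_choose_abs_le_of_lt (r : ℕ) (e : ℕ → ℝ) (c : ℝ)
    (D : ℕ → ℝ) (h : ∀ m, m < r → |e m * D m| ≤ c) :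
    |∑ m ∈ Finset.range r, (r.choose m * e m) * D m| ≤ (2 ^ r - 1) * c := by
  calc |∑ m ∈ Finset.range r, (r.choose m * e m) * D m|
      ≤ ∑ m ∈ Finset.range r, (r.choose m : ℝ) * c := by
        refine (Finset.abs_sum_le_sum_abs _ _).trans (Finset.sum_le_sum fun m hm => ?_)
        rw [mul_assoc, abs_mul, Nat.abs_cast]
        have := h m (Finset.mem_range.1 hm)
        gcongr
    _ = (2 ^ r - 1) * c := by
        rw [← Finset.sum_mul]
        congr 1
        have : ∑ m ∈ Finset.range (r + 1), (r.choose m : ℝ) = 2 ^ r := by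
          exact_mod_cast Nat.sum_range_choose r
        rw [Finset.sum_range_succ, Nat.choose_self, Nat.cast_one] at this
        linarith

/-- Discrete differences of `∑ μ, a μ (S μ) ^ (d + 1)` in terms of averages of lower powers. -/
lemma exists_difference_bound (d : ℕ) : ∃ C : ℝ, 0 ≤ C ∧
    ∀ {κ : Type} [Fintype κ] (a S : κ → ℝ) (L b : ℝ), 0 ≤ b →
      |∑ μ, a μ * (((S μ + 1) ^ d + (S μ - 1) ^ d) / 2)| ≤ L →
      (∀ l, 1 ≤ l → 2 * l ≤ d →
        |∑ μ, a μ * (((S μ + 1) ^ (d - 2 * l) + (S μ - 1) ^ (d - 2 * l)) / 2)| ≤ b) →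
      |∑ μ, a μ * ((S μ + 1) ^ (d + 1) - (S μ - 1) ^ (d + 1))| ≤ 2 * (d + 1) * L + C * b := by
  set A : ℝ := 2 ^ d with hA
  have hA1 : 1 ≤ A := one_le_pow₀ (by norm_num)
  refine ⟨2 * (d + 1) * (2 ^ d * A ^ d) + 2 ^ (d + 1) * (2 * A ^ d), by positivity,
    fun {κ} _ a S L b hb hL hl => ?_⟩
  let D : ℕ → ℝ := fun r => ∑ μ, a μ * S μ ^ r
  have expand : ∀ r, ∑ μ, a μ * (((S μ + 1) ^ r + (S μ - 1) ^ r) / 2) =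
      ∑ m ∈ Finset.range (r + 1), (r.choose m * ((1 + (-1) ^ (r - m)) / 2)) * D m := by
    intro r
    simp only [add_pow_add_sub_pow, D, Finset.mul_sum]
    rw [Finset.sum_comm]
    exact Finset.sum_congr rfl fun m _ => Finset.sum_congr rfl fun μ _ => by ring
  -- The averages form a unitriangular system in `D r`, `D (r - 2)`, …, which is solved from the
  -- lowest degree upwards.
  have small : ∀ r, r < d → Even (d - r) → |D r| ≤ A ^ r * b := by
    intro r
    induction r using Nat.strong_induction_on with
    | _ r ih =>
      intro hr hev
      obtain ⟨l, hl'⟩ := hev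
      have h1 := hl l (by omega) (by omega)
      rw [show d - 2 * l = r by omega, expand, Finset.sum_range_succ] at h1
      simp only [Nat.choose_self, Nat.cast_one, one_mul, Nat.sub_self, pow_zero] at h1
      norm_num at h1
      rcases Nat.eq_zero_or_pos r with h0 | h0
      · subst h0; simpa using h1
      · have h2 : |∑ m ∈ Finset.range r, (r.choose m * ((1 + (-1) ^ (r - m)) / 2)) * D m| ≤
            (2 ^ r - 1) * (A ^ (r - 1) * b) := by
          refine sum_choose_abs_le_of_lt r (fun m => (1 + (-1) ^ (r - m)) / 2) _ D ?_
          intro m hm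
          rcases Nat.even_or_odd (r - m) with he | ho
          · rw [he.neg_one_pow]
            norm_num
            refine (ih m hm (by omega) ?_).trans ?_
            · obtain ⟨q, hq⟩ := he
              exact ⟨l + q, by omega⟩
            · gcongr
              omega
          · rw [ho.neg_one_pow]
            norm_num
            positivity
        have h3 : b ≤ A ^ (r - 1) * b := le_mul_of_one_le_left hb (one_le_pow₀ hA1)
        have h4 : 2 ^ r * (A ^ (r - 1) * b) ≤ A ^ r * b := by
          have : A ^ r = A * A ^ (r - 1) := by rw [← pow_succ']; congr 1; omega
          rw [this, mul_assoc]
          gcongr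
          rw [hA]
          exact pow_le_pow_right₀ (by norm_num) hr.le
        rw [abs_le] at h1 h2 ⊢
        constructor <;> linarith [h1.1, h1.2, h2.1, h2.2]
  have small' : ∀ r, r < d → Even (d - r) → |D r| ≤ A ^ d * b := fun r hr he =>
    (small r hr he).trans (by gcongr)
  have top : |D d| ≤ L + 2 ^ d * (A ^ d * b) := by
    rw [expand, Finset.sum_range_succ] at hL
    simp only [Nat.choose_self, Nat.cast_one, one_mul, Nat.sub_self, pow_zero] at hL
    norm_num at hL
    have h2 : |∑ m ∈ Finset.range d, (d.choose m * ((1 + (-1) ^ (d - m)) / 2)) * D m| ≤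
        (2 ^ d - 1) * (A ^ d * b) := by
      refine sum_choose_abs_le_of_lt d (fun m => (1 + (-1) ^ (d - m)) / 2) _ D ?_
      intro m hm
      rcases Nat.even_or_odd (d - m) with he | ho
      · rw [he.neg_one_pow]
        norm_num
        exact small' m hm he
      · rw [ho.neg_one_pow]
        norm_num
        positivity
    have h3 : 0 ≤ A ^ d * b := by positivity
    rw [abs_le] at hL h2 ⊢
    constructor <;> linarith [hL.1, hL.2, h2.1, h2.2]
  -- The exponents with `d + 1 - m` even cancel, so besides the leading `D d` only power sums
  -- bounded by `small'` contribute.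
  have e : ∑ μ, a μ * ((S μ + 1) ^ (d + 1) - (S μ - 1) ^ (d + 1)) =
      ∑ m ∈ Finset.range d, ((d + 1).choose m * (1 - (-1) ^ (d + 1 - m))) * D m +
        2 * (d + 1) * D d := by
    have : ∑ μ, a μ * ((S μ + 1) ^ (d + 1) - (S μ - 1) ^ (d + 1)) =
        ∑ m ∈ Finset.range (d + 1 + 1), ((d + 1).choose m * (1 - (-1) ^ (d + 1 - m))) * D m := by
      simp only [add_pow_sub_sub_pow, D, Finset.mul_sum]
      rw [Finset.sum_comm]
      exact Finset.sum_congr rfl fun m _ => Finset.sum_congr rfl fun μ _ => by ring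
    rw [this, Finset.sum_range_succ, Finset.sum_range_succ, Nat.choose_succ_self_right,
      Nat.choose_self, Nat.sub_self, Nat.add_sub_cancel_left]
    push_cast
    ring
  have h5 : |∑ m ∈ Finset.range d, ((d + 1).choose m * (1 - (-1) ^ (d + 1 - m))) * D m| ≤
      2 ^ (d + 1) * (2 * A ^ d * b) := by
    refine sum_choose_abs_le (d + 1) d (by omega) (fun m => 1 - (-1) ^ (d + 1 - m)) _
      (by positivity) D ?_
    intro m hm
    rcases Nat.even_or_odd (d - m) with he | ho
    · rw [abs_mul, mul_assoc]
      exact mul_le_mul (neg_one_pow_abs_le _).1 (small' m hm he) (abs_nonneg _) (by norm_num)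
    · have : Even (d + 1 - m) := by
        rw [show d + 1 - m = d - m + 1 by omega]; exact ho.add_one
      rw [this.neg_one_pow]
      norm_num
      positivity
  rw [e]
  refine (abs_add_le _ _).trans ?_
  rw [abs_mul, abs_of_nonneg (by positivity : (0 : ℝ) ≤ 2 * (d + 1))]
  have : 2 * ((d : ℝ) + 1) * |D d| ≤ 2 * (d + 1) * (L + 2 ^ d * (A ^ d * b)) := by gcongr
  linarith

end BestResponse

/-- The jump of `t ↦ t ^ n` across the interval `[S - 1, S + 1]`. -/
noncomputable def gap (n : ℕ) (S : ℝ) : ℝ := (S + 1) ^ n - (S - 1) ^ n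

lemma gap_ge (n : ℕ) {S : ℝ} (hS : 0 ≤ S) : 2 * n * S ^ (n - 1) ≤ gap n S := by
  rcases n with _ | d
  · simp [gap]
  unfold gap
  rw [add_pow_sub_sub_pow, Finset.sum_range_succ, Finset.sum_range_succ,
    Nat.choose_succ_self_right, Nat.choose_self, Nat.sub_self, Nat.add_sub_cancel_left,
    Nat.add_sub_cancel]
  have : 0 ≤ ∑ m ∈ Finset.range d, ((d + 1).choose m * (1 - (-1) ^ (d + 1 - m))) * S ^ m := by
    refine Finset.sum_nonneg fun m _ => ?_
    have : (0 : ℝ) ≤ 1 - (-1) ^ (d + 1 - m) := by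
      rcases neg_one_pow_eq_or ℝ (d + 1 - m) with h | h <;> rw [h] <;> norm_num
    positivity
  push_cast
  linarith

/-- The part of the overlap of `ζ` and `x` that does not involve the neuron `i`. -/
noncomputable def cavity {N : ℕ} (ζ x : State N) (i : Fin N) : ℝ :=
  pairing ζ x - spin (ζ i) * spin (x i)

lemma pairing_update_eq_cavity {N : ℕ} (ζ x : State N) (i : Fin N) (t : ℤˣ) :
    pairing ζ (Function.update x i t) = cavity ζ x i + spin (ζ i) * spin t :=
  pairing_update ζ x i t

lemma spin_mul_gap (n : ℕ) (s : ℤˣ) (S : ℝ) :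
    (S + spin s) ^ n - (S - spin s) ^ n = spin s * gap n S := by
  unfold gap
  rcases Int.units_eq_one_or s with rfl | rfl
  · simp
  · simp only [spin_neg_one]; ring

lemma discreteField_eq (n : ℕ) {N p : ℕ} (ξ : Fin p → State N) (x : State N) (i : Fin N) :
    discreteField n ξ x i =
      (∑ μ, spin (ξ μ i) * gap n (cavity (ξ μ) x i)) / (N : ℝ) ^ (n - 1) := by
  have h : ∀ t, potential n ξ (Function.update x i t) =
      (∑ μ, (cavity (ξ μ) x i + spin (ξ μ i) * spin t) ^ n) / (N : ℝ) ^ (n - 1) := by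
    intro t
    unfold potential
    congr 1
    refine Finset.sum_congr rfl fun μ _ => ?_
    rw [← pairing_update_eq_cavity]
    rfl
  unfold discreteField
  rw [h, h, ← sub_div, ← Finset.sum_sub_distrib]
  congr 1
  refine Finset.sum_congr rfl fun μ _ => ?_
  rw [← spin_mul_gap]
  simp [sub_eq_add_neg]

lemma avg_moment_eq {N : ℕ} {κ : Type} [Fintype κ] (a : κ → ℝ) (η : κ → State N) (r : ℕ)
    (x : State N) (i : Fin N) :
    (moment a η r (Function.update x i 1) + moment a η r (Function.update x i (-1))) / 2 =
      ∑ μ, a μ * (((cavity (η μ) x i + 1) ^ r + (cavity (η μ) x i - 1) ^ r) / 2) := by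
  unfold moment
  rw [← Finset.sum_add_distrib, Finset.sum_div]
  refine Finset.sum_congr rfl fun μ _ => ?_
  rw [pairing_update_eq_cavity, pairing_update_eq_cavity]
  rcases Int.units_eq_one_or (η μ i) with h | h <;> simp [h] <;> ring

/-- The signal is at least `2 n (γ N - 1) ^ (n - 1)`, the interference at most `2 n Λ N ^ (n - 1) (1
+ O(1 / N))` plus lower moments of order `N ^ (n - 2)`. Divided by `N ^ (n - 1)`, the margin tends
to `2 n (γ ^ (n - 1) - Λ) > 0`, at a rate that involves neither `p` nor the patterns. -/
lemma best_response_pos (n : ℕ) (hn : 2 ≤ n) {γ Λ : ℝ} (hγ0 : 0 < γ) (hγ : γ < 1) (hΛ0 : 0 ≤ Λ)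
    (hΛ : Λ < γ ^ (n - 1)) : ∃ N₀ : ℕ, ∀ N : ℕ, N₀ ≤ N →
      ∀ (p : ℕ) (ξ : Fin p → State N) (ν : Fin p), InterferenceBound n ξ ν γ Λ →
        ∀ x, γ ≤ overlap (ξ ν) x → ∀ i, 0 < spin (ξ ν i) * discreteField n ξ x i := by
  obtain ⟨d, rfl⟩ : ∃ d, n = d + 1 := ⟨n - 1, by omega⟩
  rw [Nat.add_sub_cancel] at hΛ
  obtain ⟨C₁, hC₁, N₁, hext⟩ := exists_extrapolation d hγ
  obtain ⟨C₂, hC₂, hlow⟩ := exists_lower_moment_bound d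
  obtain ⟨C₃, hC₃, N₃, havg⟩ := exists_average_bound d hγ
  obtain ⟨C₄, hC₄, hdiff⟩ := exists_difference_bound d
  have hlim : Filter.Tendsto (fun N : ℕ => 2 * ((d : ℝ) + 1) * (γ - 1 / N) ^ d -
      (2 * (d + 1) * (Λ + C₃ * Λ * (1 / N)) + C₄ * (C₂ * (C₁ * Λ)) * (1 / ((N : ℝ) - d))))
      Filter.atTop (nhds (2 * ((d : ℝ) + 1) * (γ - 0) ^ d -
      (2 * (d + 1) * (Λ + C₃ * Λ * 0) + C₄ * (C₂ * (C₁ * Λ)) * 0))) := by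
    have h1 : Filter.Tendsto (fun N : ℕ => (1 : ℝ) / N) Filter.atTop (nhds 0) :=
      tendsto_one_div_atTop_nhds_zero_nat
    have h2 : Filter.Tendsto (fun N : ℕ => (1 : ℝ) / ((N : ℝ) - d)) Filter.atTop (nhds 0) := by
      simp only [one_div]
      exact Filter.Tendsto.inv_tendsto_atTop
        (Filter.tendsto_atTop_add_const_right _ _ tendsto_natCast_atTop_atTop)
    exact (((tendsto_const_nhds.sub h1).pow d).const_mul _).sub
      (((tendsto_const_nhds.add (h1.const_mul _)).const_mul _).add (h2.const_mul _))
  have hpos : 0 < 2 * ((d : ℝ) + 1) * (γ - 0) ^ d -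
      (2 * (d + 1) * (Λ + C₃ * Λ * 0) + C₄ * (C₂ * (C₁ * Λ)) * 0) := by
    have : 0 < ((d : ℝ) + 1) * (γ ^ d - Λ) := mul_pos (by positivity) (by linarith)
    rw [sub_zero]
    linarith
  obtain ⟨N₅, hN₅⟩ := Filter.eventually_atTop.1 (hlim.eventually (lt_mem_nhds hpos))
  obtain ⟨N₆, hN₆⟩ := exists_nat_ge (1 / γ)
  refine ⟨N₁ + N₃ + N₅ + N₆ + d + 1, fun N hN p ξ ν hI x hx i => ?_⟩
  have hN0 : (0 : ℝ) < N := by exact_mod_cast (by omega : 0 < N)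
  have hNd : (0 : ℝ) < N - d := by
    rw [sub_pos]; exact_mod_cast (by omega : d < N)
  have hfinal := hN₅ N (by omega)
  have hγN : 1 ≤ γ * N := by
    have : 1 / γ ≤ N := hN₆.trans (by exact_mod_cast (by omega : N₆ ≤ N))
    rw [div_le_iff₀ hγ0] at this
    linarith
  -- The weights depend on `i` but not on the state, so for fixed `i` the interference hypothesis
  -- bounds one and the same polynomial on the whole basin.
  let a : Fin p → ℝ := fun μ => if μ = ν then 0 else spin (ξ μ i)
  have hbas : ∀ x, γ * N ≤ pairing (ξ ν) x → |moment a ξ d x| ≤ Λ * N ^ d := by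
    intro x hx
    have h1 := hI x (by rw [overlap_eq, le_div_iff₀ hN0]; exact hx) i
    have h2 : ∑ μ ∈ Finset.univ.erase ν, spin (ξ μ i) * overlap (ξ μ) x ^ (d + 1 - 1) =
        moment a ξ d x / N ^ d := by
      unfold moment
      rw [← Finset.add_sum_erase _ _ (Finset.mem_univ ν)]
      simp only [a, if_true, zero_mul, zero_add, Nat.add_sub_cancel, Finset.sum_div]
      refine Finset.sum_congr rfl fun μ hμ => ?_
      rw [if_neg (Finset.ne_of_mem_erase hμ), overlap_eq, div_pow, mul_div_assoc]
    rw [h2, abs_div, abs_of_pos (pow_pos hN0 d), div_le_iff₀ (pow_pos hN0 d)] at h1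
    exact h1
  rw [overlap_eq, le_div_iff₀ hN0] at hx
  have hcube := hext N (by omega) a ξ (ξ ν) _ hbas
  have hlower := hlow N (by omega) a ξ _ hcube
  have hA := havg N (by omega) a ξ (ξ ν) _ hbas x hx i
  rw [avg_moment_eq] at hA
  have hD := hdiff a (fun μ => cavity (ξ μ) x i) _ (C₂ * (C₁ * (Λ * N ^ d)) / (N - d))
    (by positivity) hA (fun l hl hld => by
      rw [← avg_moment_eq]
      have h1 := abs_le.1 (hlower l hl hld (Function.update x i 1))
      have h2 := abs_le.1 (hlower l hl hld (Function.update x i (-1)))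
      exact abs_le.2 ⟨by linarith, by linarith⟩)
  have hsplit : spin (ξ ν i) * ∑ μ, spin (ξ μ i) * gap (d + 1) (cavity (ξ μ) x i) =
      gap (d + 1) (cavity (ξ ν) x i) + spin (ξ ν i) *
        ∑ μ, a μ * ((cavity (ξ μ) x i + 1) ^ (d + 1) - (cavity (ξ μ) x i - 1) ^ (d + 1)) := by
    rw [← Finset.add_sum_erase _ _ (Finset.mem_univ ν),
      ← Finset.add_sum_erase _ (fun μ => a μ * _) (Finset.mem_univ ν)]
    have h1 : ∑ μ ∈ Finset.univ.erase ν, spin (ξ μ i) * gap (d + 1) (cavity (ξ μ) x i) =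
        ∑ μ ∈ Finset.univ.erase ν, a μ *
          ((cavity (ξ μ) x i + 1) ^ (d + 1) - (cavity (ξ μ) x i - 1) ^ (d + 1)) := by
      refine Finset.sum_congr rfl fun μ hμ => ?_
      simp only [a, if_neg (Finset.ne_of_mem_erase hμ), gap]
    rw [h1]
    simp only [a, if_true, zero_mul, zero_add]
    linear_combination gap (d + 1) (cavity (ξ ν) x i) * spin_mul_self (ξ ν i)
  have hcav : γ * N - 1 ≤ cavity (ξ ν) x i := by
    unfold cavity
    have := spin_le_one (ξ ν i * x i)
    rw [spin_mul] at this
    linarith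
  have hgap : 2 * ((d : ℝ) + 1) * (γ * N - 1) ^ d ≤ gap (d + 1) (cavity (ξ ν) x i) := by
    have h1 := gap_ge (d + 1) (by linarith : 0 ≤ cavity (ξ ν) x i)
    rw [Nat.add_sub_cancel] at h1
    push_cast at h1
    refine le_trans ?_ h1
    have : 0 ≤ γ * N - 1 := by linarith
    gcongr
  rw [discreteField_eq, ← mul_div_assoc, hsplit]
  apply div_pos _ (by positivity)
  have habs : |spin (ξ ν i) *
        ∑ μ, a μ * ((cavity (ξ μ) x i + 1) ^ (d + 1) - (cavity (ξ μ) x i - 1) ^ (d + 1))| ≤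
      2 * (d + 1) * (Λ * N ^ d + C₃ * (Λ * N ^ d) / N) +
        C₄ * (C₂ * (C₁ * (Λ * N ^ d)) / (N - d)) := by
    rw [abs_mul, abs_spin, one_mul]; exact hD
  have hlow' := (abs_le.1 habs).1
  have hmul := mul_pos hfinal (pow_pos hN0 d)
  have e : (2 * ((d : ℝ) + 1) * (γ - 1 / N) ^ d -
      (2 * (d + 1) * (Λ + C₃ * Λ * (1 / N)) + C₄ * (C₂ * (C₁ * Λ)) * (1 / ((N : ℝ) - d)))) * N ^ d =
      2 * ((d : ℝ) + 1) * (γ * N - 1) ^ d -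
      (2 * (d + 1) * (Λ * N ^ d + C₃ * (Λ * N ^ d) / N) +
        C₄ * (C₂ * (C₁ * (Λ * N ^ d)) / (N - d))) := by
    have h1 : (γ * N - 1) ^ d = (γ - 1 / N) ^ d * N ^ d := by
      rw [← mul_pow]; congr 1; field_simp
    rw [h1]
    ring
  rw [e] at hmul
  linarith

/-! ### Rademacher sums: tails, moments, anticoncentration. -/

section Rademacher

lemma sum_update_of_notMem {κ : Type*} [DecidableEq κ] (b : κ → ℝ) (s : Finset κ) {a : κ} (ha : a ∉ s) (ε : κ → ℤˣ) (t : ℤˣ) :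
    ∑ μ ∈ s, b μ * spin (Function.update ε a t μ) = ∑ μ ∈ s, b μ * spin (ε μ) := by
  refine Finset.sum_congr rfl fun μ hμ => ?_
  rw [Function.update_of_ne]
  rintro rfl; exact ha hμ

variable {κ : Type*} [Fintype κ] [DecidableEq κ]

/-- Averaging over a family of bijections does not change an average. -/
lemma mean_eq_mean_mean {Ω G : Type*} [Fintype Ω] [Fintype G] [Nonempty G] (e : G → Ω ≃ Ω)
    (F : Ω → ℝ) : mean F = mean (fun ω => mean (fun g => F (e g ω))) := by
  rw [mean_comm]
  simp only [mean_equiv]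
  rw [mean_const]

lemma mean_units (f : ℤˣ → ℝ) : mean f = (f 1 + f (-1)) / 2 := by
  unfold mean
  rw [show (Finset.univ : Finset ℤˣ) = {1, -1} from rfl, Finset.sum_pair (by decide)]
  rw [show Fintype.card ℤˣ = 2 from rfl]
  norm_num

/-- Independence together with `cosh b ≤ exp (b ^ 2 / 2)`. -/
lemma mean_exp_le (b : κ → ℝ) :
    mean (fun ε : κ → ℤˣ => Real.exp (∑ μ, b μ * spin (ε μ))) ≤
      Real.exp ((∑ μ, b μ ^ 2) / 2) := by
  simp only [Real.exp_sum, Finset.sum_div]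
  rw [mean_pi_prod (fun μ s => Real.exp (b μ * spin s))]
  refine Finset.prod_le_prod (fun μ _ => mean_nonneg fun _ => (Real.exp_pos _).le) fun μ _ => ?_
  rw [mean_units]
  simpa [Real.cosh_eq] using Real.cosh_le_exp_half_sq (b μ)

/-- Hoeffding's inequality. -/
lemma hoeffding (b : κ → ℝ) {V t : ℝ} (hV : 0 < V) (ht : 0 ≤ t) (hb : ∑ μ, b μ ^ 2 ≤ V) :
    uniformProb (fun ε : κ → ℤˣ => t ≤ ∑ μ, b μ * spin (ε μ)) ≤ Real.exp (-(t ^ 2 / (2 * V))) := by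
  refine (uniformProb_le_div_of_le (fun ε => Real.exp (∑ μ, (t / V * b μ) * spin (ε μ)))
    (fun _ => (Real.exp_pos _).le) (Real.exp_pos (t / V * t)) ?_).trans ?_
  · intro ε h
    rw [Real.exp_le_exp]
    simp only [mul_assoc, ← Finset.mul_sum]
    gcongr
  · rw [div_le_iff₀ (Real.exp_pos _), ← Real.exp_add]
    refine (mean_exp_le _).trans ?_
    rw [Real.exp_le_exp]
    simp only [mul_pow, ← Finset.mul_sum]
    have : t ^ 2 / V ^ 2 * ∑ μ, b μ ^ 2 ≤ t ^ 2 / V ^ 2 * V := by gcongr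
    rw [div_pow]
    have e : t ^ 2 / V ^ 2 * V = t ^ 2 / V := by field_simp
    rw [e] at this
    have e2 : -(t ^ 2 / (2 * V)) + t / V * t = t ^ 2 / V / 2 := by field_simp; ring
    rw [e2]
    linarith

lemma mean_neg_spin (F : (κ → ℤˣ) → ℝ) : mean (fun ε => F (-ε)) = mean F :=
  mean_equiv (Equiv.neg (κ → ℤˣ)) F

/-- Khintchine's inequality for even moments. -/
lemma khintchine (m : ℕ) (b : κ → ℝ) :
    mean (fun ε : κ → ℤˣ => (∑ μ, b μ * spin (ε μ)) ^ (2 * m)) ≤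
      4 * (2 * m).factorial * (∑ μ, b μ ^ 2) ^ m := by
  set V := ∑ μ, b μ ^ 2 with hVdef
  have hV0 : 0 ≤ V := Finset.sum_nonneg fun μ _ => sq_nonneg _
  rcases hV0.eq_or_lt with hV | hV
  · have hb : ∀ μ, b μ = 0 := fun μ => by
      have := (Finset.sum_eq_zero_iff_of_nonneg (fun μ _ => sq_nonneg (b μ))).1 hV.symm μ
        (Finset.mem_univ μ)
      simpa using this
    rw [← hV]
    simp only [hb, zero_mul, Finset.sum_const_zero, pow_mul, mean_const]
    rcases Nat.eq_zero_or_pos m with rfl | hm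
    · simp
    · simp [hm.ne']
  have hs : 0 < Real.sqrt V := Real.sqrt_pos.2 hV
  have h1 : ∀ c : ℝ, c ^ 2 = 1 → mean (fun ε : κ → ℤˣ =>
      Real.exp (∑ μ, (c / Real.sqrt V * b μ) * spin (ε μ))) ≤ 2 := by
    intro c hc
    refine (mean_exp_le _).trans ?_
    simp only [mul_pow, div_pow, hc, Real.sq_sqrt hV0, ← Finset.mul_sum]
    rw [← hVdef, one_div, inv_mul_cancel₀ hV.ne']
    have h2 : Real.exp (1 / 2) ^ 2 ≤ 2 ^ 2 := by
      rw [← Real.exp_nat_mul]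
      norm_num
      have := Real.exp_one_lt_d9
      linarith
    exact le_of_sq_le_sq h2 (by norm_num)
  -- For `x = S / √V`, `x ^ (2 m) ≤ (2 m)! exp |x| ≤ (2 m)! (exp x + exp (-x))`; both exponentials
  -- have mean at most `exp (1 / 2) ≤ 2`.
  have h2 : ∀ ε : κ → ℤˣ, (∑ μ, b μ * spin (ε μ)) ^ (2 * m) ≤ ((2 * m).factorial * V ^ m) *
      (Real.exp (∑ μ, (1 / Real.sqrt V * b μ) * spin (ε μ)) +
        Real.exp (∑ μ, (-1 / Real.sqrt V * b μ) * spin (ε μ))) := by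
    intro ε
    set S := ∑ μ, b μ * spin (ε μ)
    have e1 : ∀ c : ℝ, ∑ μ, (c / Real.sqrt V * b μ) * spin (ε μ) = c * (S / Real.sqrt V) := by
      intro c
      simp only [mul_assoc, ← Finset.mul_sum]
      change c / Real.sqrt V * S = _
      ring
    rw [e1, e1]
    set x := S / Real.sqrt V with hx
    have hS : S = x * Real.sqrt V := by rw [hx]; field_simp
    have h3 : x ^ (2 * m) ≤ (2 * m).factorial * Real.exp |x| := by
      have := Real.pow_div_factorial_le_exp |x| (abs_nonneg x) (2 * m)
      rw [div_le_iff₀ (by positivity), (even_two_mul m).pow_abs] at this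
      linarith
    have h4 : Real.exp |x| ≤ Real.exp (1 * x) + Real.exp (-1 * x) := by
      rcases abs_choice x with h | h <;> rw [h]
      · have := Real.exp_pos (-1 * x); rw [one_mul]; linarith
      · have := Real.exp_pos (1 * x); rw [neg_one_mul]; linarith
    have h5 : S ^ (2 * m) = x ^ (2 * m) * V ^ m := by
      rw [hS, mul_pow, pow_mul (Real.sqrt V), Real.sq_sqrt hV0]
    rw [h5]
    calc x ^ (2 * m) * V ^ m ≤ ((2 * m).factorial * Real.exp |x|) * V ^ m := by gcongr
      _ = (2 * m).factorial * V ^ m * Real.exp |x| := by ring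
      _ ≤ _ := by gcongr
  refine (mean_mono h2).trans ?_
  rw [mean_const_mul, mean_add]
  have h3 := h1 1 (by norm_num)
  have h4 := h1 (-1) (by norm_num)
  have : 0 ≤ ((2 * m).factorial * V ^ m) := by positivity
  nlinarith

lemma mean_spin_mul_eq_zero (a : κ) (F : (κ → ℤˣ) → ℝ)
    (hF : ∀ ε, F (Function.update ε a (-ε a)) = F ε) :
    mean (fun ε => spin (ε a) * F ε) = 0 := by
  have hinv : Function.Involutive (fun ε : κ → ℤˣ => Function.update ε a (-ε a)) := by
    intro ε; simp
  have h := mean_equiv hinv.toPerm (fun ε => spin (ε a) * F ε)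
  simp only [Function.Involutive.coe_toPerm, Function.update_self, spin_neg, hF] at h
  have h2 : mean (fun ε : κ → ℤˣ => -spin (ε a) * F ε) =
      -1 * mean (fun ε => spin (ε a) * F ε) := by
    rw [← mean_const_mul]; congr 1; ext ε; ring
  linarith

/-- Terms are added one at a time; odd powers of the new sign average to zero. The constant `3`
matters: it keeps the fourth moment in `anticoncentration` above `3 / 2` times the squared variance.
-/
lemma second_and_fourth_moment (b : κ → ℝ) (s : Finset κ) :
    mean (fun ε : κ → ℤˣ => (∑ μ ∈ s, b μ * spin (ε μ)) ^ 2) = ∑ μ ∈ s, b μ ^ 2 ∧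
    mean (fun ε : κ → ℤˣ => (∑ μ ∈ s, b μ * spin (ε μ)) ^ 4) =
      3 * (∑ μ ∈ s, b μ ^ 2) ^ 2 - 2 * ∑ μ ∈ s, b μ ^ 4 := by
  induction s using Finset.induction_on with
  | empty => simp [mean_const]
  | insert a s ha ih =>
    have hz : ∀ k : ℕ, mean (fun ε : κ → ℤˣ =>
        spin (ε a) * (∑ μ ∈ s, b μ * spin (ε μ)) ^ k) = 0 := fun k =>
      mean_spin_mul_eq_zero a _ fun ε => by rw [sum_update_of_notMem b s ha]
    simp only [Finset.sum_insert ha]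
    constructor
    · have e : ∀ ε : κ → ℤˣ, (b a * spin (ε a) + ∑ μ ∈ s, b μ * spin (ε μ)) ^ 2 =
          (∑ μ ∈ s, b μ * spin (ε μ)) ^ 2 + b a ^ 2 +
            2 * b a * (spin (ε a) * (∑ μ ∈ s, b μ * spin (ε μ)) ^ 1) := by
        intro ε
        linear_combination b a ^ 2 * spin_sq (ε a)
      simp only [e, mean_add, mean_const_mul, hz, mean_const, ih.1]
      ring
    · have e : ∀ ε : κ → ℤˣ, (b a * spin (ε a) + ∑ μ ∈ s, b μ * spin (ε μ)) ^ 4 =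
          (∑ μ ∈ s, b μ * spin (ε μ)) ^ 4 + 6 * b a ^ 2 * (∑ μ ∈ s, b μ * spin (ε μ)) ^ 2 +
            b a ^ 4 + 4 * b a * (spin (ε a) * (∑ μ ∈ s, b μ * spin (ε μ)) ^ 3) +
            4 * b a ^ 3 * (spin (ε a) * (∑ μ ∈ s, b μ * spin (ε μ)) ^ 1) := by
        intro ε
        rcases Int.units_eq_one_or (ε a) with h | h <;> rw [h] <;> simp <;> ring
      simp only [e, mean_add, mean_const_mul, hz, mean_const, ih.1, ih.2]
      ring

/-- The probability bound in `anticoncentration`. -/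
noncomputable def anticoncentrationConst : ℝ := 1 / (8 * (4 * (Nat.factorial 8)))

lemma anticoncentrationConst_pos : 0 < anticoncentrationConst := by
  unfold anticoncentrationConst; positivity

/-- A Rademacher sum without dominating terms is below `-t` with probability bounded from below,
for `t` somewhat larger than its standard deviation. -/
lemma anticoncentration (b : κ → ℝ) {V t : ℝ} (hV : 0 < V) (hb : V ≤ ∑ μ, b μ ^ 2)
    (hb4 : ∑ μ, b μ ^ 4 ≤ V ^ 2 / 2) (ht : t ^ 2 ≤ 3 / 2 * V) :
    anticoncentrationConst ≤ uniformProb (fun ε : κ → ℤˣ => ∑ μ, b μ * spin (ε μ) < -t) := by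
  classical
  set W := ∑ μ, b μ ^ 2 with hW
  have hW0 : 0 < W := hV.trans_le hb
  set M : ℝ := 4 * (Nat.factorial 8) with hM
  have hM0 : 0 < M := by positivity
  let S : (κ → ℤˣ) → ℝ := fun ε => ∑ μ, b μ * spin (ε μ)
  obtain ⟨m2, m4⟩ := second_and_fourth_moment b Finset.univ
  have m8 := khintchine 4 b
  change mean (fun ε => S ε ^ 2) = W at m2
  change mean (fun ε => S ε ^ 4) = 3 * W ^ 2 - _ at m4
  change mean (fun ε => S ε ^ 8) ≤ M * W ^ 4 at m8
  have hlow : 2 * W ^ 2 ≤ mean (fun ε => S ε ^ 4) := by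
    have : V ^ 2 ≤ W ^ 2 := by gcongr
    rw [m4]; linarith
  let I : (κ → ℤˣ) → ℝ := fun ε => if t < |S ε| then 1 else 0
  -- The states with `|S| ≤ t` carry at most `3 / 2 * W ^ 2` of a fourth moment of at least `2 * W ^
  -- 2`. On the others Young's inequality splits `S ^ 4`: the eighth moment takes at most `W ^ 2 /
  -- 4`, and the remaining `W ^ 2 / 4` forces probability at least `1 / (4 * M)`. Symmetry halves it
  -- for one sign.
  have hpt : ∀ ε, S ε ^ 4 ≤ 3 / 2 * W * S ε ^ 2 + (1 / (4 * M * W ^ 2) * S ε ^ 8 +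
      M * W ^ 2 * I ε) := by
    intro ε
    simp only [I]
    have hq : 0 ≤ 1 / (4 * M * W ^ 2) * S ε ^ 8 := by positivity
    split_ifs with h
    · have h1 : S ε ^ 4 ≤ 1 / (4 * M * W ^ 2) * S ε ^ 8 + M * W ^ 2 := by
        have h2 : 0 ≤ 1 / (4 * M * W ^ 2) * (S ε ^ 4 - 2 * M * W ^ 2) ^ 2 := by positivity
        have h3 : 1 / (4 * M * W ^ 2) * (S ε ^ 4 - 2 * M * W ^ 2) ^ 2 =
            1 / (4 * M * W ^ 2) * S ε ^ 8 - S ε ^ 4 + M * W ^ 2 := by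
          field_simp; ring
        linarith
      have : 0 ≤ 3 / 2 * W * S ε ^ 2 := by positivity
      linarith
    · push Not at h
      have h1 : S ε ^ 2 ≤ 3 / 2 * W := by
        rw [← sq_abs]
        have : |S ε| ^ 2 ≤ t ^ 2 := by gcongr
        linarith
      have h2 : S ε ^ 4 ≤ 3 / 2 * W * S ε ^ 2 := by
        have : S ε ^ 4 = S ε ^ 2 * S ε ^ 2 := by ring
        rw [this]; gcongr
      linarith
  have hmean := mean_mono hpt
  simp only [mean_add, mean_const_mul, m2] at hmean
  have hI : 1 / (4 * M) ≤ mean I := by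
    have h1 : 1 / (4 * M * W ^ 2) * mean (fun ε => S ε ^ 8) ≤ W ^ 2 / 4 := by
      calc _ ≤ 1 / (4 * M * W ^ 2) * (M * W ^ 4) := by gcongr
        _ = _ := by field_simp
    have h2 : W ^ 2 / 4 ≤ M * W ^ 2 * mean I := by nlinarith
    rw [div_le_iff₀ (by positivity)]
    have hW2 : 0 < W ^ 2 := by positivity
    rw [← mul_le_mul_iff_right₀ hW2]
    have e1 : W ^ 2 * (mean I * (4 * M)) = 4 * (M * W ^ 2 * mean I) := by ring
    have e2 : W ^ 2 * 1 = 4 * (W ^ 2 / 4) := by ring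
    rw [e1, e2]
    exact mul_le_mul_of_nonneg_left h2 (by norm_num)
  have hsplit : mean I ≤ 2 * uniformProb (fun ε => S ε < -t) := by
    have h1 : uniformProb (fun ε => t < S ε) = uniformProb (fun ε => S ε < -t) := by
      simp only [uniformProb_eq_mean]
      rw [← mean_neg_spin]
      congr 1; ext ε
      have : S (-ε) = - S ε := by
        simp only [S, Pi.neg_apply, spin_neg, mul_neg, Finset.sum_neg_distrib]
      rw [this]
      congr 1
      exact propext lt_neg
    have h2 : mean I = uniformProb (fun ε => t < |S ε|) := by
      simp only [uniformProb_eq_mean, I]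
    have h3 : uniformProb (fun ε => t < |S ε|) ≤ uniformProb (fun ε => t < S ε ∨ S ε < -t) := by
      apply uniformProb_mono
      intro ε h
      rcases lt_abs.1 h with h | h
      · exact Or.inl h
      · right; linarith
    have h4 := uniformProb_or_le (fun ε => t < S ε) (fun ε => S ε < -t)
    linarith
  have e : anticoncentrationConst = 1 / (4 * M) / 2 := by
    rw [anticoncentrationConst, hM]; ring
  rw [e]
  linarith

end Rademacher

/-! ### Lower tails of sums of nonnegative variables. -/

section LowerTail

variable {Ω κ : Type*} [Fintype Ω] [Nonempty Ω] [Fintype κ] [DecidableEq κ]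

/-- Lower tail of a sum of independent nonnegative variables with bounded second moment. -/
lemma lower_tail (X : Ω → ℝ) (hX : ∀ ω, 0 ≤ X ω) {v g m₂ : ℝ} (hg : 0 ≤ g) (hm₂ : 0 < m₂)
    (h1 : v + g ≤ mean X) (h2 : mean (fun ω => X ω ^ 2) ≤ m₂) :
    uniformProb (fun ω : κ → Ω => ∑ μ, X (ω μ) ≤ Fintype.card κ * v) ≤
      Real.exp (-(Fintype.card κ * (g ^ 2 / (2 * m₂)))) := by
  -- The minimiser of `-l g + l ^ 2 m₂ / 2`. As `X ≥ 0`, `exp (-y) ≤ 1 - y + y ^ 2 / 2` applies, and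
  -- no upper bound on `X` is needed.
  set l := g / m₂ with hl
  have hl0 : 0 ≤ l := by positivity
  refine (uniformProb_le_div_of_le (fun ω => ∏ μ, Real.exp (-l * X (ω μ)))
    (fun _ => Finset.prod_nonneg fun _ _ => (Real.exp_pos _).le)
    (Real.exp_pos (-l * (Fintype.card κ * v))) ?_).trans ?_
  · intro ω h
    rw [← Real.exp_sum, Real.exp_le_exp, ← Finset.mul_sum]
    nlinarith
  · rw [mean_pi_prod (fun _ x => Real.exp (-l * X x)), Finset.prod_const, Finset.card_univ,
      div_le_iff₀ (Real.exp_pos _), ← Real.exp_add]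
    have h3 : mean (fun ω => Real.exp (-l * X ω)) ≤
        Real.exp (-(l * (v + g)) + l ^ 2 * m₂ / 2) := by
      have h4 : ∀ ω, Real.exp (-l * X ω) ≤ 1 + (-l) * X ω + l ^ 2 / 2 * X ω ^ 2 := by
        intro ω
        have hx : 0 ≤ l * X ω := mul_nonneg hl0 (hX ω)
        have h5 : 1 + l * X ω + (l * X ω) ^ 2 / 2 ≤ Real.exp (l * X ω) :=
          Real.quadratic_le_exp_of_nonneg hx
        have h6 : Real.exp (-l * X ω) = (Real.exp (l * X ω))⁻¹ := by
          rw [neg_mul, Real.exp_neg]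
        rw [h6]
        set y := l * X ω
        have h7 : (Real.exp y)⁻¹ ≤ (1 + y + y ^ 2 / 2)⁻¹ := by
          apply inv_anti₀ (by positivity) h5
        refine h7.trans ?_
        rw [inv_le_iff_one_le_mul₀ (by positivity)]
        have e : 1 + (-l) * X ω + l ^ 2 / 2 * X ω ^ 2 = 1 - y + y ^ 2 / 2 := by
          simp only [y]; ring
        rw [e]
        -- `(1 - y + y ^ 2 / 2) (1 + y + y ^ 2 / 2) = 1 + y ^ 4 / 4`.
        nlinarith [sq_nonneg (y ^ 2)]
      refine (mean_mono h4).trans ?_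
      simp only [mean_add, mean_const_mul, mean_const]
      have := Real.add_one_le_exp (-(l * (v + g)) + l ^ 2 * m₂ / 2)
      have h8 : l * (v + g) ≤ l * mean X := by gcongr
      have h9 : l ^ 2 / 2 * mean (fun ω => X ω ^ 2) ≤ l ^ 2 / 2 * m₂ := by gcongr
      linarith
    refine (pow_le_pow_left₀ (mean_nonneg fun _ => (Real.exp_pos _).le) h3 _).trans ?_
    rw [← Real.exp_nat_mul, Real.exp_le_exp]
    apply le_of_eq
    rw [hl]
    field_simp
    ring

end LowerTail

/-! ### Reduction to the crosstalk seen from the all-ones state. -/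

section Gauge

variable {N : ℕ}

/-- The sum of the spins of `x` over the neurons in `J`. -/
noncomputable def partSum (J : Finset (Fin N)) (x : State N) : ℝ := ∑ j ∈ J, spin (x j)

lemma partSum_congr {J : Finset (Fin N)} {x y : State N} (h : ∀ j ∈ J, x j = y j) :
    partSum J x = partSum J y :=
  Finset.sum_congr rfl fun j hj => by rw [h j hj]

/-- The crosstalk of the patterns `η μ` at neuron `i`, as seen from the state `(1, …, 1)`. -/
noncomputable def crosstalk (n : ℕ) {κ : Type*} [Fintype κ] (η : κ → State N) (i : Fin N) : ℝ :=
  ∑ μ, spin (η μ i) * gap n (partSum (Finset.univ.erase i) (η μ))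

lemma step_eq_self_iff (h : State N → Fin N → ℝ) (x : State N) (i : Fin N) :
    step h x i = x ↔ 0 ≤ spin (x i) * h x i := by
  unfold step
  rw [Function.update_eq_self_iff]
  rcases Int.units_eq_one_or (x i) with hx | hx <;> rw [hx] <;> split_ifs with h1 h2
  · simp [h1.le]
  · simp only [spin_one, one_mul, not_le.2 h2, iff_false]; decide
  · simp [not_lt.1 h2]
  · simp only [spin_neg_one, neg_mul, one_mul, Left.nonneg_neg_iff, not_le.2 h1, iff_false]; decide
  · simp [h2.le]
  · simp [not_lt.1 h1]

/-- Ties leave a neuron unchanged, hence the weak inequality. The pattern itself supplies the signal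
`gap n (N - 1)`, and the others enter only through their products with it. -/
lemma isStable_iff (n : ℕ) {p : ℕ} (ξ : Fin p → State N) (ν : Fin p) :
    IsStable n ξ ν ↔ ∀ i, 0 ≤ gap n (N - 1) +
      crosstalk n (fun μ : {μ // μ ≠ ν} => ξ μ * ξ ν) i := by
  refine forall_congr' fun i => ?_
  have hN : (0 : ℝ) < N := by exact_mod_cast i.pos
  have hcav : ∀ μ, cavity (ξ μ) (ξ ν) i = partSum (Finset.univ.erase i) (ξ μ * ξ ν) := by
    intro μ
    unfold cavity pairing partSum
    rw [← Finset.add_sum_erase _ _ (Finset.mem_univ i), add_sub_cancel_left]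
    exact Finset.sum_congr rfl fun j _ => by rw [Pi.mul_apply, spin_mul]
  have hν : cavity (ξ ν) (ξ ν) i = N - 1 := by
    unfold cavity pairing; simp
  rw [step_eq_self_iff, discreteField_eq, ← mul_div_assoc, le_div_iff₀ (pow_pos hN _), zero_mul,
    ← Finset.add_sum_erase _ _ (Finset.mem_univ ν), hν]
  have e : spin (ξ ν i) * ∑ μ ∈ Finset.univ.erase ν, spin (ξ μ i) * gap n (cavity (ξ μ) (ξ ν) i) =
      crosstalk n (fun μ : {μ // μ ≠ ν} => ξ μ * ξ ν) i := by
    unfold crosstalk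
    rw [Finset.mul_sum, Finset.sum_subtype (p := fun μ => μ ≠ ν) _ (fun μ => by simp)]
    refine Finset.sum_congr rfl fun μ _ => ?_
    beta_reduce
    rw [hcav, Pi.mul_apply, spin_mul]
    ring
  rw [mul_add, e, ← mul_assoc, spin_mul_self, one_mul]

lemma uniformProb_equiv {Ω Ω' : Type*} [Fintype Ω] [Fintype Ω'] (e : Ω ≃ Ω') (A : Ω' → Prop) :
    uniformProb (fun ω => A (e ω)) = uniformProb A := by
  classical
  simp only [uniformProb_eq_mean]
  exact mean_equiv e (fun ω => if A ω then (1 : ℝ) else 0)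

lemma uniformProb_restrict {ι Ω : Type*} [Fintype ι] [DecidableEq ι] [Fintype Ω] [Nonempty Ω]
    (P : ι → Prop) [DecidablePred P] (A : ({i // P i} → Ω) → Prop) :
    uniformProb (fun ω : ι → Ω => A fun i => ω i) = uniformProb A := by
  classical
  have h := uniformProb_equiv (Equiv.piEquivPiSubtypeProd P (fun _ => Ω))
    (fun ω => A ω.1)
  refine h.trans ?_
  simp only [uniformProb_eq_mean]
  rw [mean_prod]
  congr 1
  ext ω
  exact mean_const (Ω := {i // ¬ P i} → Ω) (if A ω then (1 : ℝ) else 0)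

/-- By symmetry the probability of stability only involves the products with the given pattern. -/
lemma uniformProb_isStable (n : ℕ) {p : ℕ} (ν : Fin p) :
    uniformProb (fun ξ : Fin p → State N => IsStable n ξ ν) =
      uniformProb (fun η : {μ // μ ≠ ν} → State N =>
        ∀ i, 0 ≤ gap n (N - 1) + crosstalk n η i) := by
  -- Multiplying the other patterns by `ξ ν` is a bijection of the configurations, so the products
  -- are again independent and uniform.
  have hinv : Function.Involutive
      (fun (ξ : Fin p → State N) μ => if μ = ν then ξ ν else ξ μ * ξ ν) := by
    intro ξ
    funext μ
    by_cases h : μ = ν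
    · simp [h]
    · simp only [h, if_false, if_true]
      rw [mul_assoc]
      have : ξ ν * ξ ν = 1 := by
        funext j
        exact Int.units_mul_self _
      rw [this, mul_one]
  rw [← uniformProb_equiv (Function.Involutive.toPerm _ hinv),
    ← uniformProb_restrict (ι := Fin p) (fun μ => μ ≠ ν)]
  congr 1
  funext ξ
  rw [isStable_iff]
  refine propext (forall_congr' fun i => ?_)
  have e : (fun μ : {μ // μ ≠ ν} => Function.Involutive.toPerm _ hinv ξ μ *
      Function.Involutive.toPerm _ hinv ξ ν) =
      fun μ : {μ // μ ≠ ν} => ξ μ := by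
    funext μ
    simp only [Function.Involutive.coe_toPerm, if_neg μ.2, if_true]
    rw [mul_assoc]
    have : ξ ν * ξ ν = 1 := by
      funext j
      exact Int.units_mul_self _
    rw [this, mul_one]
  rw [e]

end Gauge

/-! ### Resampling signs. -/

section Flip

variable {N : ℕ} {κ : Type*}

/-- Multiply the entries `η μ j`, `j ∈ I`, by the signs `ε j μ`. -/
def flipOn (I : Finset (Fin N)) (ε : Fin N → κ → ℤˣ) : (κ → State N) ≃ (κ → State N) :=
  Function.Involutive.toPerm (fun η μ j => if j ∈ I then ε j μ * η μ j else η μ j) (by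
    intro η
    funext μ j
    by_cases h : j ∈ I
    · simp only [h, if_true]; rw [← mul_assoc, Int.units_mul_self, one_mul]
    · simp [h])

lemma flipOn_apply (I : Finset (Fin N)) (ε : Fin N → κ → ℤˣ) (η : κ → State N) (μ : κ)
    (j : Fin N) : flipOn I ε η μ j = if j ∈ I then ε j μ * η μ j else η μ j := rfl

lemma pow_sum_le_card_mul [Fintype κ] (f : κ → ℝ) (hf : ∀ μ, 0 ≤ f μ) (q : ℕ) :
    (Fintype.card κ : ℝ) * (∑ μ, f μ) ^ q ≤ (Fintype.card κ : ℝ) ^ q * ∑ μ, f μ ^ q := by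
  rcases q with _ | q
  · simp
  · rcases isEmpty_or_nonempty κ with h | h
    · simp
    have hc : (0 : ℝ) < Fintype.card κ := by exact_mod_cast Fintype.card_pos
    have := pow_sum_div_card_le_sum_pow (s := Finset.univ) (f := f) (n := q) (fun μ _ => hf μ)
    rw [Finset.card_univ, div_le_iff₀ (pow_pos hc q)] at this
    calc (Fintype.card κ : ℝ) * (∑ μ, f μ) ^ (q + 1)
        ≤ Fintype.card κ * ((∑ μ, f μ ^ (q + 1)) * (Fintype.card κ : ℝ) ^ q) := by gcongr
      _ = _ := by ring

variable [Fintype κ] [DecidableEq κ]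

/-- Moments of sums of independent copies of a nonnegative variable. -/
lemma mean_sum_pow_le {Ω : Type*} [Fintype Ω] [Nonempty Ω] (f : Ω → ℝ) (hf : ∀ ω, 0 ≤ f ω) {q : ℕ}
    (hq : 1 ≤ q) : mean (fun ω : κ → Ω => (∑ μ, f (ω μ)) ^ q) ≤
      (Fintype.card κ : ℝ) ^ q * mean (fun ω => f ω ^ q) := by
  rcases isEmpty_or_nonempty κ with h | h
  · simp [mean_const, show q ≠ 0 by omega]
  have hc : (0 : ℝ) < Fintype.card κ := by exact_mod_cast Fintype.card_pos
  have h1 := mean_mono fun ω : κ → Ω => pow_sum_le_card_mul (fun μ => f (ω μ)) (fun μ => hf _) q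
  rw [mean_const_mul, mean_const_mul, mean_sum] at h1
  simp only [mean_pi_apply (Ω := Ω) _ (fun ω => f ω ^ q), Finset.sum_const, Finset.card_univ,
    nsmul_eq_mul] at h1
  rw [← mul_le_mul_iff_right₀ hc]
  linarith

/-- Even moments of a crosstalk term: the sign `η μ i` is independent of the factor `g (η μ)`. -/
lemma mean_signed_sum_pow_le (i : Fin N) (g : State N → ℝ)
    (hg : ∀ x y : State N, (∀ j, j ≠ i → x j = y j) → g x = g y) {q : ℕ} (hq : 1 ≤ q) :
    mean (fun η : κ → State N => (∑ μ, spin (η μ i) * g (η μ)) ^ (2 * q)) ≤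
      4 * (2 * q).factorial * ((Fintype.card κ : ℝ) ^ q * mean (fun x => g x ^ (2 * q))) := by
  -- Fresh signs at `i` preserve the uniform measure and do not affect `g`, so Khintchine applies
  -- for each fixed `η`.
  rw [mean_eq_mean_mean (fun ε => flipOn {i} ε)]
  have h1 : ∀ (η : κ → State N) (ε : Fin N → κ → ℤˣ),
      ∑ μ, spin (flipOn {i} ε η μ i) * g (flipOn {i} ε η μ) =
        ∑ μ, (spin (η μ i) * g (η μ)) * spin (ε i μ) := by
    intro η ε
    refine Finset.sum_congr rfl fun μ _ => ?_
    rw [hg (flipOn {i} ε η μ) (η μ) fun j hj => by simp [flipOn_apply, hj]]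
    simp only [flipOn_apply, Finset.mem_singleton, if_true, spin_mul]
    ring
  simp only [h1]
  have h2 : ∀ η : κ → State N, mean (fun ε : Fin N → κ → ℤˣ =>
      (∑ μ, (spin (η μ i) * g (η μ)) * spin (ε i μ)) ^ (2 * q)) ≤
      4 * (2 * q).factorial * (∑ μ, g (η μ) ^ 2) ^ q := by
    intro η
    rw [mean_pi_apply i (fun ε : κ → ℤˣ =>
      (∑ μ, (spin (η μ i) * g (η μ)) * spin (ε μ)) ^ (2 * q))]
    have := khintchine q fun μ => spin (η μ i) * g (η μ)
    simpa only [mul_pow, spin_sq, one_mul] using this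
  refine (mean_mono h2).trans ?_
  rw [mean_const_mul]
  have := mean_sum_pow_le (κ := κ) (fun x : State N => g x ^ 2) (fun _ => sq_nonneg _) hq
  simp only [← pow_mul] at this
  gcongr

end Flip

/-! ### Moments of spin sums and of their gaps. -/

section Moments

variable {N : ℕ}

lemma partSum_eq (J : Finset (Fin N)) (x : State N) :
    partSum J x = ∑ j, (if j ∈ J then 1 else 0) * spin (x j) := by
  simp [partSum]

lemma sum_indicator_sq (J : Finset (Fin N)) :
    ∑ j, (if j ∈ J then (1 : ℝ) else 0) ^ 2 = J.card := by
  simp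

lemma mean_partSum_pow_le (m : ℕ) (J : Finset (Fin N)) :
    mean (fun x => partSum J x ^ (2 * m)) ≤ 4 * (2 * m).factorial * (N : ℝ) ^ m := by
  simp only [partSum_eq]
  refine (khintchine m _).trans ?_
  rw [sum_indicator_sq]
  have : (J.card : ℝ) ≤ N := by
    have := Finset.card_le_univ J
    rw [Fintype.card_fin] at this
    exact_mod_cast this
  gcongr

lemma exists_abs_partSum_moment_bound (m : ℕ) : ∃ C : ℝ, 0 ≤ C ∧ ∀ (N : ℕ) (J : Finset (Fin N))
    (w : ℝ), 0 ≤ w → w ^ 2 ≤ N → mean (fun x => (|partSum J x| + w) ^ (2 * m)) ≤ C * N ^ m := by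
  refine ⟨2 ^ (2 * m) * (4 * (2 * m).factorial + 1), by positivity, fun N J w hw hwN => ?_⟩
  have h1 : ∀ x, (|partSum J x| + w) ^ (2 * m) ≤
      2 ^ (2 * m) * (partSum J x ^ (2 * m) + w ^ (2 * m)) := by
    intro x
    refine (add_pow_le (abs_nonneg _) hw _).trans ?_
    rw [(even_two_mul m).pow_abs]
    have : 0 ≤ partSum J x ^ (2 * m) := (even_two_mul m).pow_nonneg _
    gcongr
    · norm_num
    · omega
  refine (mean_mono h1).trans ?_
  rw [mean_const_mul, mean_add, mean_const]
  have h2 := mean_partSum_pow_le m J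
  have h3 : w ^ (2 * m) ≤ N ^ m := by rw [pow_mul]; gcongr
  rw [mul_assoc]
  gcongr
  linarith

lemma abs_gap_le (n : ℕ) (S : ℝ) : |gap n S| ≤ 2 * n * (|S| + 1) ^ (n - 1) := by
  unfold gap
  refine (abs_pow_sub_pow_le _ _ _).trans ?_
  have e : |S + 1 - (S - 1)| = 2 := by
    rw [show S + 1 - (S - 1) = 2 by ring]; norm_num
  rw [e]
  have h1 : |S + 1| ≤ |S| + 1 := (abs_add_le _ _).trans (by simp)
  have h2 : |S - 1| ≤ |S| + 1 := (abs_sub _ _).trans (by simp)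
  have h3 : 0 ≤ max |S + 1| |S - 1| := le_max_of_le_left (abs_nonneg _)
  gcongr
  exact max_le h1 h2

lemma gap_neg (n : ℕ) (S : ℝ) : gap n (-S) = (-1) ^ (n + 1) * gap n S := by
  unfold gap
  rw [show -S + 1 = (-1) * (S - 1) by ring, show -S - 1 = (-1) * (S + 1) by ring, mul_pow, mul_pow]
  ring

lemma le_abs_gap (n : ℕ) (S : ℝ) : 2 * n * |S| ^ (n - 1) ≤ |gap n S| := by
  have h : |gap n S| = |gap n (|S|)| := by
    rcases abs_choice S with h | h <;> rw [h]
    rw [gap_neg, abs_mul, abs_pow]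
    simp
  rw [h]
  exact (gap_ge n (abs_nonneg S)).trans (le_abs_self _)

/-- The top power cancels inside `gap`, leaving degree `n - 1`, and the increment lowers the degree
once more. This makes the crosstalk remainder negligible. -/
lemma abs_gap_sub_gap_le (n : ℕ) (R W : ℝ) :
    |gap n (R + W) - gap n R| ≤ 2 ^ n * (2 * (n * |W| * (|R| + |W| + 1) ^ (n - 2))) := by
  rcases n with _ | d
  · simp [gap]
  unfold gap
  rw [add_pow_sub_sub_pow, add_pow_sub_sub_pow, Finset.sum_range_succ,
    Finset.sum_range_succ _ (d + 1), Nat.sub_self, pow_zero, sub_self, mul_zero, zero_mul, zero_mul,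
    add_zero, add_zero, ← Finset.sum_sub_distrib]
  simp only [← mul_sub]
  refine sum_choose_abs_le (d + 1) (d + 1) (by omega) (fun m => 1 - (-1) ^ (d + 1 - m)) _
    (by positivity) (fun m => (R + W) ^ m - R ^ m) ?_
  intro m hm
  rw [abs_mul]
  refine mul_le_mul (neg_one_pow_abs_le _).1 ?_ (abs_nonneg _) (by norm_num)
  refine (abs_pow_sub_pow_le _ _ _).trans ?_
  rw [add_sub_cancel_left, mul_comm |W|]
  have h1 : (m : ℝ) ≤ (d + 1 : ℕ) := by exact_mod_cast hm.le
  have h2 : max |R + W| |R| ≤ |R| + |W| + 1 := by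
    have := abs_add_le R W
    have := abs_nonneg W
    exact max_le (by linarith) (by linarith)
  have h3 : 0 ≤ max |R + W| |R| := le_max_of_le_left (abs_nonneg _)
  have h4 : 1 ≤ |R| + |W| + 1 := by
    have := abs_nonneg W
    have := abs_nonneg R
    linarith
  have h5 : max |R + W| |R| ^ (m - 1) ≤ (|R| + |W| + 1) ^ (d + 1 - 2) :=
    (pow_le_pow_left₀ h3 h2 _).trans (pow_le_pow_right₀ h4 (by omega))
  gcongr

lemma exists_gap_moment_bound (n q : ℕ) : ∃ C : ℝ, 0 < C ∧ ∀ (N : ℕ), 1 ≤ N →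
    ∀ J : Finset (Fin N), mean (fun x => gap n (partSum J x) ^ (2 * q)) ≤
      C * (N : ℝ) ^ ((n - 1) * q) := by
  obtain ⟨C, hC, h⟩ := exists_abs_partSum_moment_bound ((n - 1) * q)
  refine ⟨(2 * n) ^ (2 * q) * C + 1, by positivity, fun N hN J => ?_⟩
  have h1 : ∀ x : State N, gap n (partSum J x) ^ (2 * q) ≤
      (2 * n) ^ (2 * q) * (|partSum J x| + 1) ^ (2 * ((n - 1) * q)) := by
    intro x
    rw [← (even_two_mul q).pow_abs]
    refine (pow_le_pow_left₀ (abs_nonneg _) (abs_gap_le n _) _).trans_eq ?_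
    rw [mul_pow, ← pow_mul]
    congr 2
    ring
  refine (mean_mono h1).trans ?_
  rw [mean_const_mul]
  have h2 := h N J 1 zero_le_one (by rw [one_pow]; exact_mod_cast hN)
  calc _ ≤ (2 * (n : ℝ)) ^ (2 * q) * (C * N ^ ((n - 1) * q)) := by gcongr
    _ ≤ _ := by
      have : (0 : ℝ) ≤ (N : ℝ) ^ ((n - 1) * q) := by positivity
      linarith

/-- A discrete integration by parts: one factor of the sum is expanded over `J`, and pairing `x`
with its flip at `j` turns twice the mean of `x j * S ^ (2 m + 1)` into the mean gap of the sum
without `j`. Iteration produces the Gaussian double factorial and loses one element of `J` per step.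
-/
lemma mean_partSum_pow_ge (m : ℕ) (J : Finset (Fin N)) (hJ : m ≤ J.card) :
    (∏ l ∈ Finset.range m, (2 * l + 1 : ℝ)) * ((J.card : ℝ) - m) ^ m ≤
      mean (fun x => partSum J x ^ (2 * m)) := by
  induction m generalizing J with
  | zero => simp [mean_const]
  | succ m ih =>
    have h1 : ∀ j ∈ J, (2 * m + 1) * ((∏ l ∈ Finset.range m, (2 * l + 1 : ℝ)) *
        ((J.card : ℝ) - (m + 1 : ℕ)) ^ m) ≤
        mean (fun x => spin (x j) * partSum J x ^ (2 * m + 1)) := by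
      intro j hj
      have h2 := ih (J.erase j) (by rw [Finset.card_erase_of_mem hj]; omega)
      have h3 : ((J.erase j).card : ℝ) - m = J.card - (m + 1 : ℕ) := by
        rw [Finset.card_erase_of_mem hj, Nat.cast_sub (by omega)]
        push_cast; ring
      rw [h3] at h2
      have hinv : Function.Involutive
          (fun x : State N => Function.update x j (-x j)) := by
        intro x; simp
      have h4 := mean_equiv (Function.Involutive.toPerm _ hinv)
        (fun x : State N => spin (x j) * partSum J x ^ (2 * m + 1))
      have hsplit : ∀ x : State N, partSum J x = partSum (J.erase j) x + spin (x j) := by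
        intro x
        unfold partSum
        rw [← Finset.sum_erase_add _ _ hj]
      have h5 : ∀ x : State N, spin (Function.Involutive.toPerm _ hinv x j) *
          partSum J (Function.Involutive.toPerm _ hinv x) ^ (2 * m + 1) + spin (x j) * partSum J x ^ (2 * m + 1) =
          gap (2 * m + 1) (partSum (J.erase j) x) := by
        intro x
        have e1 : partSum (J.erase j) (Function.Involutive.toPerm _ hinv x) = partSum (J.erase j) x :=
          partSum_congr fun j' hj' => by
            simp [Function.Involutive.coe_toPerm,
              Function.update_of_ne (Finset.ne_of_mem_erase hj')]
        have e2 : Function.Involutive.toPerm _ hinv x j = -x j := by simp [Function.Involutive.coe_toPerm]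
        rw [hsplit, hsplit x, e1, e2, spin_neg]
        unfold gap
        rcases Int.units_eq_one_or (x j) with h | h <;> rw [h] <;> simp <;> ring
      have h6 : 2 * mean (fun x : State N => spin (x j) * partSum J x ^ (2 * m + 1)) =
          mean (fun x => gap (2 * m + 1) (partSum (J.erase j) x)) := by
        simp only [← h5]
        rw [mean_add, h4]; ring
      have h7 : ∀ S : ℝ, 2 * (2 * m + 1) * S ^ (2 * m) ≤ gap (2 * m + 1) S := by
        intro S
        have h8 := gap_ge (2 * m + 1) (abs_nonneg S)
        rw [Nat.add_sub_cancel, (even_two_mul m).pow_abs] at h8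
        push_cast at h8
        refine h8.trans_eq ?_
        rcases abs_choice S with h | h <;> rw [h]
        rw [gap_neg, Even.neg_one_pow ⟨m + 1, by ring⟩, one_mul]
      have h9 := mean_mono fun x : State N => h7 (partSum (J.erase j) x)
      rw [mean_const_mul, ← h6] at h9
      have : (2 * (m : ℝ) + 1) * ((∏ l ∈ Finset.range m, (2 * l + 1 : ℝ)) *
        ((J.card : ℝ) - (m + 1 : ℕ)) ^ m) ≤
          (2 * m + 1) * mean (fun x => partSum (J.erase j) x ^ (2 * m)) := by gcongr
      linarith
    have e : ∀ x : State N, partSum J x ^ (2 * (m + 1)) =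
        ∑ j ∈ J, spin (x j) * partSum J x ^ (2 * m + 1) := by
      intro x
      rw [← Finset.sum_mul, show 2 * (m + 1) = 2 * m + 1 + 1 by ring, pow_succ']
      rfl
    simp only [e]
    rw [mean_sum]
    refine le_trans ?_ (Finset.card_nsmul_le_sum _ _ _ h1)
    rw [nsmul_eq_mul, Finset.prod_range_succ, pow_succ]
    have h0 : 0 ≤ (J.card : ℝ) - (m + 1 : ℕ) := by
      rw [sub_nonneg]; exact_mod_cast hJ
    have hprod : 0 ≤ ∏ l ∈ Finset.range m, (2 * l + 1 : ℝ) :=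
      Finset.prod_nonneg fun l _ => by positivity
    have hle : (J.card : ℝ) - (m + 1 : ℕ) ≤ J.card := by
      have : (0 : ℝ) ≤ (m + 1 : ℕ) := by positivity
      linarith
    calc _ = ((J.card : ℝ) - (m + 1 : ℕ)) * ((2 * m + 1) *
        ((∏ l ∈ Finset.range m, (2 * l + 1 : ℝ)) * ((J.card : ℝ) - (m + 1 : ℕ)) ^ m)) := by ring
      _ ≤ _ := by gcongr

/-- For `m = n - 1` this is `(2n - 3)!! ≥ n / 2`, the inequality behind the load `2 N ^ (n - 1) /
n`. -/
lemma prod_odd_ge (m : ℕ) : ((m : ℝ) + 1) / 2 ≤ ∏ l ∈ Finset.range m, (2 * l + 1 : ℝ) := by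
  induction m with
  | zero => norm_num
  | succ m ih =>
    rw [Finset.prod_range_succ]
    rcases Nat.eq_zero_or_pos m with rfl | hm
    · norm_num
    · have : (1 : ℝ) ≤ m := by exact_mod_cast hm
      push_cast
      nlinarith

end Moments

/-! ### Conditional independence on a small set of neurons, and the error events. -/

section Instability

variable {N : ℕ} {κ : Type*} [Fintype κ] [DecidableEq κ]

lemma card_compl_eq (I : Finset (Fin N)) : ((Iᶜ.card : ℕ) : ℝ) = N - I.card := by
  rw [Finset.card_compl, Fintype.card_fin, Nat.cast_sub]
  have := Finset.card_le_univ I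
  rwa [Fintype.card_fin] at this

lemma mean_indicator {Ω : Type*} [Fintype Ω] (A : Ω → Prop) [DecidablePred A] :
    mean (fun ω => if A ω then (1 : ℝ) else 0) = uniformProb A := by
  rw [uniformProb_eq_mean]
  congr 1
  ext ω
  congr

/-- The leading parts of the crosstalk at the neurons of `I` are conditionally independent. -/
lemma leading_crosstalk_bound (n : ℕ) (I : Finset (Fin N)) {V t : ℝ} (hV : 0 < V)
    (ht : t ^ 2 ≤ 3 / 2 * V) :
    uniformProb (fun η : κ → State N => (V ≤ ∑ μ, gap n (partSum Iᶜ (η μ)) ^ 2 ∧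
      ∑ μ, gap n (partSum Iᶜ (η μ)) ^ 4 ≤ V ^ 2 / 2) ∧
      ∀ i ∈ I, -t ≤ ∑ μ, spin (η μ i) * gap n (partSum Iᶜ (η μ))) ≤
      (1 - anticoncentrationConst) ^ I.card := by
  classical
  have hc1 : 0 ≤ 1 - anticoncentrationConst := by
    have : anticoncentrationConst ≤ 1 := by
      unfold anticoncentrationConst
      rw [div_le_one (by positivity)]
      have : (1 : ℝ) ≤ Nat.factorial 8 := by exact_mod_cast Nat.factorial_pos 8
      linarith
    linarith
  rw [uniformProb_eq_mean, mean_eq_mean_mean (fun ε => flipOn I ε)]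
  refine (mean_mono fun η => ?_).trans (mean_const _).le
  -- The sums over `Iᶜ` do not see the resampled entries: for fixed `η` the leading parts at the
  -- neurons of `I` are independent Rademacher sums.
  have hb : ∀ ε μ, partSum Iᶜ (flipOn I ε η μ) = partSum Iᶜ (η μ) := fun ε μ =>
    partSum_congr fun j hj => by rw [flipOn_apply, if_neg (Finset.mem_compl.1 hj)]
  simp only [hb]
  by_cases hgood : V ≤ ∑ μ, gap n (partSum Iᶜ (η μ)) ^ 2 ∧
      ∑ μ, gap n (partSum Iᶜ (η μ)) ^ 4 ≤ V ^ 2 / 2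
  · simp only [hgood, true_and]
    let b : Fin N → κ → ℝ := fun i μ => spin (η μ i) * gap n (partSum Iᶜ (η μ))
    have e : ∀ ε : Fin N → κ → ℤˣ, (∀ i ∈ I, -t ≤ ∑ μ, spin (flipOn I ε η μ i) *
        gap n (partSum Iᶜ (η μ))) ↔ ∀ i, i ∈ I → -t ≤ ∑ μ, b i μ * spin (ε i μ) := by
      intro ε
      refine forall_congr' fun i => forall_congr' fun hi => ?_
      have : ∑ μ, spin (flipOn I ε η μ i) * gap n (partSum Iᶜ (η μ)) =
          ∑ μ, b i μ * spin (ε i μ) := by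
        refine Finset.sum_congr rfl fun μ _ => ?_
        rw [flipOn_apply, if_pos hi, spin_mul]
        simp only [b]
        ring
      rw [this]
    simp only [e]
    rw [mean_indicator, uniformProb_pi_forall
      (fun i (ω : κ → ℤˣ) => i ∈ I → -t ≤ ∑ μ, b i μ * spin (ω μ))]
    have h1 : ∀ i, uniformProb (fun ω : κ → ℤˣ => i ∈ I → -t ≤ ∑ μ, b i μ * spin (ω μ)) ≤
        if i ∈ I then 1 - anticoncentrationConst else 1 := by
      intro i
      split_ifs with hi
      · have h2 := anticoncentration (b i) (V := V) (t := t) hV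
          (by simpa only [b, mul_pow, spin_sq, one_mul] using hgood.1)
          (by
            have : ∀ s : ℤˣ, spin s ^ 4 = 1 := fun s => by
              rw [show (4 : ℕ) = 2 * 2 from rfl, pow_mul, spin_sq, one_pow]
            simpa only [b, mul_pow, this, one_mul] using hgood.2) ht
        have h3 := uniformProb_not (fun ω : κ → ℤˣ => ∑ μ, b i μ * spin (ω μ) < -t)
        have h4 : uniformProb (fun ω : κ → ℤˣ => i ∈ I → -t ≤ ∑ μ, b i μ * spin (ω μ)) ≤
            uniformProb (fun ω : κ → ℤˣ => ¬ ∑ μ, b i μ * spin (ω μ) < -t) :=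
          uniformProb_mono fun ω h => not_lt.2 (h hi)
        linarith
      · exact uniformProb_le_one _
    refine (Finset.prod_le_prod (fun i _ => uniformProb_nonneg _) fun i _ => h1 i).trans ?_
    rw [Finset.prod_ite_mem, Finset.univ_inter, Finset.prod_const]
  · simp only [hgood, false_and, if_false, mean_const]
    positivity

/-- The remainder of the crosstalk is negligible. -/
lemma exists_crosstalk_remainder_bound (n : ℕ) {q : ℕ} (hq : 1 ≤ q) : ∃ C : ℝ, 0 ≤ C ∧
    ∀ (N : ℕ) (I : Finset (Fin N)), ((I.card : ℝ) + 1) ^ 2 ≤ N → ∀ i ∈ I,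
    ∀ {κ : Type} [Fintype κ] [DecidableEq κ] (τ : ℝ), 0 < τ →
      uniformProb (fun η : κ → State N => τ ≤ |∑ μ, spin (η μ i) *
        (gap n (partSum (Finset.univ.erase i) (η μ)) - gap n (partSum Iᶜ (η μ)))|) ≤
        C * ((Fintype.card κ : ℝ) * I.card ^ 2 * N ^ (n - 2) / τ ^ 2) ^ q := by
  obtain ⟨C, hC, h⟩ := exists_abs_partSum_moment_bound ((n - 2) * q)
  refine ⟨4 * (2 * q).factorial * ((2 ^ n * (2 * n)) ^ (2 * q) * C), by positivity,
    fun N I hI i hi κ _ _ τ hτ => ?_⟩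
  let g : State N → ℝ := fun x =>
    gap n (partSum (Finset.univ.erase i) x) - gap n (partSum Iᶜ x)
  have hg : ∀ x y : State N, (∀ j, j ≠ i → x j = y j) → g x = g y := by
    intro x y hxy
    simp only [g]
    rw [partSum_congr fun j hj => hxy j (Finset.ne_of_mem_erase hj),
      partSum_congr (J := Iᶜ) fun j hj => hxy j ?_]
    rintro rfl
    exact Finset.mem_compl.1 hj hi
  have hgm : mean (fun x => g x ^ (2 * q)) ≤
      (2 ^ n * (2 * n)) ^ (2 * q) * C * ((I.card : ℝ) ^ 2 * N ^ (n - 2)) ^ q := by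
    have h1 : ∀ x, g x ^ (2 * q) ≤ ((2 ^ n * (2 * n)) ^ (2 * q) * ((I.card : ℝ) ^ 2) ^ q) *
        (|partSum Iᶜ x| + (I.card + 1)) ^ (2 * ((n - 2) * q)) := by
      intro x
      have hsub : Iᶜ ⊆ Finset.univ.erase i := by
        intro j hj
        refine Finset.mem_erase.2 ⟨?_, Finset.mem_univ _⟩
        rintro rfl
        exact Finset.mem_compl.1 hj hi
      set W := partSum (Finset.univ.erase i \ Iᶜ) x with hWdef
      have hsplit : partSum (Finset.univ.erase i) x = partSum Iᶜ x + W := by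
        rw [hWdef]
        unfold partSum
        rw [add_comm, Finset.sum_sdiff hsub]
      have hW : |W| ≤ I.card := by
        rw [hWdef]
        unfold partSum
        refine (Finset.abs_sum_le_sum_abs _ _).trans ?_
        simp only [abs_spin, Finset.sum_const, nsmul_eq_mul, mul_one]
        have : Finset.univ.erase i \ Iᶜ ⊆ I := by
          intro j hj
          simpa using (Finset.mem_sdiff.1 hj).2
        exact_mod_cast Finset.card_le_card this
      -- Restoring the entries in `I` shifts the sum by at most `I.card`, and `I.card + 1 ≤ √N`
      -- keeps the moments of the shifted sum at their usual order.
      have h2 : |g x| ≤ 2 ^ n * (2 * n) * I.card * (|partSum Iᶜ x| + (I.card + 1)) ^ (n - 2) := by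
        simp only [g]
        rw [hsplit]
        refine (abs_gap_sub_gap_le n _ _).trans ?_
        calc 2 ^ n * (2 * (n * |W| * (|partSum Iᶜ x| + |W| + 1) ^ (n - 2)))
            ≤ 2 ^ n * (2 * (n * (I.card : ℝ) * (|partSum Iᶜ x| + I.card + 1) ^ (n - 2))) := by
              gcongr
          _ = _ := by rw [add_assoc]; ring
      rw [← (even_two_mul q).pow_abs]
      refine (pow_le_pow_left₀ (abs_nonneg _) h2 _).trans_eq ?_
      rw [mul_pow, mul_pow, ← pow_mul, ← pow_mul]
      congr 2
      ring
    refine (mean_mono h1).trans ?_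
    rw [mean_const_mul]
    have h3 := h N Iᶜ (I.card + 1) (by positivity) hI
    calc _ ≤ ((2 ^ n * (2 * (n : ℝ))) ^ (2 * q) * ((I.card : ℝ) ^ 2) ^ q) *
          (C * N ^ ((n - 2) * q)) := by gcongr
      _ = _ := by rw [mul_pow _ ((N : ℝ) ^ (n - 2)), ← pow_mul (N : ℝ)]; ring
  have hmain := mean_signed_sum_pow_le (κ := κ) i g hg hq
  refine (uniformProb_le_div_of_le (fun η : κ → State N =>
    (∑ μ, spin (η μ i) * g (η μ)) ^ (2 * q)) (fun η => (even_two_mul q).pow_nonneg _)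
    (pow_pos hτ (2 * q)) fun η hη => ?_).trans ?_
  · rw [← (even_two_mul q).pow_abs (∑ μ, _)]
    exact pow_le_pow_left₀ hτ.le hη _
  · rw [div_le_iff₀ (pow_pos hτ _)]
    refine hmain.trans ?_
    calc _ ≤ 4 * ((2 * q).factorial : ℝ) * ((Fintype.card κ : ℝ) ^ q *
          ((2 ^ n * (2 * n)) ^ (2 * q) * C * ((I.card : ℝ) ^ 2 * N ^ (n - 2)) ^ q)) := by gcongr
      _ = _ := by
        rw [div_pow, pow_mul τ]
        field_simp
        simp only [mul_pow]
        ring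

/-- The variance of the crosstalk is not smaller than expected. -/
lemma exists_variance_lower_tail (n : ℕ) (hn : 2 ≤ n) : ∃ c : ℝ, 0 < c ∧ ∀ (N : ℕ), 1 ≤ N →
    ∀ (I : Finset (Fin N)), I.card + (n - 1) ≤ N →
    99 / 100 * (N : ℝ) ^ (n - 1) ≤ ((N : ℝ) - I.card - (n - 1 : ℕ)) ^ (n - 1) →
    ∀ {κ : Type} [Fintype κ] [DecidableEq κ],
      uniformProb (fun η : κ → State N => ∑ μ, gap n (partSum Iᶜ (η μ)) ^ 2 ≤
        Fintype.card κ * (9 / 5 * n ^ 3 * N ^ (n - 1))) ≤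
        Real.exp (-(c * Fintype.card κ)) := by
  obtain ⟨C, hC, h⟩ := exists_gap_moment_bound n 2
  have hn0 : (0 : ℝ) < n := by positivity
  refine ⟨(9 / 50 * n ^ 3) ^ 2 / (2 * C), by positivity, fun N hN I hI hIN κ _ _ => ?_⟩
  have hN0 : (0 : ℝ) < N := by exact_mod_cast hN
  -- The mean is at least `99 / 50 * n ^ 3 * N ^ (n - 1)`, and `99 / 50 = 9 / 5 + 9 / 50`; the
  -- second part is the slack for `lower_tail`.
  have hmean : 9 / 5 * n ^ 3 * N ^ (n - 1) + 9 / 50 * n ^ 3 * N ^ (n - 1) ≤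
      mean (fun x : State N => gap n (partSum Iᶜ x) ^ 2) := by
    have hcard : n - 1 ≤ Iᶜ.card := by
      rw [Finset.card_compl, Fintype.card_fin]; omega
    have h1 := mean_partSum_pow_ge (n - 1) Iᶜ hcard
    have h2 := prod_odd_ge (n - 1)
    have hnn : ((n - 1 : ℕ) : ℝ) + 1 = n := by
      rw [Nat.cast_sub (by omega)]; push_cast; ring
    rw [hnn] at h2
    rw [card_compl_eq] at h1
    have h3 : ∀ x : State N, 4 * n ^ 2 * partSum Iᶜ x ^ (2 * (n - 1)) ≤
        gap n (partSum Iᶜ x) ^ 2 := by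
      intro x
      have h4 := le_abs_gap n (partSum Iᶜ x)
      rw [← sq_abs (gap n _)]
      calc 4 * n ^ 2 * partSum Iᶜ x ^ (2 * (n - 1))
          = (2 * n * |partSum Iᶜ x| ^ (n - 1)) ^ 2 := by
            rw [← (even_two_mul (n - 1)).pow_abs]; ring
        _ ≤ _ := by gcongr
    have h5 := mean_mono h3
    rw [mean_const_mul] at h5
    refine le_trans ?_ h5
    calc 9 / 5 * (n : ℝ) ^ 3 * N ^ (n - 1) + 9 / 50 * n ^ 3 * N ^ (n - 1)
        = 4 * n ^ 2 * (n / 2 * (99 / 100 * (N : ℝ) ^ (n - 1))) := by ring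
      _ ≤ 4 * n ^ 2 * ((∏ l ∈ Finset.range (n - 1), (2 * l + 1 : ℝ)) *
            ((N : ℝ) - I.card - (n - 1 : ℕ)) ^ (n - 1)) := by gcongr
      _ ≤ _ := by gcongr
  have hsq : mean (fun x : State N => (gap n (partSum Iᶜ x) ^ 2) ^ 2) ≤
      C * (N : ℝ) ^ ((n - 1) * 2) := by
    have := h N hN Iᶜ
    simp only [← pow_mul]
    exact this
  have := lower_tail (κ := κ) (fun x : State N => gap n (partSum Iᶜ x) ^ 2)
    (fun _ => sq_nonneg _) (by positivity) (by positivity) hmean hsq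
  refine this.trans_eq ?_
  congr 2
  rw [pow_mul]
  field_simp

/-- No pattern dominates the variance of the crosstalk. -/
lemma exists_fourth_moment_tail (n : ℕ) (hn : 2 ≤ n) {q : ℕ} (hq : 1 ≤ q) : ∃ C : ℝ, 0 ≤ C ∧
    ∀ (N : ℕ), 1 ≤ N → ∀ (I : Finset (Fin N)) {κ : Type} [Fintype κ] [DecidableEq κ] [Nonempty κ],
      uniformProb (fun η : κ → State N =>
        (Fintype.card κ * (9 / 5 * n ^ 3 * (N : ℝ) ^ (n - 1))) ^ 2 / 2 ≤
          ∑ μ, gap n (partSum Iᶜ (η μ)) ^ 4) ≤ C / (Fintype.card κ : ℝ) ^ q := by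
  obtain ⟨C, hC, h⟩ := exists_gap_moment_bound n (2 * q)
  have hn0 : (0 : ℝ) < n := by positivity
  refine ⟨C / ((9 / 5 * n ^ 3) ^ 2 / 2) ^ q, by positivity, fun N hN I κ _ _ _ => ?_⟩
  have hN0 : (0 : ℝ) < N := by exact_mod_cast hN
  have hM : (0 : ℝ) < Fintype.card κ := by exact_mod_cast Fintype.card_pos
  -- With `M` patterns the sum has order `M N ^ (2 (n - 1))`, the threshold `M ^ 2 N ^ (2 (n - 1))`;
  -- Markov for the `q`-th power gains `M ^ q`.
  refine (uniformProb_le_div_of_le (fun η : κ → State N =>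
    (∑ μ, gap n (partSum Iᶜ (η μ)) ^ 4) ^ q) (fun η => by positivity)
    (t := ((Fintype.card κ * (9 / 5 * n ^ 3 * (N : ℝ) ^ (n - 1))) ^ 2 / 2) ^ q) (by positivity)
    fun η hη => pow_le_pow_left₀ (by positivity) hη _).trans ?_
  rw [div_le_iff₀ (by positivity)]
  refine (mean_sum_pow_le (κ := κ) (fun x : State N => gap n (partSum Iᶜ x) ^ 4)
    (fun _ => by positivity) hq).trans ?_
  have h1 := h N hN Iᶜ
  simp only [← pow_mul]
  rw [show 2 * (2 * q) = 4 * q by ring] at h1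
  calc (Fintype.card κ : ℝ) ^ q * mean (fun x : State N => gap n (partSum Iᶜ x) ^ (4 * q))
      ≤ (Fintype.card κ : ℝ) ^ q * (C * (N : ℝ) ^ ((n - 1) * (2 * q))) := by gcongr
    _ = _ := by
      have e : (N : ℝ) ^ ((n - 1) * (2 * q)) = (((N : ℝ) ^ (n - 1)) ^ 2) ^ q := by
        rw [← pow_mul, ← pow_mul]
      rw [e]
      simp only [div_pow, mul_pow]
      field_simp
      ring

end Instability

/-! ### The integer fourth root and vanishing error terms. -/

section Asymptotics

lemma anticoncentrationConst_lt_one : anticoncentrationConst < 1 := by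
  unfold anticoncentrationConst
  rw [div_lt_one (by positivity)]
  have : (1 : ℝ) ≤ Nat.factorial 8 := by exact_mod_cast Nat.factorial_pos 8
  linarith

lemma tendsto_sqrt_sqrt : Filter.Tendsto (fun N : ℕ => Nat.sqrt (Nat.sqrt N)) Filter.atTop
    Filter.atTop := by
  refine Filter.tendsto_atTop_atTop.2 fun b => ⟨b ^ 4, fun N hN => ?_⟩
  rw [Nat.le_sqrt', Nat.le_sqrt', ← pow_mul]
  exact hN

lemma sqrt_sqrt_pow_four_le (N : ℕ) : Nat.sqrt (Nat.sqrt N) ^ 4 ≤ N := by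
  calc Nat.sqrt (Nat.sqrt N) ^ 4 = (Nat.sqrt (Nat.sqrt N) ^ 2) ^ 2 := by ring
    _ ≤ Nat.sqrt N ^ 2 := Nat.pow_le_pow_left (Nat.sqrt_le' _) 2
    _ ≤ N := Nat.sqrt_le' _

lemma lt_sqrt_sqrt_succ_pow_four (N : ℕ) : N < (Nat.sqrt (Nat.sqrt N) + 1) ^ 4 := by
  have h1 := Nat.lt_succ_sqrt' N
  have h2 : Nat.sqrt N + 1 ≤ (Nat.sqrt (Nat.sqrt N) + 1) ^ 2 := Nat.lt_succ_sqrt' (Nat.sqrt N)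
  calc N < (Nat.sqrt N + 1) ^ 2 := h1
    _ ≤ ((Nat.sqrt (Nat.sqrt N) + 1) ^ 2) ^ 2 := Nat.pow_le_pow_left h2 2
    _ = _ := by ring

lemma tendsto_pow_mul_exp_neg (K : ℕ) {b : ℝ} (hb : 0 < b) :
    Filter.Tendsto (fun N : ℕ => (N : ℝ) ^ K * Real.exp (-(b * N))) Filter.atTop (nhds 0) := by
  have h := tendsto_pow_const_mul_const_pow_of_abs_lt_one K (r := Real.exp (-b))
    (by rw [abs_of_pos (Real.exp_pos _)]; rw [← Real.exp_zero]; exact Real.exp_lt_exp.2 (by linarith))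
  refine h.congr fun N => ?_
  rw [← Real.exp_nat_mul]
  congr 2
  ring

/-- As `N < (k + 1) ^ 4` for the integer fourth root `k`, a power of `N` is at most a power of `k +
1`. -/
lemma tendsto_pow_mul_pow_sqrt_sqrt (K : ℕ) {ρ : ℝ} (h0 : 0 < ρ) (h1 : ρ < 1) :
    Filter.Tendsto (fun N : ℕ => (N : ℝ) ^ K * ρ ^ Nat.sqrt (Nat.sqrt N)) Filter.atTop
      (nhds 0) := by
  have h := tendsto_pow_const_mul_const_pow_of_abs_lt_one (4 * K) (r := ρ)
    (by rwa [abs_of_pos h0])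
  have h2 := (h.comp ((Filter.tendsto_add_atTop_nat 1).comp tendsto_sqrt_sqrt)).const_mul ρ⁻¹
  rw [mul_zero] at h2
  refine squeeze_zero (fun N => by positivity) (fun N => ?_) h2
  simp only [Function.comp_apply]
  set k := Nat.sqrt (Nat.sqrt N) with hk
  have h3 : (N : ℝ) ≤ ((k + 1 : ℕ) : ℝ) ^ 4 := by
    exact_mod_cast (lt_sqrt_sqrt_succ_pow_four N).le
  calc (N : ℝ) ^ K * ρ ^ k ≤ (((k + 1 : ℕ) : ℝ) ^ 4) ^ K * ρ ^ k := by gcongr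
    _ = ρ⁻¹ * (((k + 1 : ℕ) : ℝ) ^ (4 * K) * ρ ^ (k + 1)) := by
      rw [← pow_mul, pow_succ ρ]; field_simp

end Asymptotics

/-! ### Failure above the critical load. -/

section Instability

variable {N : ℕ} {κ : Type} [Fintype κ] [DecidableEq κ]

/-- Decomposition of the event that the state `(1, …, 1)` withstands the crosstalk. -/
lemma uniformProb_withstand_le (n : ℕ) (hN : 1 ≤ N) (I : Finset (Fin N)) {V τ e₁ e₂ e₃ : ℝ}
    (hV : 0 < V)
    (hτ : (2 * n * (N : ℝ) ^ (n - 1) + τ) ^ 2 ≤ 3 / 2 * V)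
    (h₁ : ∀ i ∈ I, uniformProb (fun η : κ → State N => τ ≤ |∑ μ, spin (η μ i) *
        (gap n (partSum (Finset.univ.erase i) (η μ)) - gap n (partSum Iᶜ (η μ)))|) ≤ e₁)
    (h₂ : uniformProb (fun η : κ → State N => ∑ μ, gap n (partSum Iᶜ (η μ)) ^ 2 ≤ V) ≤ e₂)
    (h₃ : uniformProb (fun η : κ → State N => V ^ 2 / 2 ≤ ∑ μ, gap n (partSum Iᶜ (η μ)) ^ 4) ≤ e₃) :
    uniformProb (fun η : κ → State N => ∀ i, 0 ≤ gap n (N - 1) + crosstalk n η i) ≤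
      I.card * e₁ + e₂ + e₃ + (1 - anticoncentrationConst) ^ I.card := by
  set t := 2 * n * (N : ℝ) ^ (n - 1) + τ with ht
  have hgapN : gap n ((N : ℝ) - 1) ≤ 2 * n * (N : ℝ) ^ (n - 1) := by
    refine (le_abs_self _).trans ((abs_gap_le n _).trans_eq ?_)
    have : (1 : ℝ) ≤ N := by exact_mod_cast hN
    rw [abs_of_nonneg (by linarith), sub_add_cancel]
  have hincl : ∀ η : κ → State N, (∀ i, 0 ≤ gap n (N - 1) + crosstalk n η i) →
      ((((∃ i : I, τ ≤ |∑ μ, spin (η μ i) *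
        (gap n (partSum (Finset.univ.erase i.1) (η μ)) - gap n (partSum Iᶜ (η μ)))|) ∨
        ∑ μ, gap n (partSum Iᶜ (η μ)) ^ 2 ≤ V) ∨
        V ^ 2 / 2 ≤ ∑ μ, gap n (partSum Iᶜ (η μ)) ^ 4) ∨
        ((V ≤ ∑ μ, gap n (partSum Iᶜ (η μ)) ^ 2 ∧
          ∑ μ, gap n (partSum Iᶜ (η μ)) ^ 4 ≤ V ^ 2 / 2) ∧
          ∀ i ∈ I, -t ≤ ∑ μ, spin (η μ i) * gap n (partSum Iᶜ (η μ)))) := by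
    intro η h
    by_contra hcon
    push Not at hcon
    obtain ⟨⟨⟨ha, hb⟩, hc⟩, hd⟩ := hcon
    obtain ⟨i, hi, hlt⟩ := hd ⟨hb.le, hc.le⟩
    have h5 := (abs_lt.1 (ha ⟨i, hi⟩)).2
    have h6 := h i
    have h7 : crosstalk n η i = ∑ μ, spin (η μ i) * (gap n (partSum (Finset.univ.erase i) (η μ)) -
        gap n (partSum Iᶜ (η μ))) + ∑ μ, spin (η μ i) * gap n (partSum Iᶜ (η μ)) := by
      unfold crosstalk
      rw [← Finset.sum_add_distrib]
      exact Finset.sum_congr rfl fun μ _ => by ring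
    rw [h7] at h6
    simp only at h5
    linarith
  refine (uniformProb_mono hincl).trans ((uniformProb_or_le _ _).trans ?_)
  refine add_le_add ((uniformProb_or_le _ _).trans (add_le_add ((uniformProb_or_le _ _).trans
    (add_le_add ((uniformProb_exists_le _).trans ?_) h₂)) h₃))
    (leading_crosstalk_bound n I hV hτ)
  refine (Finset.sum_le_card_nsmul _ _ e₁ fun i _ => h₁ i.1 i.2).trans ?_
  rw [nsmul_eq_mul, Finset.card_univ, Fintype.card_coe]

set_option maxHeartbeats 800000 in
/-- Above the critical load the state `(1, …, 1)` withstands the crosstalk only with a probability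
that vanishes faster than any power of `N`. -/
lemma exists_withstand_bound (n : ℕ) (hn : 2 ≤ n) (K : ℕ) (ε : ℝ) (hε : 0 < ε) :
    ∃ N₀ : ℕ, ∀ N : ℕ, N₀ ≤ N → ∀ {κ : Type} [Fintype κ] [DecidableEq κ],
      2 * (N : ℝ) ^ (n - 1) / n < Fintype.card κ + 1 →
      (N : ℝ) ^ K * uniformProb (fun η : κ → State N =>
        ∀ i, 0 ≤ gap n (N - 1) + crosstalk n η i) ≤ ε := by
  -- With `I.card = k` the integer fourth root, the remainder bound is a power of a multiple of `k ^
  -- 2 / N ≤ N ^ (-1/2)`. The exponent `2 * (K + 2)` gives `N ^ (-(K + 2))`, which pays for `N ^ K`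
  -- and the union over `I` and leaves `1 / N`.
  obtain ⟨C₁, hC₁, H₁⟩ := exists_crosstalk_remainder_bound n (q := 2 * (K + 2)) (by omega)
  obtain ⟨c₂, hc₂, H₂⟩ := exists_variance_lower_tail n hn
  obtain ⟨C₃, hC₃, H₃⟩ := exists_fourth_moment_tail n hn (q := K + 1) (by omega)
  have hn0 : (0 : ℝ) < n := by positivity
  have hn2 : (2 : ℝ) ≤ n := by exact_mod_cast hn
  set A₁ : ℝ := C₁ * (500 / (9 * n ^ 3)) ^ (2 * (K + 2)) with hA₁
  have hρ0 : 0 < 1 - anticoncentrationConst := by linarith [anticoncentrationConst_lt_one]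
  have hρ1 : 1 - anticoncentrationConst < 1 := by linarith [anticoncentrationConst_pos]
  have hlim : Filter.Tendsto (fun N : ℕ => A₁ * (1 / (N : ℝ)) +
      (N : ℝ) ^ K * Real.exp (-(c₂ / n * N)) + C₃ * n ^ (K + 1) * (1 / (N : ℝ)) +
      (N : ℝ) ^ K * (1 - anticoncentrationConst) ^ Nat.sqrt (Nat.sqrt N)) Filter.atTop
      (nhds (A₁ * 0 + 0 + C₃ * n ^ (K + 1) * 0 + 0)) := by
    have h1 : Filter.Tendsto (fun N : ℕ => (1 : ℝ) / N) Filter.atTop (nhds 0) :=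
      tendsto_one_div_atTop_nhds_zero_nat
    exact (((h1.const_mul _).add (tendsto_pow_mul_exp_neg K (by positivity))).add
      (h1.const_mul _)).add (tendsto_pow_mul_pow_sqrt_sqrt K hρ0 hρ1)
  obtain ⟨N₁, hN₁⟩ := Filter.eventually_atTop.1 (hlim.eventually (ge_mem_nhds
    (show A₁ * 0 + 0 + C₃ * n ^ (K + 1) * 0 + 0 < ε by simpa using hε)))
  obtain ⟨N₂, hN₂⟩ := Filter.eventually_atTop.1
    (tendsto_sqrt_sqrt.eventually (Filter.eventually_ge_atTop (100 * n)))
  refine ⟨N₁ + N₂, fun N hN κ _ _ hM => ?_⟩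
  have hfin := hN₁ N (by omega)
  have hk := hN₂ N (by omega)
  set k := Nat.sqrt (Nat.sqrt N) with hkdef
  have hk4 : k ^ 4 ≤ N := sqrt_sqrt_pow_four_le N
  have hkR : 100 * (n : ℝ) ≤ k := by exact_mod_cast hk
  have hk4R : (k : ℝ) ^ 4 ≤ N := by exact_mod_cast hk4
  have hk200 : (200 : ℝ) ≤ k := by linarith
  have hk2 : (k : ℝ) * (100 * n) ≤ k ^ 2 := by rw [sq]; gcongr
  have hk3 : 200 * (k : ℝ) ^ 2 ≤ k ^ 4 := by
    have : (k : ℝ) ^ 4 = k ^ 2 * k ^ 2 := by ring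
    rw [this]
    have : (200 : ℝ) ≤ k ^ 2 := by nlinarith
    gcongr
  have hkN' : (k : ℝ) ≤ N := by nlinarith
  have hN0 : (0 : ℝ) < N := by linarith
  have hN1 : 1 ≤ N := by exact_mod_cast hN0
  have hkN : k ≤ N := by exact_mod_cast hkN'
  obtain ⟨I, -, hI⟩ := Finset.exists_subset_card_eq
    (show k ≤ (Finset.univ : Finset (Fin N)).card by simpa using hkN)
  have hnR : ((n - 1 : ℕ) : ℝ) = n - 1 := by rw [Nat.cast_sub (by omega)]; simp
  have hNn : 100 * (n : ℝ) * (k + n) ≤ N := by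
    have : 100 * (n : ℝ) * (k + n) ≤ k * (k + k) := by
      gcongr
      linarith
    nlinarith
  set P := (N : ℝ) ^ (n - 1) with hP
  have hPN : (N : ℝ) ≤ P := by
    rw [hP]
    exact le_self_pow₀ (by exact_mod_cast hN1) (by omega)
  have hP0 : 0 < P := by positivity
  set M : ℝ := ((Fintype.card κ : ℕ) : ℝ) with hMdef
  -- The index type leaves out the target, so `M` stands for `p - 1`; the missing `1` is absorbed in
  -- lowering `2` to `99 / 50`.
  have hMP : 99 / 50 * P / n ≤ M := by
    have h1 : 1 ≤ 1 / 50 * P / n := by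
      rw [le_div_iff₀ hn0]
      nlinarith
    have e : 2 * P / n = 99 / 50 * P / n + 1 / 50 * P / n := by ring
    rw [e] at hM
    linarith
  have hMN : N / n ≤ M := by
    refine le_trans ?_ hMP
    gcongr
    linarith
  have hM0 : 0 < M := lt_of_lt_of_le (by positivity) hMN
  have hne : Nonempty κ := Fintype.card_pos_iff.1 (Nat.cast_pos.1 hM0)
  set V := M * (9 / 5 * n ^ 3 * P) with hV
  have hV0 : 0 < V := by positivity
  -- Budget of constants: `6/5 * 9/5 * 99/50 > 4` here, and `11/10 * 6/5 + 11/100 < 3/2` in `hthr`.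
  have hlead : (2 * n * P) ^ 2 ≤ 6 / 5 * V := by
    have h1 : 99 / 50 * P ≤ M * n := by rwa [div_le_iff₀ hn0] at hMP
    have h2 : 6 / 5 * V = (54 / 25 * n ^ 2 * P) * (M * n) := by rw [hV]; ring
    rw [h2]
    have h3 : (54 / 25 * (n : ℝ) ^ 2 * P) * (99 / 50 * P) ≤ (54 / 25 * n ^ 2 * P) * (M * n) := by
      gcongr
    refine le_trans ?_ h3
    have h4 : 0 ≤ (n : ℝ) ^ 2 * P ^ 2 := by positivity
    have h5 : (2 * n * P) ^ 2 = 4 * ((n : ℝ) ^ 2 * P ^ 2) := by ring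
    have h6 : (54 / 25 * (n : ℝ) ^ 2 * P) * (99 / 50 * P) =
        2673 / 625 * ((n : ℝ) ^ 2 * P ^ 2) := by ring
    rw [h5, h6]
    linarith
  set τ := Real.sqrt (V / 100) with hτ
  have hτ0 : 0 < τ := Real.sqrt_pos.2 (by positivity)
  have hτ2 : τ ^ 2 = V / 100 := Real.sq_sqrt (by positivity)
  have hthr : (2 * n * P + τ) ^ 2 ≤ 3 / 2 * V := by
    have aux : ∀ a : ℝ, a ^ 2 ≤ 6 / 5 * V → (a + τ) ^ 2 ≤ 3 / 2 * V := fun a ha => by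
      have h1 : (a + τ) ^ 2 + (a - 10 * τ) ^ 2 / 10 = 11 / 10 * a ^ 2 + 11 * τ ^ 2 := by ring
      have h2 : 0 ≤ (a - 10 * τ) ^ 2 / 10 := by positivity
      linarith
    exact aux _ hlead
  have hbern : 99 / 100 * P ≤ ((N : ℝ) - I.card - (n - 1 : ℕ)) ^ (n - 1) := by
    rw [hI, hnR]
    have h1 : (N : ℝ) - k - (n - 1) = N * (1 + -((k + (n - 1)) / N)) := by field_simp; ring
    rw [h1, mul_pow, mul_comm (99 / 100) P]
    have hu : ((n : ℝ) - 1) * ((k + (n - 1)) / N) ≤ 1 / 100 := by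
      rw [← mul_div_assoc, div_le_iff₀ hN0]
      nlinarith
    have h2 : -2 ≤ -(((k : ℝ) + (n - 1)) / N) := by
      have : ((k : ℝ) + (n - 1)) / N ≤ 1 := by
        rw [div_le_one hN0]; nlinarith
      linarith
    have h3 := one_add_mul_le_pow h2 (n - 1)
    rw [hnR] at h3
    gcongr
    linarith
  have hcardN : I.card + (n - 1) ≤ N := by
    have : ((I.card + (n - 1) : ℕ) : ℝ) ≤ N := by
      push_cast
      rw [hI, hnR]
      nlinarith
    exact_mod_cast this
  have hIsq : ((I.card : ℝ) + 1) ^ 2 ≤ N := by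
    rw [hI]
    nlinarith
  have e₁ : ∀ i ∈ I, uniformProb (fun η : κ → State N => τ ≤ |∑ μ, spin (η μ i) *
      (gap n (partSum (Finset.univ.erase i) (η μ)) - gap n (partSum Iᶜ (η μ)))|) ≤
      A₁ / N ^ (K + 2) := by
    intro i hi
    refine (H₁ N I hIsq i hi τ hτ0).trans ?_
    have h1 : M * (I.card : ℝ) ^ 2 * N ^ (n - 2) / τ ^ 2 = 500 / (9 * n ^ 3) * (k ^ 2 / N) := by
      have : P = N ^ (n - 2) * N := by
        rw [hP, ← pow_succ]; congr 1; omega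
      rw [hτ2, hV, hI, this]
      field_simp
      ring
    rw [h1, mul_pow, ← mul_assoc, ← hA₁, div_eq_mul_inv A₁]
    gcongr
    rw [pow_mul, ← inv_pow]
    apply pow_le_pow_left₀ (by positivity)
    rw [div_pow, ← pow_mul, div_le_iff₀ (by positivity)]
    calc (k : ℝ) ^ (2 * 2) ≤ N := hk4R
      _ = (N : ℝ)⁻¹ * N ^ 2 := by field_simp
  have key := uniformProb_withstand_le (κ := κ) n hN1 I hV0 hthr e₁
    (H₂ N hN1 I hcardN hbern) (H₃ N hN1 I)
  rw [hI] at key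
  refine (mul_le_mul_of_nonneg_left key (by positivity)).trans (le_trans ?_ hfin)
  rw [mul_add, mul_add, mul_add]
  have t1 : (N : ℝ) ^ K * (k * (A₁ / N ^ (K + 2))) ≤ A₁ * (1 / N) := by
    calc (N : ℝ) ^ K * (k * (A₁ / N ^ (K + 2))) ≤ (N : ℝ) ^ K * (N * (A₁ / N ^ (K + 2))) := by
          gcongr
      _ = _ := by rw [pow_add]; field_simp
  have t2 : (N : ℝ) ^ K * Real.exp (-(c₂ * M)) ≤ (N : ℝ) ^ K * Real.exp (-(c₂ / n * N)) := by
    have h1 : c₂ / n * N ≤ c₂ * M := by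
      calc c₂ / n * N = c₂ * (N / n) := by ring
        _ ≤ c₂ * M := by gcongr
    exact mul_le_mul_of_nonneg_left (Real.exp_le_exp.2 (neg_le_neg h1)) (by positivity)
  have t3 : (N : ℝ) ^ K * (C₃ / M ^ (K + 1)) ≤ C₃ * n ^ (K + 1) * (1 / N) := by
    calc (N : ℝ) ^ K * (C₃ / M ^ (K + 1)) ≤ (N : ℝ) ^ K * (C₃ / (N / n) ^ (K + 1)) := by gcongr
      _ = _ := by rw [div_pow, pow_succ (N : ℝ)]; field_simp
  linarith

end Instability

/-- Random patterns above the critical load. -/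
lemma exists_unstable_bound (n : ℕ) (hn : 2 ≤ n) (K : ℕ) (ε : ℝ) (hε : 0 < ε) :
    ∃ N₀ : ℕ, ∀ N : ℕ, N₀ ≤ N → ∀ p : ℕ, 2 * (N : ℝ) ^ (n - 1) / n < p → ∀ ν : Fin p,
      (N : ℝ) ^ K * uniformProb (fun ξ : Fin p → State N => IsStable n ξ ν) ≤ ε := by
  obtain ⟨N₀, h⟩ := exists_withstand_bound n hn K ε hε
  refine ⟨N₀, fun N hN p hp ν => ?_⟩
  rw [uniformProb_isStable]
  apply h N hN
  have h1 : Fintype.card {μ : Fin p // μ ≠ ν} + 1 = p := by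
    have := ν.pos
    rw [Fintype.card_subtype_compl, Fintype.card_fin, Fintype.card_subtype_eq]
    omega
  have h2 : (Fintype.card {μ : Fin p // μ ≠ ν} : ℝ) + 1 = p := by exact_mod_cast h1
  rwa [h2]

lemma expectedStable_eq (n N p : ℕ) : expectedStable n N p =
    ∑ ν : Fin p, uniformProb (fun ξ : Fin p → State N => IsStable n ξ ν) := by
  classical
  simp only [uniformProb_eq_mean]
  rw [← mean_sum]
  unfold expectedStable mean
  congr 1
  refine Finset.sum_congr rfl fun ξ _ => ?_
  simp

/-! ### Stability below the capacity. -/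

section Capacity

variable {N : ℕ} {κ : Type} [Fintype κ] [DecidableEq κ]

lemma uniformProb_lt_abs_partSum_le (hN : 1 ≤ N) (J : Finset (Fin N)) {r : ℝ} (hr : 0 ≤ r) :
    uniformProb (fun x : State N => r < |partSum J x|) ≤ 2 * Real.exp (-(r ^ 2 / (2 * N))) := by
  have hN0 : (0 : ℝ) < N := by exact_mod_cast hN
  have hcard : (J.card : ℝ) ≤ N := by
    have := Finset.card_le_univ J
    rw [Fintype.card_fin] at this
    exact_mod_cast this
  have h1 := hoeffding (fun j => if j ∈ J then (1 : ℝ) else 0) hN0 hr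
    (by rw [sum_indicator_sq]; exact hcard)
  have h2 := hoeffding (fun j => -(if j ∈ J then (1 : ℝ) else 0)) hN0 hr
    (by simp only [neg_sq]; rw [sum_indicator_sq]; exact hcard)
  simp only [neg_mul, Finset.sum_neg_distrib] at h2
  simp only [← partSum_eq] at h1 h2
  have h3 := uniformProb_or_le (fun x : State N => r ≤ partSum J x) (fun x => r ≤ -partSum J x)
  have h4 : uniformProb (fun x : State N => r < |partSum J x|) ≤
      uniformProb (fun x : State N => r ≤ partSum J x ∨ r ≤ -partSum J x) :=
    uniformProb_mono fun x hx => by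
      rcases lt_abs.1 hx with h | h
      · exact Or.inl h.le
      · exact Or.inr h.le
  linarith

lemma uniformProb_pi_apply {Ω : Type*} [Fintype Ω] [Nonempty Ω] (μ : κ) (A : Ω → Prop) :
    uniformProb (fun ω : κ → Ω => A (ω μ)) = uniformProb A := by
  classical
  simp only [uniformProb_eq_mean]
  exact mean_pi_apply μ (fun ω => if A ω then (1 : ℝ) else 0)

/-- Tail bound for the crosstalk at one neuron. -/
lemma uniformProb_crosstalk_le (n : ℕ) (hN : 1 ≤ N) (i : Fin N) {r W t : ℝ} (hr : 1 ≤ r)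
    (ht : 0 ≤ t) (hW : 0 < W)
    (hWM : Fintype.card κ * ((2 * n) ^ 2 * (2 * r) ^ (2 * (n - 1))) ≤ W) :
    uniformProb (fun η : κ → State N => crosstalk n η i < -t) ≤
      Fintype.card κ * (2 * Real.exp (-(r ^ 2 / (2 * N)))) + Real.exp (-(t ^ 2 / (2 * W))) := by
  classical
  set J := Finset.univ.erase i with hJ
  -- The truncation event does not involve the entries at `i`, and on it all gaps are bounded, so
  -- Hoeffding applies to the resampled signs at `i`.
  have hincl : ∀ η : κ → State N, crosstalk n η i < -t →
      (∃ μ, r < |partSum J (η μ)|) ∨ ((∀ μ, |partSum J (η μ)| ≤ r) ∧ crosstalk n η i < -t) := by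
    intro η h
    by_cases hex : ∃ μ, r < |partSum J (η μ)|
    · exact Or.inl hex
    · push Not at hex
      exact Or.inr ⟨hex, h⟩
  refine (uniformProb_mono hincl).trans ((uniformProb_or_le _ _).trans (add_le_add ?_ ?_))
  · refine (uniformProb_exists_le _).trans ?_
    refine (Finset.sum_le_card_nsmul _ _ (2 * Real.exp (-(r ^ 2 / (2 * N)))) fun μ _ => ?_).trans ?_
    · rw [uniformProb_pi_apply μ (fun x : State N => r < |partSum J x|)]
      exact uniformProb_lt_abs_partSum_le hN J (by linarith)
    · rw [nsmul_eq_mul, Finset.card_univ]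
  · rw [uniformProb_eq_mean, mean_eq_mean_mean (fun ε => flipOn {i} ε)]
    refine (mean_mono fun η => ?_).trans (mean_const _).le
    have hb : ∀ ε μ, partSum J (flipOn {i} ε η μ) = partSum J (η μ) := fun ε μ =>
      partSum_congr fun j hj => by
        rw [flipOn_apply, if_neg]
        rw [Finset.mem_singleton]
        exact Finset.ne_of_mem_erase hj
    simp only [hb]
    by_cases hgood : ∀ μ, |partSum J (η μ)| ≤ r
    · simp only [hgood, implies_true, true_and]
      let b : κ → ℝ := fun μ => -(spin (η μ i) * gap n (partSum J (η μ)))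
      have e : ∀ ε : Fin N → κ → ℤˣ, crosstalk n (flipOn {i} ε η) i =
          -∑ μ, b μ * spin (ε i μ) := by
        intro ε
        unfold crosstalk
        rw [← Finset.sum_neg_distrib]
        refine Finset.sum_congr rfl fun μ _ => ?_
        rw [← hJ, hb, flipOn_apply, if_pos (Finset.mem_singleton_self i), spin_mul]
        simp only [b]
        ring
      simp only [e]
      rw [mean_indicator]
      have h1 : uniformProb (fun ε : Fin N → κ → ℤˣ => -∑ μ, b μ * spin (ε i μ) < -t) ≤
          uniformProb (fun ε : Fin N → κ → ℤˣ => t ≤ ∑ μ, b μ * spin (ε i μ)) :=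
        uniformProb_mono fun ε h => (neg_lt_neg_iff.1 h).le
      rw [uniformProb_pi_apply i (fun ε : κ → ℤˣ => t ≤ ∑ μ, b μ * spin (ε μ))] at h1
      refine h1.trans (hoeffding b hW ht ?_)
      have h2 : ∀ μ, b μ ^ 2 ≤ (2 * n) ^ 2 * (2 * r) ^ (2 * (n - 1)) := by
        intro μ
        simp only [b, neg_sq, mul_pow (spin _), spin_sq, one_mul]
        rw [← sq_abs]
        have h3 : |gap n (partSum J (η μ))| ≤ 2 * n * (2 * r) ^ (n - 1) := by
          refine (abs_gap_le n _).trans ?_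
          have := hgood μ
          gcongr
          linarith
        calc |gap n (partSum J (η μ))| ^ 2 ≤ (2 * n * (2 * r) ^ (n - 1)) ^ 2 := by gcongr
          _ = _ := by ring
      refine (Finset.sum_le_card_nsmul _ _ _ fun μ _ => h2 μ).trans ?_
      rw [nsmul_eq_mul, Finset.card_univ]
      exact hWM
    · simp only [hgood, false_and, if_false, mean_const]
      exact (Real.exp_pos _).le

end Capacity

/-- Random patterns below the capacity are all stable with high probability. -/
lemma exists_all_stable (n : ℕ) (hn : 2 ≤ n) : ∃ c : ℝ, 0 < c ∧ ∀ ε : ℝ, 0 < ε → ∃ N₀ : ℕ,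
    ∀ N : ℕ, N₀ ≤ N → ∀ p : ℕ, (p : ℝ) ≤ c * (N : ℝ) ^ (n - 1) / (Real.log (N : ℝ)) ^ n →
      1 - ε ≤ uniformProb (fun ξ : Fin p → State N => ∀ ν : Fin p, IsStable n ξ ν) := by
  have hn0 : (0 : ℝ) < n := by positivity
  -- All tails become `exp (-A log N) = N ^ (-(2n + 2))`. Interfering patterns, neurons and tested
  -- patterns cost at most `3 P * N * P` in the union bound, which leaves `3 / N ^ 3`.
  set A : ℝ := 2 * n + 2 with hA
  have hA0 : 0 < A := by positivity
  set D : ℝ := (2 * n) ^ 2 * (8 * A) ^ (n - 1) with hD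
  have hD1 : 1 ≤ D := by
    have h1 : (1 : ℝ) ≤ (2 * n) ^ 2 := one_le_pow₀ (by
      have : (2 : ℝ) ≤ n := by exact_mod_cast hn
      linarith)
    have h2 : (1 : ℝ) ≤ (8 * A) ^ (n - 1) := one_le_pow₀ (by rw [hA]; linarith)
    nlinarith
  have hc1 : 1 / (2 * A * D) ≤ 1 := by
    rw [div_le_one (by positivity)]
    have : 1 ≤ 2 * A := by rw [hA]; linarith
    nlinarith
  refine ⟨1 / (2 * A * D), by positivity, fun ε hε => ?_⟩
  obtain ⟨N₁, hN₁⟩ := exists_nat_ge (3 / ε)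
  refine ⟨N₁ + 2 * n + 3, fun N hN p hp => ?_⟩
  have hN1 : 1 ≤ N := by omega
  have hNR : (1 : ℝ) ≤ N := by exact_mod_cast hN1
  have hN0 : (0 : ℝ) < N := by linarith
  set L := Real.log N with hL
  have hL1 : 1 ≤ L := by
    rw [hL, Real.le_log_iff_exp_le hN0]
    have h3 : (3 : ℝ) ≤ N := by exact_mod_cast (by omega : 3 ≤ N)
    have := Real.exp_one_lt_d9
    linarith
  have hL0 : 0 < L := by linarith
  set P := (N : ℝ) ^ (n - 1) with hP
  have hP1 : 1 ≤ P := one_le_pow₀ hNR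
  have hpP : (p : ℝ) ≤ P := by
    refine hp.trans ?_
    rw [div_le_iff₀ (by positivity)]
    have : 1 ≤ L ^ n := one_le_pow₀ hL1
    calc 1 / (2 * A * D) * P ≤ 1 * P := by gcongr
      _ ≤ P * L ^ n := by rw [one_mul]; exact le_mul_of_one_le_right (by linarith) this
  -- `r` makes the overlap tail `exp (-A L)`, and `W` is the variance for which Hoeffding at
  -- threshold `P` gives the same. The condition on `W` then reads `p ≤ P / (2 A D L ^ n)`: `n - 1`
  -- logarithms stem from `r`, one from `W`.
  set r := Real.sqrt (2 * A * L * N) with hr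
  have hr2 : r ^ 2 = 2 * A * L * N := Real.sq_sqrt (by positivity)
  have hr1 : 1 ≤ r := by
    rw [hr, Real.one_le_sqrt]
    have h1 : 1 ≤ 2 * A := by rw [hA]; linarith
    have h2 : 1 ≤ 2 * A * L := one_le_mul_of_one_le_of_one_le h1 hL1
    exact one_le_mul_of_one_le_of_one_le h2 hNR
  set W := P ^ 2 / (2 * A * L) with hW
  have hW0 : 0 < W := by positivity
  have hexp : Real.exp (-(A * L)) = 1 / (N : ℝ) ^ (2 * n + 2) := by
    rw [Real.exp_neg, one_div]
    congr 1
    have : A * L = ((2 * n + 2 : ℕ) : ℝ) * L := by rw [hA]; push_cast; ring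
    rw [this, Real.exp_nat_mul, hL, Real.exp_log hN0]
  have hgap : P ≤ gap n ((N : ℝ) - 1) := by
    refine le_trans ?_ (gap_ge n (by linarith))
    have h1 : (N : ℝ) - 1 = N * (1 + -(1 / N)) := by
      rw [mul_add, mul_neg, mul_one_div_cancel hN0.ne']; ring
    have h2 : -2 ≤ -(1 / (N : ℝ)) := by
      have : 1 / (N : ℝ) ≤ 1 := by rw [div_le_one hN0]; exact hNR
      linarith
    have h3 := one_add_mul_le_pow h2 (n - 1)
    have h4 : ((n - 1 : ℕ) : ℝ) * (1 / N) ≤ 1 / 2 := by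
      rw [mul_one_div, div_le_iff₀ hN0]
      have h5 : ((n - 1 : ℕ) : ℝ) ≤ n := by exact_mod_cast Nat.sub_le _ _
      have h6 : 2 * (n : ℝ) ≤ N := by exact_mod_cast (by omega : 2 * n ≤ N)
      linarith
    have h5 : 1 / 2 ≤ (1 + -(1 / (N : ℝ))) ^ (n - 1) := by linarith
    rw [h1, mul_pow]
    have h6 : (2 : ℝ) ≤ n := by exact_mod_cast hn
    calc P ≤ 2 * 2 * (P * (1 / 2)) := by linarith
      _ ≤ 2 * n * (P * (1 + -(1 / (N : ℝ))) ^ (n - 1)) := by gcongr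
  set F : ℝ := (2 * P + 1) * (1 / (N : ℝ) ^ (2 * n + 2)) with hF
  have hstable : ∀ ν : Fin p,
      1 - N * F ≤ uniformProb (fun ξ : Fin p → State N => IsStable n ξ ν) := by
    intro ν
    rw [uniformProb_isStable]
    have hcard : (Fintype.card {μ : Fin p // μ ≠ ν} : ℝ) ≤ p := by
      have := Fintype.card_subtype_le (fun μ : Fin p => μ ≠ ν)
      rw [Fintype.card_fin] at this
      exact_mod_cast this
    have hone : ∀ i : Fin N, uniformProb (fun η : {μ // μ ≠ ν} → State N =>
        crosstalk n η i < -P) ≤ F := by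
      intro i
      refine (uniformProb_crosstalk_le n hN1 i hr1 (by linarith) hW0 ?_).trans ?_
      · have h1 : (2 * (n : ℝ)) ^ 2 * (2 * r) ^ (2 * (n - 1)) = D * L ^ (n - 1) * P := by
          rw [pow_mul, mul_pow 2 r 2, hr2, hD, hP,
            show (2 : ℝ) ^ 2 * (2 * A * L * N) = (8 * A) * L * N by ring, mul_pow, mul_pow]
          ring
        rw [h1]
        calc _ ≤ (1 / (2 * A * D) * P / L ^ n) * (D * L ^ (n - 1) * P) := by
              gcongr
              exact hcard.trans hp
          _ = W := by
              have : L ^ n = L ^ (n - 1) * L := by rw [← pow_succ]; congr 1; omega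
              rw [this, hW]
              field_simp
      · have e1 : r ^ 2 / (2 * N) = A * L := by rw [hr2]; field_simp
        have e2 : P ^ 2 / (2 * W) = A * L := by rw [hW]; field_simp
        rw [e1, e2, hexp, hF]
        have h2 : (Fintype.card {μ : Fin p // μ ≠ ν} : ℝ) ≤ P := hcard.trans hpP
        have h3 : (0 : ℝ) < 1 / (N : ℝ) ^ (2 * n + 2) := by positivity
        nlinarith
    have hnot := uniformProb_not (fun η : {μ // μ ≠ ν} → State N =>
      ∀ i, 0 ≤ gap n (N - 1) + crosstalk n η i)
    have hle : uniformProb (fun η : {μ // μ ≠ ν} → State N =>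
        ¬ ∀ i, 0 ≤ gap n (N - 1) + crosstalk n η i) ≤ N * F := by
      refine (uniformProb_mono (B := fun η => ∃ i, crosstalk n η i < -P) fun η h => ?_).trans
        ((uniformProb_exists_le _).trans
          ((Finset.sum_le_card_nsmul _ _ _ fun i _ => hone i).trans ?_))
      · push Not at h
        obtain ⟨i, hi⟩ := h
        exact ⟨i, by linarith⟩
      · rw [nsmul_eq_mul, Finset.card_univ, Fintype.card_fin]
    linarith
  have hnot := uniformProb_not (fun ξ : Fin p → State N => ∀ ν : Fin p, IsStable n ξ ν)
  have hle : uniformProb (fun ξ : Fin p → State N => ¬ ∀ ν : Fin p, IsStable n ξ ν) ≤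
      p * (N * F) := by
    refine (uniformProb_mono (B := fun ξ => ∃ ν : Fin p, ¬ IsStable n ξ ν) fun ξ h =>
      not_forall.1 h).trans ((uniformProb_exists_le _).trans
        ((Finset.sum_le_card_nsmul _ _ (N * F) fun ν _ => ?_).trans ?_))
    · rw [uniformProb_not]
      linarith [hstable ν]
    · rw [nsmul_eq_mul, Finset.card_univ, Fintype.card_fin]
  have hfinal : p * (N * F) ≤ ε := by
    have hF0 : 0 ≤ F := by positivity
    have hF1 : F ≤ 3 * P * (1 / (N : ℝ) ^ (2 * n + 2)) := by
      rw [hF]; gcongr; linarith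
    have e : P * (N * (3 * P * (1 / (N : ℝ) ^ (2 * n + 2)))) = 3 / N ^ 3 := by
      have h1 : (N : ℝ) ^ (2 * n + 2) = P * P * N * N ^ 3 := by
        rw [hP, ← pow_add, ← pow_succ, ← pow_add]; congr 1; omega
      rw [h1]
      field_simp
    calc p * (N * F) ≤ P * (N * (3 * P * (1 / (N : ℝ) ^ (2 * n + 2)))) := by gcongr
      _ = 3 / N ^ 3 := e
      _ ≤ 3 / N := by
        gcongr
        exact le_self_pow₀ hNR (by norm_num)
      _ ≤ ε := by
        rw [div_le_iff₀ hN0]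
        have h1 : 3 / ε ≤ N := hN₁.trans (by exact_mod_cast (by omega : N₁ ≤ N))
        rw [div_le_iff₀ hε] at h1
        linarith
  linarith

end DAM

theorem theorem3 (n : ℕ) (hn : 2 ≤ n) :
    -- Retrieval under separation and interference at every load `p`, in particular for all `p` up
    -- to (and beyond) `N^(n-1) / (4 n^2 (n-1)^2)`:
    -- updates by the sign of the formal field, every system size `N`
    (∀ γ Λ : ℝ, 0 < γ → 0 ≤ Λ → Λ < γ ^ (n - 1) →
      ∀ (N p : ℕ) (ξ : Fin p → DAM.State N) (ν : Fin p) (β : ℝ), β < γ →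
        DAM.PatternSeparation ξ ν γ β → DAM.InterferenceBound n ξ ν γ Λ →
        DAM.RetrievalGuarantee (DAM.formalField n ξ) (ξ ν) γ) ∧
    -- best-response updates, `N` large in terms of `n`, `γ`, `Λ` only
    (∀ γ Λ : ℝ, 0 < γ → γ < 1 → 0 ≤ Λ → Λ < γ ^ (n - 1) →
      ∃ N₀ : ℕ, ∀ N : ℕ, N₀ ≤ N →
        ∀ (p : ℕ) (ξ : Fin p → DAM.State N) (ν : Fin p) (β : ℝ), β < γ →
          DAM.PatternSeparation ξ ν γ β → DAM.InterferenceBound n ξ ν γ Λ →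
          DAM.RetrievalGuarantee (DAM.discreteField n ξ) (ξ ν) γ) ∧
    -- random patterns above `2 N^(n-1) / n`: each stored pattern is unstable with high probability
    (∀ ε : ℝ, 0 < ε → ∃ N₀ : ℕ, ∀ N : ℕ, N₀ ≤ N →
      ∀ p : ℕ, 2 * (N : ℝ) ^ (n - 1) / (n : ℝ) < (p : ℝ) → ∀ ν : Fin p,
        DAM.uniformProb (fun ξ : Fin p → DAM.State N => DAM.IsStable n ξ ν) ≤ ε) ∧
    -- and, at polynomial load, the expected number of stable patterns vanishes
    (∀ K : ℕ, ∀ ε : ℝ, 0 < ε → ∃ N₀ : ℕ, ∀ N : ℕ, N₀ ≤ N →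
      ∀ p : ℕ, 2 * (N : ℝ) ^ (n - 1) / (n : ℝ) < (p : ℝ) → p ≤ N ^ K →
        DAM.expectedStable n N p ≤ ε) ∧
    -- random patterns up to `c N^(n-1) / (log N)^n`: all stored patterns are stable
    (∃ c : ℝ, 0 < c ∧ ∀ ε : ℝ, 0 < ε → ∃ N₀ : ℕ, ∀ N : ℕ, N₀ ≤ N →
      ∀ p : ℕ, (p : ℝ) ≤ c * (N : ℝ) ^ (n - 1) / (Real.log (N : ℝ)) ^ n →
        1 - ε ≤ DAM.uniformProb
          (fun ξ : Fin p → DAM.State N => ∀ ν : Fin p, DAM.IsStable n ξ ν)) := by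
  refine ⟨?_, ?_, ?_, ?_, DAM.exists_all_stable n hn⟩
  · intro γ Λ hγ _ hΛ N p ξ ν β _ _ hI
    exact DAM.retrievalGuarantee_of_pos hγ fun x hx i => DAM.formalField_pos hn hγ hΛ hI x hx i
  · intro γ Λ hγ hγ1 hΛ0 hΛ
    obtain ⟨N₀, h⟩ := DAM.best_response_pos n hn hγ hγ1 hΛ0 hΛ
    refine ⟨N₀, fun N hN p ξ ν β _ _ hI => ?_⟩
    exact DAM.retrievalGuarantee_of_pos hγ fun x hx i => h N hN p ξ ν hI x hx i
  · intro ε hε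
    obtain ⟨N₀, h⟩ := DAM.exists_unstable_bound n hn 0 ε hε
    refine ⟨N₀, fun N hN p hp ν => ?_⟩
    simpa using h N hN p hp ν
  · intro K ε hε
    -- The decay beyond `N ^ (-K)` pays for the sum over at most `N ^ K` patterns.
    obtain ⟨N₀, h⟩ := DAM.exists_unstable_bound n hn K ε hε
    refine ⟨N₀ + 1, fun N hN p hp hpK => ?_⟩
    have hN0 : (0 : ℝ) < N := by exact_mod_cast (by omega : 0 < N)
    have hpK' : (p : ℝ) ≤ (N : ℝ) ^ K := by exact_mod_cast hpK
    rw [DAM.expectedStable_eq]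
    refine (Finset.sum_le_card_nsmul _ _ (ε / (N : ℝ) ^ K) fun ν _ => ?_).trans ?_
    · rw [le_div_iff₀ (by positivity), mul_comm]
      exact h N (by omega) p hp ν
    · rw [nsmul_eq_mul, Finset.card_univ, Fintype.card_fin, mul_div_assoc', div_le_iff₀ (by positivity),
        mul_comm ε]
      gcongr
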